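/- Let $\mathbb{F}_q$ be a finite field. All representations are over $\mathbb{C}$. An irreducible representation of $\mathrm{GL}_k(\mathbb{F}_q)$ is called cuspidal if it has no nonzero vector fixed by the unipotent radical of a proper parabolic subgroup. For representations $\rho_i$ of $\mathrm{GL}_{k_i}(\mathbb{F}_q)$, $\rho_1\times\cdots\times\rho_t$ denotes the representation of $\mathrm{GL}_{k_1+\cdots+k_t}(\mathbb{F}_q)$ induced from the representation $\rho_1\boxtimes\cdots\boxtimes\rho_t$ of the standard parabolic subgroup with Levi subgroup $\mathrm{GL}_{k_1}\times\cdots\times \mathrm{GL}_{k_t}$, its unipotent radical acting trivially. Let $n=n_1+\cdots+n_r$ be a sum of positive integers with $n \geq 1$, and let $\pi_i$ be an irreducible cuspidal representation of $\mathrm{GL}_{n_i}(\mathbb{F}_q)$ for $i=1,\dots,r$. Let $n-1=k_1+\cdots+k_s$ be a sum of positive integers (the empty sum if $n=1$), and let $\mu_j$ be an irreducible cuspidal representation of $\mathrm{GL}_{k_j}(\mathbb{F}_q)$ for $j=1,\dots,s$. Assume that $\mu_1,\dots,\mu_s$ are pairwise distinct (that is, pairwise non-isomorphic, where representations of general linear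 groups of different sizes count as distinct). Embed $\mathrm{GL}_{n-1}(\mathbb{F}_q)$ in $\mathrm{GL}_n(\mathbb{F}_q)$ by $g\mapsto \mathrm{diag}(g,1)$. Then: 1. $\mu_1\times\cdots\times\mu_s$ is irreducible. 2. $$\dim \mathrm{Hom}_{\mathrm{GL}_{n-1}(\mathbb{F}_q)}(\pi_1\times\cdots\times\pi_r,\ \mu_1\times\cdots\times\mu_s)=\prod_{j=1}^{s}(1+m_j)\ \geq\ 1,$$ where $m_j$ is the number of indices $i\in\{1,\dots,r\}$ with $\pi_i\cong\mu_j$. 3. If moreover $\pi_1,\dots,\pi_r$ are pairwise distinct, this dimension equals $2^d$, where $d$ is the cardinality of $\{\pi_1,\dots,\pi_r\}\cap\{\mu_1,\dots,\mu_s\}$ (as sets of isomorphism classes). 4. This dimension equals $1$ if and only if the sets $\{\pi_1,\dots,\pi_r\}$ and $\{\mu_1,\dots,\mu_s\}$ have no common element. -/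

import Mathlib

open scoped MatrixGroups

namespace FiniteGL

/-- The isomorphism `GL_ι(F) ≃ GL_κ(F)` obtained by relabelling rows and columns along `e`. -/
def reindexGL (F : Type*) [Field F] {ι κ : Type*} [Fintype ι] [DecidableEq ι] [Fintype κ]
    [DecidableEq κ] (e : ι ≃ κ) : GL ι F ≃* GL κ F :=
  Units.mapEquiv (Matrix.reindexRingEquiv F e).toMulEquiv

/-- The standard embedding `GL_N(F) → GL_{N+1}(F)`, sending `g` to the block matrix
`diag(g, 1)`. -/
def embedGL (F : Type*) [Field F] (N : ℕ) : GL (Fin N) F →* GL (Fin (N + 1)) F :=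
  (reindexGL F (finSumFinEquiv (m := N) (n := 1))).toMonoidHom.comp
    (Units.map
      { toFun := fun A : Matrix (Fin N) (Fin N) F => Matrix.fromBlocks A 0 0 1
        map_one' := Matrix.fromBlocks_one
        map_mul' := fun A B => by simp [Matrix.fromBlocks_multiply] })

section Parabolic

variable (F : Type*) [Field F] {r : ℕ} (n : Fin r → ℕ)

/-- The standard parabolic subgroup of type `(n 0, …, n (r-1))`: the invertible block upper
triangular matrices. The rows and columns are indexed by pairs (block, position in the block). -/
def parabolic : Subgroup (GL ((i : Fin r) × Fin (n i)) F) where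
  carrier := {g | (g : Matrix ((i : Fin r) × Fin (n i)) ((i : Fin r) × Fin (n i)) F).BlockTriangular
    Sigma.fst}
  one_mem' := by
    simpa using Matrix.blockTriangular_one
  mul_mem' {g h} hg hh := by
    simpa using Matrix.BlockTriangular.mul hg hh
  inv_mem' {g} hg := by
    have : Invertible (g : Matrix ((i : Fin r) × Fin (n i)) ((i : Fin r) × Fin (n i)) F) :=
      g.invertible
    simpa [Matrix.coe_units_inv] using Matrix.blockTriangular_inv_of_blockTriangular hg

/-- The projection of the standard parabolic subgroup onto the `i`-th factor of its Levi quotient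
`∏ i, GL_{n i}(F)`, sending a block upper triangular matrix to its `i`-th diagonal block. -/
def leviProj (i : Fin r) : parabolic F n →* GL (Fin (n i)) F :=
  MonoidHom.toHomUnits
    { toFun := fun p => Matrix.blockDiag' (p : GL ((i : Fin r) × Fin (n i)) F).val i
      map_one' := by simp
      map_mul' := fun p q => by
        ext a b
        simp only [Subgroup.coe_mul, Units.val_mul, Matrix.blockDiag'_apply, Matrix.mul_apply]
        rw [Fintype.sum_sigma, Finset.sum_eq_single i]
        · intro l _ hl
          refine Finset.sum_eq_zero fun c _ => ?_
          rcases lt_or_gt_of_ne hl with h | h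
          · have h0 : (p : GL ((i : Fin r) × Fin (n i)) F).val ⟨i, a⟩ ⟨l, c⟩ = 0 := p.2 h
            rw [h0, zero_mul]
          · have h0 : (q : GL ((i : Fin r) × Fin (n i)) F).val ⟨l, c⟩ ⟨i, b⟩ = 0 := q.2 h
            rw [h0, mul_zero]
        · simp }

variable {F n}

/-- The external tensor product `π 0 ⊠ ⋯ ⊠ π (r-1)` of representations of the groups
`GL_{n i}(F)`, inflated to the standard parabolic subgroup through its Levi quotient. -/
noncomputable def leviRep {V : Fin r → Type*} [∀ i, AddCommGroup (V i)] [∀ i, Module ℂ (V i)]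
    (π : ∀ i, Representation ℂ (GL (Fin (n i)) F) (V i)) :
    Representation ℂ (parabolic F n) (PiTensorProduct ℂ V) :=
  PiTensorProduct.mapMonoidHom.comp (MonoidHom.pi fun i => (π i).comp (leviProj F n i))

/-- The parabolically induced representation `π 0 × ⋯ × π (r-1)` of `GL_N(F)`, where
`N = n 0 + ⋯ + n (r-1)`: the group acts by right translation on the functions
`f : GL_N(F) → V 0 ⊗ ⋯ ⊗ V (r-1)` with `f (p g) = (π 0 ⊠ ⋯ ⊠ π (r-1)) (p) (f g)` for `p` in the
standard parabolic subgroup. The index set `{0, …, N-1}` is cut into consecutive blocks of sizes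
`n 0, …, n (r-1)` by `finSigmaFinEquiv`. -/
noncomputable def parabolicInduction {N : ℕ} (h : ∑ i, n i = N)
    {V : Fin r → Type*} [∀ i, AddCommGroup (V i)] [∀ i, Module ℂ (V i)]
    (π : ∀ i, Representation ℂ (GL (Fin (n i)) F) (V i)) :
    Representation ℂ (GL (Fin N) F)
      (Representation.coindV (parabolic F n).subtype (leviRep π)) :=
  (Representation.coind (parabolic F n).subtype (leviRep π)).comp
    (reindexGL F (finSigmaFinEquiv.trans (finCongr h)).symm).toMonoidHom

end Parabolic

/-- The unipotent radical of the standard maximal parabolic subgroup of type `(k, n - k)` in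
`GL_n(F)`: the matrices that agree with the identity outside the upper right `k × (n - k)` block. -/
def unipotentRadical (F : Type*) [Field F] (n k : ℕ) : Set (GL (Fin n) F) :=
  {g | ∀ i j : Fin n, ¬ ((i : ℕ) < k ∧ k ≤ (j : ℕ)) →
    g.val i j = (1 : Matrix (Fin n) (Fin n) F) i j}

/-- A representation of `GL_n(F)` is cuspidal if it has no nonzero vector fixed by the unipotent
radical of a proper parabolic subgroup. Up to conjugacy, it is enough to consider the standard
maximal parabolic subgroups, as their unipotent radicals are contained in the others. -/
def IsCuspidal {F : Type*} [Field F] {n : ℕ} {V : Type*} [AddCommGroup V] [Module ℂ V]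
    (ρ : Representation ℂ (GL (Fin n) F) V) : Prop :=
  ∀ k, 0 < k → k < n → ∀ v : V, (∀ g ∈ unipotentRadical F n k, ρ g v = v) → v = 0

/-- Two representations of `GL_a(F)` and `GL_b(F)` are the same if `a = b` and they are
isomorphic. -/
def SameRep {F : Type*} [Field F] {a b : ℕ} {V W : Type*} [AddCommGroup V] [Module ℂ V]
    [AddCommGroup W] [Module ℂ W] (ρ : Representation ℂ (GL (Fin a) F) V)
    (σ : Representation ℂ (GL (Fin b) F) W) : Prop :=
  ∃ h : a = b, Nonempty (Representation.Equiv ρ (σ.comp (reindexGL F (finCongr h)).toMonoidHom))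

/-- The dimension of `Hom_{GL_N(F)}(Π, M)` for a representation `Π` of `GL_{N+1}(F)` and a
representation `M` of `GL_N(F)`. -/
noncomputable def dimHom {F : Type*} [Field F] {N : ℕ} {V W : Type*} [AddCommGroup V] [Module ℂ V]
    [AddCommGroup W] [Module ℂ W] (Pi : Representation ℂ (GL (Fin (N + 1)) F) V)
    (M : Representation ℂ (GL (Fin N) F) W) : ℕ :=
  Module.finrank ℂ (Representation.IntertwiningMap (Pi.comp (embedGL F N)) M)

end FiniteGL

namespace FiniteGL

universe u

/-! Everything is done with characters, extended by zero to functions of endomorphisms of finite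
`F`-vector spaces. On such functions parabolic induction is the Hall product: a sum over stable
subspaces `U` of the value of one factor on `U` times the value of the other on the quotient. Hom
dimensions become the bilinear `pairing`, with the character of one side replaced by that of its
dual.

Two structures drive the computation. The first is the Bernstein–Zelevinsky derivative, built here
from partial Fourier transforms along the last column. It satisfies a Leibniz rule for Hall products
(`derivative_hall`). A cuspidal function of degree `n` has only two nonzero derivatives: itself in
order 0, and the unit of the Hall product in order `n`. Hence the derivatives of a product of
cuspidal `f i` are the homogeneous parts of `∏ (1 + f i)` (`derivative_hallProd`). Fourier inversion
and Parseval express the multiplicity for restriction from `GL_{m+1}` to `GL_m` as the sum over `i`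
of the pairings of the derivative of order `i + 1` of one side with the derivative of order `i` of
the other (`sum_blk_mul_eq_sum_pairing`). So the dimension sought is the pairing of `∏ (1 + f i)`
with `∏ (1 + h j)`, summed over all degrees.

The second is Frobenius reciprocity: the adjoint `skew` of Hall multiplication by a cuspidal
function is a derivation (`skew_hall`). Moving the `h j` to the other side one by one, each either
contributes 1 or cancels some `f i` isomorphic to it. As the `h j` are distinct, the cancelled `f i`
is orthogonal to all other `h j'`, the choices are independent, and the answer is `∏ (1 + m_j)`
(`sum_pairing_hallProdSum`). The same derivation shows that a product of distinct cuspidals has norm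
1, which is irreducibility.

The remaining input is that the top derivative of an irreducible cuspidal character is exactly 1,
i.e. that it has a unique Whittaker model. Uniqueness is Gelfand's trick with the reflection in the
antidiagonal, whose key point is a Gelfand–Kazhdan lemma proved through Hessenberg matrices
(`apply_antiTransposeGL`). Existence follows from the branching formula itself, tested against the
indicator of the identity (`derivative_ne_zero`). -/

open Classical in
noncomputable instance {F V : Type*} [Field F] [AddCommGroup V] [Module F V] [Finite V] :
    Fintype (Submodule F V) := Fintype.ofFinite _

instance {F V W : Type*} [Field F] [AddCommGroup V] [Module F V] [AddCommGroup W] [Module F W]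
    [Finite V] [Finite W] : Finite (V →ₗ[F] W) := DFunLike.finite _

open Classical in
noncomputable instance {F V W : Type*} [Field F] [AddCommGroup V] [Module F V] [AddCommGroup W]
    [Module F W] [Finite V] [Finite W] : Fintype (V →ₗ[F] W) := Fintype.ofFinite _

/-- Complex functions of an endomorphism of an `F`-vector space. -/
abbrev EndFun (F : Type u) [Field F] :=
  ∀ (V : Type u) [AddCommGroup V] [Module F V], (V →ₗ[F] V) → ℂ

/-- Complex functions of a linear form and an endomorphism of an `F`-vector space. -/
abbrev FlagFun (F : Type u) [Field F] :=
  ∀ (V : Type u) [AddCommGroup V] [Module F V], (V →ₗ[F] F) → (V →ₗ[F] V) → ℂ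

/-! ### Functions of endomorphisms and the Hall product. -/

section

variable {F : Type u} [Field F]

/-- Invariance under isomorphisms. -/
def IsInv (f : EndFun F) : Prop :=
  ∀ ⦃V W : Type u⦄ [AddCommGroup V] [Module F V] [AddCommGroup W] [Module F W] (e : V ≃ₗ[F] W)
    (g : V →ₗ[F] V) (h : W →ₗ[F] W), (∀ v, e (g v) = h (e v)) → f V g = f W h

/-- Invariance under isomorphisms. -/
def IsInvFlag (φ : FlagFun F) : Prop :=
  ∀ ⦃V W : Type u⦄ [AddCommGroup V] [Module F V] [AddCommGroup W] [Module F W] (e : V ≃ₗ[F] W)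
    (k : V →ₗ[F] F) (l : W →ₗ[F] F) (g : V →ₗ[F] V) (h : W →ₗ[F] W),
    (∀ v, l (e v) = k v) → (∀ v, e (g v) = h (e v)) → φ V k g = φ W l h

theorem IsInv.flag {f : EndFun F} (hf : IsInv f) : IsInvFlag fun V _ _ _ g => f V g :=
  fun _ _ _ _ _ _ e _ _ g h _ hg => hf e g h hg

theorem IsInvFlag.at_zero {φ : FlagFun F} (hφ : IsInvFlag φ) : IsInv fun V _ _ g => φ V 0 g :=
  fun _ _ _ _ _ _ e g h hg => hφ e 0 0 g h (by simp) hg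

open Classical in
/-- The contribution of a subspace `U` to the Hall product. -/
noncomputable def hallTerm (f h : EndFun F) (V : Type u) [AddCommGroup V] [Module F V]
    (g : V →ₗ[F] V) (U : Submodule F V) : ℂ :=
  if hU : U ≤ U.comap g then f U (g.restrict hU) * h (V ⧸ U) (U.mapQ U g hU) else 0

/-- The Hall product, which is parabolic induction on the level of characters. -/
noncomputable def hall (f h : EndFun F) : EndFun F :=
  fun V _ _ g => ∑ᶠ U : Submodule F V, hallTerm f h V g U

section Transport

variable {V A B : Type u} [AddCommGroup V] [Module F V] [AddCommGroup A] [Module F A]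
  [AddCommGroup B] [Module F B]

theorem IsInv.restrict_eq {f : EndFun F} (hf : IsInv f) {g : V →ₗ[F] V} {U : Submodule F V}
    (hU : U ≤ U.comap g) (i : A →ₗ[F] V) (hi : Function.Injective i) (hr : i.range = U)
    (a : A →ₗ[F] A) (ha : ∀ x, g (i x) = i (a x)) : f U (g.restrict hU) = f A a := by
  subst hr
  refine (hf (LinearEquiv.ofInjective i hi) a _ fun x => ?_).symm
  ext
  simp [LinearMap.restrict_apply, ha]

theorem IsInv.mapQ_eq {f : EndFun F} (hf : IsInv f) {g : V →ₗ[F] V} {U : Submodule F V}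
    (hU : U ≤ U.comap g) (p : V →ₗ[F] B) (hp : Function.Surjective p) (hk : p.ker = U)
    (b : B →ₗ[F] B) (hb : ∀ x, p (g x) = b (p x)) : f (V ⧸ U) (U.mapQ U g hU) = f B b := by
  subst hk
  refine hf (p.quotKerEquivOfSurjective hp) _ b fun x => ?_
  obtain ⟨x, rfl⟩ := Submodule.mkQ_surjective _ x
  simp [LinearMap.quotKerEquivOfSurjective_apply_mk, hb]

/-- Any exact sequence `A → V → B` presenting `U` may replace the subspace and the quotient. Later
computations of Hall terms all go through such a sequence. -/
theorem hallTerm_eq {f h : EndFun F} (hf : IsInv f) (hh : IsInv h) {g : V →ₗ[F] V}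
    {U : Submodule F V} (i : A →ₗ[F] V) (hi : Function.Injective i) (hr : i.range = U)
    (p : V →ₗ[F] B) (hp : Function.Surjective p) (hk : p.ker = U)
    (a : A →ₗ[F] A) (ha : ∀ x, g (i x) = i (a x)) (b : B →ₗ[F] B) (hb : ∀ x, p (g x) = b (p x)) :
    hallTerm f h V g U = f A a * h B b := by
  have hU : U ≤ U.comap g := by
    subst hr
    rintro _ ⟨x, rfl⟩
    exact ⟨a x, (ha x).symm⟩
  rw [hallTerm, dif_pos hU, hf.restrict_eq hU i hi hr a ha, hh.mapQ_eq hU p hp hk b hb]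

theorem hallTerm_map {f h : EndFun F} (hf : IsInv f) (hh : IsInv h) (e : V ≃ₗ[F] A)
    (g : V →ₗ[F] V) (g' : A →ₗ[F] A) (hg : ∀ v, e (g v) = g' (e v)) (U : Submodule F V) :
    hallTerm f h A g' (U.map (e : V →ₗ[F] A)) = hallTerm f h V g U := by
  by_cases hU : U ≤ U.comap g
  · rw [hallTerm_eq hf hh ((e : V →ₗ[F] A) ∘ₗ U.subtype)
      (e.injective.comp U.subtype_injective) (by rw [LinearMap.range_comp, U.range_subtype])
      (U.mkQ ∘ₗ (e.symm : A →ₗ[F] V)) ((U.mkQ_surjective).comp e.symm.surjective)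
      (by
        rw [LinearMap.ker_comp, U.ker_mkQ]
        ext x
        simp [Submodule.mem_map_equiv])
      (g.restrict hU) (by intro x; simp [LinearMap.restrict_apply, hg]) (U.mapQ U g hU)
      (by
        intro x
        obtain ⟨v, rfl⟩ := e.surjective x
        simp [← hg])]
    rw [hallTerm, dif_pos hU]
  · rw [hallTerm, hallTerm, dif_neg hU, dif_neg]
    intro h
    refine hU fun v hv => ?_
    have := h (Submodule.mem_map_of_mem (f := (e : V →ₗ[F] A)) hv)
    simpa [← hg, Submodule.mem_map_equiv] using this

theorem IsInv.hall {f h : EndFun F} (hf : IsInv f) (hh : IsInv h) : IsInv (hall f h) := by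
  intro V W _ _ _ _ e g g' hg
  refine finsum_eq_of_bijective (fun U => U.map (e : V →ₗ[F] W))
    (Submodule.orderIsoMapComap e).bijective fun U => ?_
  exact (hallTerm_map hf hh e g g' hg U).symm

end Transport

/-! ### Subspaces of `A × B` under unipotent shears. -/

section Blocks

variable {A B : Type u} [AddCommGroup A] [Module F A] [AddCommGroup B] [Module F B]

/-- The block upper triangular endomorphism of `A × B` with blocks `a`, `u`, `b`. -/
def blk (a : A →ₗ[F] A) (u : B →ₗ[F] A) (b : B →ₗ[F] B) : (A × B) →ₗ[F] (A × B) :=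
  (a ∘ₗ LinearMap.fst F A B + u ∘ₗ LinearMap.snd F A B).prod (b ∘ₗ LinearMap.snd F A B)

@[simp] theorem blk_apply (a : A →ₗ[F] A) (u : B →ₗ[F] A) (b : B →ₗ[F] B) (p : A × B) :
    blk a u b p = (a p.1 + u p.2, b p.2) := rfl

/-- The unipotent automorphism of `A × B` given by `s : B → A`. -/
def shear (s : B →ₗ[F] A) : (A × B) ≃ₗ[F] (A × B) where
  toFun p := (p.1 + s p.2, p.2)
  invFun p := (p.1 - s p.2, p.2)
  map_add' p q := by simp; abel
  map_smul' c p := by simp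
  left_inv p := by simp
  right_inv p := by simp

@[simp] theorem shear_apply (s : B →ₗ[F] A) (p : A × B) : shear s p = (p.1 + s p.2, p.2) := rfl

theorem shear_blk (a : A →ₗ[F] A) (u s : B →ₗ[F] A) (b : B →ₗ[F] B) (p : A × B) :
    shear s (blk a u b p) = blk a (u + (s ∘ₗ b - a ∘ₗ s)) b (shear s p) := by
  simp; abel

theorem mem_map_shear (s : B →ₗ[F] A) (U : Submodule F (A × B)) (p : A × B) :
    p ∈ U.map (shear s : (A × B) →ₗ[F] (A × B)) ↔ (p.1 - s p.2, p.2) ∈ U := by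
  rw [Submodule.mem_map_equiv]; rfl

theorem map_shear_map_shear (s t : B →ₗ[F] A) (U : Submodule F (A × B)) :
    (U.map (shear s : (A × B) →ₗ[F] (A × B))).map (shear t : (A × B) →ₗ[F] (A × B)) =
      U.map (shear (s + t) : (A × B) →ₗ[F] (A × B)) := by
  ext p
  rw [mem_map_shear, mem_map_shear, mem_map_shear]
  simp [sub_sub, add_comm]

/-- The subspace `U` of `A × B` has intersection `A₁` with `A` and projection `B₁` to `B`. -/
def HasType (A₁ : Submodule F A) (B₁ : Submodule F B) (U : Submodule F (A × B)) : Prop :=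
  U.comap (LinearMap.inl F A B) = A₁ ∧ U.map (LinearMap.snd F A B) = B₁

theorem hasType_prod (A₁ : Submodule F A) (B₁ : Submodule F B) : HasType A₁ B₁ (A₁.prod B₁) := by
  constructor
  · ext x; simp
  · ext y
    simp only [Submodule.mem_map, Submodule.mem_prod, LinearMap.snd_apply, Prod.exists]
    exact ⟨fun ⟨_, _, h, e⟩ => e ▸ h.2, fun h => ⟨0, y, ⟨zero_mem _, h⟩, rfl⟩⟩

theorem hasType_map_shear {A₁ : Submodule F A} {B₁ : Submodule F B} {U : Submodule F (A × B)}
    (h : HasType A₁ B₁ U) (s : B →ₗ[F] A) :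
    HasType A₁ B₁ (U.map (shear s : (A × B) →ₗ[F] (A × B))) := by
  obtain ⟨rfl, rfl⟩ := h
  constructor
  · ext x
    rw [Submodule.mem_comap, mem_map_shear]
    simp
  · ext y
    simp only [Submodule.mem_map, LinearMap.snd_apply, Prod.exists]
    constructor
    · rintro ⟨x, _, h, rfl⟩
      obtain ⟨x', y', h', e⟩ := h
      refine ⟨x', y', h', ?_⟩
      simpa using congrArg Prod.snd e
    · rintro ⟨x, _, h, rfl⟩
      exact ⟨x + s _, _, ⟨x, _, h, rfl⟩, rfl⟩

/-- A linear section of the projection `U → B₁` writes `U` as `A₁` plus a graph over `B₁`. Extending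
the first coordinate of the section to all of `B` gives the shear. -/
theorem HasType.exists_shear {A₁ : Submodule F A} {B₁ : Submodule F B} {U : Submodule F (A × B)}
    (h : HasType A₁ B₁ U) :
    ∃ s : B →ₗ[F] A, (A₁.prod B₁).map (shear s : (A × B) →ₗ[F] (A × B)) = U := by
  obtain ⟨rfl, rfl⟩ := h
  set q : U →ₗ[F] U.map (LinearMap.snd F A B) := (LinearMap.snd F A B).submoduleMap U with hq
  obtain ⟨t, ht⟩ := q.exists_rightInverse_of_surjective
    (LinearMap.range_eq_top.2 ((LinearMap.snd F A B).submoduleMap_surjective U))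
  obtain ⟨s, hs⟩ := LinearMap.exists_extend ((LinearMap.fst F A B) ∘ₗ U.subtype ∘ₗ t)
  refine ⟨s, ?_⟩
  have key : ∀ y ∈ U.map (LinearMap.snd F A B), (s y, y) ∈ U := by
    intro y hy
    have h1 : s y = ((t ⟨y, hy⟩ : U) : A × B).1 := LinearMap.congr_fun hs ⟨y, hy⟩
    have h2 : y = ((t ⟨y, hy⟩ : U) : A × B).2 :=
      (congrArg Subtype.val (LinearMap.congr_fun ht ⟨y, hy⟩)).symm
    have h3 : (s y, y) = ((t ⟨y, hy⟩ : U) : A × B) := Prod.ext h1 h2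
    rw [h3]
    exact (t ⟨y, hy⟩).2
  ext ⟨x, y⟩
  rw [mem_map_shear]
  simp only [Submodule.mem_prod, Submodule.mem_comap, LinearMap.inl_apply]
  constructor
  · rintro ⟨h1, h2⟩
    simpa using U.add_mem h1 (key y h2)
  · intro h
    have hy : y ∈ U.map (LinearMap.snd F A B) := ⟨(x, y), h, rfl⟩
    exact ⟨by simpa using U.sub_mem h (key y hy), hy⟩

theorem map_shear_prod_eq_iff {A₁ : Submodule F A} {B₁ : Submodule F B} (s : B →ₗ[F] A) :
    (A₁.prod B₁).map (shear s : (A × B) →ₗ[F] (A × B)) = A₁.prod B₁ ↔ ∀ y ∈ B₁, s y ∈ A₁ := by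
  constructor
  · intro h y hy
    have : ((0 : A), y) ∈ (A₁.prod B₁).map (shear s : (A × B) →ₗ[F] (A × B)) := by
      rw [h]; exact ⟨zero_mem _, hy⟩
    rw [mem_map_shear] at this
    simpa using this.1
  · intro h
    ext ⟨x, y⟩
    rw [mem_map_shear]
    simp only [Submodule.mem_prod]
    refine and_congr_left fun hy => ⟨fun h1 => ?_, fun h1 => A₁.sub_mem h1 (h y hy)⟩
    simpa using A₁.add_mem h1 (h y hy)

variable [Finite A] [Finite B]

open Classical in
-- Orbit–stabilizer: `Hom(B, A)` acts by shears, transitively on the subspaces of a given type, and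
-- the second factor is the stabilizer of `A₁ × B₁`.
theorem card_hasType_mul (A₁ : Submodule F A) (B₁ : Submodule F B) :
    Fintype.card {U : Submodule F (A × B) // HasType A₁ B₁ U} *
      Fintype.card {s : B →ₗ[F] A // ∀ y ∈ B₁, s y ∈ A₁} = Fintype.card (B →ₗ[F] A) := by
  have h1 := Finset.card_eq_sum_card_fiberwise (s := (Finset.univ : Finset (B →ₗ[F] A)))
    (t := Finset.univ.filter fun U : Submodule F (A × B) => HasType A₁ B₁ U)
    (f := fun s => (A₁.prod B₁).map (shear s : (A × B) →ₗ[F] (A × B)))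
    (fun s _ => by simpa using hasType_map_shear (hasType_prod A₁ B₁) s)
  rw [Finset.card_univ] at h1
  rw [h1, Fintype.card_subtype, Fintype.card_subtype, Finset.sum_const_nat]
  intro U hU
  obtain ⟨t, rfl⟩ := (Finset.mem_filter.1 hU).2.exists_shear
  refine Finset.card_bij' (fun s _ => s - t) (fun s _ => s + t) ?_ ?_ ?_ ?_
  · intro s hs
    simp only [Finset.mem_filter, Finset.mem_univ, true_and] at hs ⊢
    rw [← map_shear_prod_eq_iff, sub_eq_add_neg, ← map_shear_map_shear, hs, map_shear_map_shear,
      add_neg_cancel, map_shear_prod_eq_iff]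
    simp
  · intro s hs
    simp only [Finset.mem_filter, Finset.mem_univ, true_and] at hs ⊢
    rw [← map_shear_map_shear, map_shear_prod_eq_iff _ |>.2 hs]
  · intro s _; simp
  · intro s _; simp

open Classical in
-- Conjugation by a shear moves `A₁ × B₁` to any subspace of the same type and translates `u` by `s
-- b - a s`, which the weight `ω` does not see. After summing over `u`, all subspaces of one type
-- therefore contribute equally, and only the representative `A₁ × B₁` has to be evaluated. This is
-- the Mackey-type reduction behind both the Leibniz rule and the derivation property.
theorem sum_blk_hasType (a : A →ₗ[F] A) (b : B →ₗ[F] B) (ω : (B →ₗ[F] A) → ℂ)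
    (hω : ∀ u s : B →ₗ[F] A, ω (u + (s ∘ₗ b - a ∘ₗ s)) = ω u)
    (Φ : Submodule F (A × B) → ((A × B) →ₗ[F] (A × B)) → ℂ)
    (hΦ : ∀ (U : Submodule F (A × B)) (g g' : (A × B) →ₗ[F] (A × B)) (s : B →ₗ[F] A),
      (∀ p, shear s (g p) = g' (shear s p)) →
        Φ (U.map (shear s : (A × B) →ₗ[F] (A × B))) g' = Φ U g)
    (A₁ : Submodule F A) (B₁ : Submodule F B) :
    ∑ u, ω u * ∑ U : Submodule F (A × B), (if HasType A₁ B₁ U then Φ U (blk a u b) else 0) =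
      (Fintype.card (B →ₗ[F] A) : ℂ) *
        ((Fintype.card {s : B →ₗ[F] A // ∀ y ∈ B₁, s y ∈ A₁} : ℂ)⁻¹ *
          ∑ u, ω u * Φ (A₁.prod B₁) (blk a u b)) := by
  have key : ∀ U : Submodule F (A × B), HasType A₁ B₁ U →
      ∑ u, ω u * Φ U (blk a u b) = ∑ u, ω u * Φ (A₁.prod B₁) (blk a u b) := by
    intro U hU
    obtain ⟨s, rfl⟩ := hU.exists_shear
    rw [← Equiv.sum_comp (Equiv.addRight (s ∘ₗ b - a ∘ₗ s))]
    refine Finset.sum_congr rfl fun u _ => ?_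
    rw [Equiv.coe_addRight, hω, hΦ _ _ _ s (shear_blk a u s b)]
  simp_rw [Finset.mul_sum]
  rw [Finset.sum_comm]
  have : ∀ U : Submodule F (A × B),
      ∑ u, ω u * (if HasType A₁ B₁ U then Φ U (blk a u b) else 0) =
        if HasType A₁ B₁ U then ∑ u, ω u * Φ (A₁.prod B₁) (blk a u b) else 0 := by
    intro U
    split_ifs with h
    · exact key U h
    · simp
  simp_rw [this]
  rw [← Finset.sum_filter, Finset.sum_const, nsmul_eq_mul, ← Fintype.card_subtype,
    ← card_hasType_mul A₁ B₁, Nat.cast_mul]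
  have : (Fintype.card {s : B →ₗ[F] A // ∀ y ∈ B₁, s y ∈ A₁} : ℂ) ≠ 0 := by
    have : Nonempty {s : B →ₗ[F] A // ∀ y ∈ B₁, s y ∈ A₁} := ⟨⟨0, by simp⟩⟩
    exact_mod_cast Fintype.card_ne_zero
  rw [Finset.mul_sum]
  exact Finset.sum_congr rfl fun u _ => by rw [mul_assoc, mul_inv_cancel_left₀ this]

open Classical in
theorem sum_submodule_eq_sum_hasType {M : Type*} [AddCommMonoid M] (Φ : Submodule F (A × B) → M) :
    ∑ U, Φ U = ∑ A₁ : Submodule F A, ∑ B₁ : Submodule F B,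
      ∑ U, if HasType A₁ B₁ U then Φ U else 0 := by
  have : ∀ A₁ : Submodule F A, ∑ B₁ : Submodule F B, ∑ U, (if HasType A₁ B₁ U then Φ U else 0) =
      ∑ U : Submodule F (A × B), if U.comap (LinearMap.inl F A B) = A₁ then Φ U else 0 := by
    intro A₁
    rw [Finset.sum_comm]
    refine Finset.sum_congr rfl fun U _ => ?_
    by_cases h : U.comap (LinearMap.inl F A B) = A₁
    · rw [if_pos h, Finset.sum_eq_single (U.map (LinearMap.snd F A B))]
      · rw [if_pos ⟨h, rfl⟩]
      · intro B₁ _ hB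
        rw [if_neg fun h => hB h.2.symm]
      · simp
    · rw [if_neg h]
      exact Finset.sum_eq_zero fun B₁ _ => if_neg fun h' => h h'.1
  simp_rw [this]
  rw [Finset.sum_comm]
  simp

end Blocks

end

end FiniteGL

/-! ### Partial Fourier transforms, derivatives and the Leibniz rule. -/

namespace FiniteGL

universe u

section

variable {F : Type u} [Field F]

theorem card_inv_mul_sum_comp_of_surjective {X Y : Type*} [AddGroup X] [AddGroup Y] [Fintype X]
    [Fintype Y] (p : X →+ Y) (hp : Function.Surjective p) (f : Y → ℂ) :
    (Fintype.card X : ℂ)⁻¹ * ∑ x, f (p x) = (Fintype.card Y : ℂ)⁻¹ * ∑ y, f y := by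
  classical
  have hc : ∀ y, (Finset.univ.filter fun x => p x = y).card =
      (Finset.univ.filter fun x => p x = 0).card := fun y =>
    AddMonoidHom.card_fiber_eq_of_mem_range p (hp y) (hp 0)
  have h1 : ∑ x, f (p x) = (Finset.univ.filter fun x => p x = 0).card * ∑ y, f y := by
    rw [← Finset.sum_fiberwise Finset.univ p, Finset.mul_sum]
    refine Finset.sum_congr rfl fun y _ => ?_
    rw [Finset.sum_congr rfl (g := fun _ => f y), Finset.sum_const, hc, nsmul_eq_mul]
    intro x hx
    rw [(Finset.mem_filter.1 hx).2]
  have h2 : Fintype.card X = (Finset.univ.filter fun x => p x = 0).card * Fintype.card Y := by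
    rw [← Finset.card_univ, Finset.card_eq_sum_card_fiberwise (t := Finset.univ) (f := p) (by simp),
      Finset.sum_const_nat (fun y _ => hc y), mul_comm, Finset.card_univ]
  have h3 : ((Finset.univ.filter fun x => p x = 0).card : ℂ) ≠ 0 := by
    have : (0 : X) ∈ Finset.univ.filter fun x => p x = 0 := by simp
    exact_mod_cast Finset.card_ne_zero_of_mem this
  rw [h1, h2, Nat.cast_mul]
  have : (Fintype.card Y : ℂ) ≠ 0 := by exact_mod_cast Fintype.card_ne_zero
  field_simp

theorem sum_eq_zero_of_translate {X : Type*} [AddGroup X] [Fintype X] (f : X → ℂ) (x₀ : X) (c : ℂ)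
    (hc : c ≠ 1) (h : ∀ x, f (x + x₀) = c * f x) : ∑ x, f x = 0 := by
  have h1 : ∑ x, f x = c * ∑ x, f x := by
    conv_lhs => rw [← Equiv.sum_comp (Equiv.addRight x₀)]
    simp [h, Finset.mul_sum]
  have h2 : (1 - c) * ∑ x, f x = 0 := by rw [sub_mul, one_mul, ← h1, sub_self]
  exact (mul_eq_zero.1 h2).resolve_left (sub_ne_zero.2 hc.symm)

instance {V : Type*} [AddCommGroup V] [Module F V] [Finite V] (U : Submodule F V) :
    Finite (V ⧸ U) := Finite.of_surjective _ U.mkQ_surjective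

theorem card_inv_mul_sum_mkQ_comp {B V : Type*} [AddCommGroup B] [Module F B] [AddCommGroup V]
    [Module F V] [Finite B] [Finite V] (U : Submodule F V) (f : (B →ₗ[F] V ⧸ U) → ℂ) :
    (Fintype.card (B →ₗ[F] V) : ℂ)⁻¹ * ∑ u : B →ₗ[F] V, f (U.mkQ ∘ₗ u) =
      (Fintype.card (B →ₗ[F] V ⧸ U) : ℂ)⁻¹ * ∑ u, f u := by
  obtain ⟨s, hs⟩ := U.mkQ.exists_rightInverse_of_surjective U.range_mkQ
  refine card_inv_mul_sum_comp_of_surjective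
    (AddMonoidHom.mk' (fun u : B →ₗ[F] V => U.mkQ ∘ₗ u) fun u v => LinearMap.comp_add _ _ _)
    (fun u => ⟨s ∘ₗ u, ?_⟩) f
  simp [← LinearMap.comp_assoc, hs]

theorem exists_char_ne_one {V : Type*} [AddCommGroup V] [Module F V] {ψ : AddChar F ℂ}
    (hψ : ψ ≠ 1) {ℓ : V →ₗ[F] F} (hℓ : ℓ ≠ 0) : ∃ v, ψ (ℓ v) ≠ 1 := by
  obtain ⟨x, hx⟩ := AddChar.ne_one_iff.1 hψ
  obtain ⟨v, rfl⟩ := LinearMap.surjective hℓ x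
  exact ⟨v, hx⟩

/-- The partial Fourier transform along the last column, in the variable dual to the linear form. -/
noncomputable def fourier (ψ : AddChar F ℂ) (φ : FlagFun F) : FlagFun F := fun V [_] [_] ℓ g =>
  (Nat.card (F →ₗ[F] V) : ℂ)⁻¹ * ∑ᶠ u : F →ₗ[F] V,
    ψ (ℓ (u 1)) * φ (V × F) (LinearMap.snd F V F) (blk g u LinearMap.id)

/-- The iterated partial Fourier transforms of a function of endomorphisms. -/
noncomputable def iterFourier (ψ : AddChar F ℂ) (k : ℕ) (f : EndFun F) : FlagFun F :=
  (fourier ψ)^[k] (fun V [AddCommGroup V] [Module F V] _ g => f V g : FlagFun F)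

/-- The `k`-th Bernstein–Zelevinsky derivative. -/
noncomputable def derivative (ψ : AddChar F ℂ) (k : ℕ) (f : EndFun F) : EndFun F :=
  fun V _ _ g => iterFourier ψ k f V 0 g

theorem iterFourier_zero (ψ : AddChar F ℂ) (f : EndFun F) :
    iterFourier ψ 0 f = fun V [AddCommGroup V] [Module F V] _ g => f V g := rfl

theorem iterFourier_succ (ψ : AddChar F ℂ) (k : ℕ) (f : EndFun F) :
    iterFourier ψ (k + 1) f = fourier ψ (iterFourier ψ k f) :=
  Function.iterate_succ_apply' _ _ _

theorem derivative_zero (ψ : AddChar F ℂ) (f : EndFun F) : derivative ψ 0 f = f := rfl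

theorem IsInvFlag.fourier {φ : FlagFun F} (hφ : IsInvFlag φ) (ψ : AddChar F ℂ) :
    IsInvFlag (fourier ψ φ) := by
  intro V W _ _ _ _ e k l g h hk hg
  unfold FiniteGL.fourier
  have hb : Function.Bijective fun u : F →ₗ[F] V => (e : V →ₗ[F] W) ∘ₗ u := by
    refine Function.bijective_iff_has_inverse.2 ⟨fun u => (e.symm : W →ₗ[F] V) ∘ₗ u, ?_, ?_⟩
    · intro u; ext; simp
    · intro u; ext; simp
  rw [Nat.card_congr (Equiv.ofBijective _ hb)]
  congr 1
  refine finsum_eq_of_bijective _ hb fun u => ?_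
  congr 1
  · simp [hk]
  · refine hφ (e.prodCongr (LinearEquiv.refl F F)) _ _ _ _ ?_ ?_ <;> intro p <;> simp [hg]

theorem IsInv.iterFourier {f : EndFun F} (hf : IsInv f) (ψ : AddChar F ℂ) (k : ℕ) :
    IsInvFlag (iterFourier ψ k f) := by
  induction k with
  | zero => exact hf.flag
  | succ k ih => rw [iterFourier_succ]; exact ih.fourier ψ

theorem IsInv.derivative {f : EndFun F} (hf : IsInv f) (ψ : AddChar F ℂ) (k : ℕ) :
    IsInv (derivative ψ k f) := (hf.iterFourier ψ k).at_zero

theorem fourier_eq [Finite F] (ψ : AddChar F ℂ) (φ : FlagFun F) {V : Type u} [AddCommGroup V]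
    [Module F V] [Finite V] (ℓ : V →ₗ[F] F) (g : V →ₗ[F] V) :
    fourier ψ φ V ℓ g = (Fintype.card (F →ₗ[F] V) : ℂ)⁻¹ * ∑ u : F →ₗ[F] V,
      ψ (ℓ (u 1)) * φ (V × F) (LinearMap.snd F V F) (blk g u LinearMap.id) := by
  rw [fourier, Nat.card_eq_fintype_card, finsum_eq_sum_of_fintype]

section Pieces

variable {V A B : Type u} [AddCommGroup V] [Module F V] [AddCommGroup A] [Module F A]
  [AddCommGroup B] [Module F B]

open Classical in
/-- The contribution to a Hall product of a subspace on which the linear form is carried by the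
first factor. -/
noncomputable def subPiece (φ : FlagFun F) (h : EndFun F) (V : Type u) [AddCommGroup V]
    [Module F V] (ℓ : V →ₗ[F] F) (g : V →ₗ[F] V) (U : Submodule F V) : ℂ :=
  if hU : U ≤ U.comap g then φ U (ℓ ∘ₗ U.subtype) (g.restrict hU) * h (V ⧸ U) (U.mapQ U g hU)
  else 0

open Classical in
/-- The contribution to a Hall product of a subspace on which the linear form is carried by the
second factor. -/
noncomputable def quotPiece (f : EndFun F) (φ : FlagFun F) (V : Type u) [AddCommGroup V]
    [Module F V] (ℓ : V →ₗ[F] F) (g : V →ₗ[F] V) (U : Submodule F V) : ℂ :=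
  if hU : U ≤ U.comap g ∧ U ≤ ℓ.ker then
    f U (g.restrict hU.1) * φ (V ⧸ U) (U.liftQ ℓ hU.2) (U.mapQ U g hU.1)
  else 0

theorem subPiece_eq {φ : FlagFun F} {h : EndFun F} (hφ : IsInvFlag φ) (hh : IsInv h)
    {ℓ : V →ₗ[F] F} {g : V →ₗ[F] V}
    {U : Submodule F V} (i : A →ₗ[F] V) (hi : Function.Injective i) (hr : i.range = U)
    (p : V →ₗ[F] B) (hp : Function.Surjective p) (hk : p.ker = U)
    (a : A →ₗ[F] A) (ha : ∀ x, g (i x) = i (a x)) (b : B →ₗ[F] B) (hb : ∀ x, p (g x) = b (p x)) :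
    subPiece φ h V ℓ g U = φ A (ℓ ∘ₗ i) a * h B b := by
  have hU : U ≤ U.comap g := by
    subst hr
    rintro _ ⟨x, rfl⟩
    exact ⟨a x, (ha x).symm⟩
  rw [subPiece, dif_pos hU, hh.mapQ_eq hU p hp hk b hb]
  congr 1
  subst hr
  refine (hφ (LinearEquiv.ofInjective i hi) _ _ a _ (fun x => ?_) fun x => ?_).symm
  · simp
  · ext
    simp [LinearMap.restrict_apply, ha]

theorem quotPiece_eq {f : EndFun F} {φ : FlagFun F} (hf : IsInv f) (hφ : IsInvFlag φ)
    {ℓ : V →ₗ[F] F} {g : V →ₗ[F] V}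
    {U : Submodule F V} (i : A →ₗ[F] V) (hi : Function.Injective i) (hr : i.range = U)
    (p : V →ₗ[F] B) (hp : Function.Surjective p) (hk : p.ker = U) (ℓ' : B →ₗ[F] F)
    (hℓ : ∀ x, ℓ' (p x) = ℓ x)
    (a : A →ₗ[F] A) (ha : ∀ x, g (i x) = i (a x)) (b : B →ₗ[F] B) (hb : ∀ x, p (g x) = b (p x)) :
    quotPiece f φ V ℓ g U = f A a * φ B ℓ' b := by
  have hU : U ≤ U.comap g := by
    subst hr
    rintro _ ⟨x, rfl⟩
    exact ⟨a x, (ha x).symm⟩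
  have hU' : U ≤ ℓ.ker := by
    subst hk
    intro x hx
    rw [LinearMap.mem_ker] at hx ⊢
    rw [← hℓ, hx, map_zero]
  rw [quotPiece, dif_pos ⟨hU, hU'⟩, hf.restrict_eq hU i hi hr a ha]
  congr 1
  subst hk
  refine hφ (p.quotKerEquivOfSurjective hp) _ _ _ b (fun x => ?_) fun x => ?_
  · obtain ⟨x, rfl⟩ := Submodule.mkQ_surjective _ x
    simp [LinearMap.quotKerEquivOfSurjective_apply_mk, hℓ]
  · obtain ⟨x, rfl⟩ := Submodule.mkQ_surjective _ x
    simp [LinearMap.quotKerEquivOfSurjective_apply_mk, hb]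

theorem le_comap_map_iff (e : V ≃ₗ[F] A) (g : V →ₗ[F] V) (g' : A →ₗ[F] A)
    (hg : ∀ v, e (g v) = g' (e v)) (U : Submodule F V) :
    U.map (e : V →ₗ[F] A) ≤ (U.map (e : V →ₗ[F] A)).comap g' ↔ U ≤ U.comap g := by
  constructor
  · intro h v hv
    have := h (Submodule.mem_map_of_mem (f := (e : V →ₗ[F] A)) hv)
    simpa [← hg, Submodule.mem_map_equiv] using this
  · rintro h _ ⟨v, hv, rfl⟩
    exact ⟨g v, h hv, hg v⟩

theorem le_ker_map_iff (e : V ≃ₗ[F] A) (ℓ : V →ₗ[F] F) (ℓ' : A →ₗ[F] F)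
    (hℓ : ∀ v, ℓ' (e v) = ℓ v) (U : Submodule F V) :
    U.map (e : V →ₗ[F] A) ≤ ℓ'.ker ↔ U ≤ ℓ.ker := by
  constructor
  · intro h v hv
    have := h (Submodule.mem_map_of_mem (f := (e : V →ₗ[F] A)) hv)
    simpa [hℓ] using this
  · rintro h _ ⟨v, hv, rfl⟩
    simpa [hℓ] using h hv

theorem ker_mkQ_comp_symm (e : V ≃ₗ[F] A) (U : Submodule F V) :
    (U.mkQ ∘ₗ (e.symm : A →ₗ[F] V)).ker = U.map (e : V →ₗ[F] A) := by
  rw [LinearMap.ker_comp, U.ker_mkQ]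
  ext x
  simp [Submodule.mem_map_equiv]

theorem subPiece_map {φ : FlagFun F} {h : EndFun F} (hφ : IsInvFlag φ) (hh : IsInv h)
    (e : V ≃ₗ[F] A) (ℓ : V →ₗ[F] F) (ℓ' : A →ₗ[F] F) (hℓ : ∀ v, ℓ' (e v) = ℓ v)
    (g : V →ₗ[F] V) (g' : A →ₗ[F] A) (hg : ∀ v, e (g v) = g' (e v)) (U : Submodule F V) :
    subPiece φ h A ℓ' g' (U.map (e : V →ₗ[F] A)) = subPiece φ h V ℓ g U := by
  by_cases hU : U ≤ U.comap g
  · rw [subPiece_eq hφ hh ((e : V →ₗ[F] A) ∘ₗ U.subtype)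
      (e.injective.comp U.subtype_injective) (by rw [LinearMap.range_comp, U.range_subtype])
      (U.mkQ ∘ₗ (e.symm : A →ₗ[F] V)) ((U.mkQ_surjective).comp e.symm.surjective)
      (ker_mkQ_comp_symm e U)
      (g.restrict hU) (by intro x; simp [LinearMap.restrict_apply, hg]) (U.mapQ U g hU)
      (by
        intro x
        obtain ⟨v, rfl⟩ := e.surjective x
        simp [← hg])]
    rw [subPiece, dif_pos hU]
    congr 2
    ext x
    simp [hℓ]
  · rw [subPiece, subPiece, dif_neg hU, dif_neg]
    rwa [le_comap_map_iff e g g' hg]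

theorem quotPiece_map {f : EndFun F} {φ : FlagFun F} (hf : IsInv f) (hφ : IsInvFlag φ)
    (e : V ≃ₗ[F] A) (ℓ : V →ₗ[F] F) (ℓ' : A →ₗ[F] F) (hℓ : ∀ v, ℓ' (e v) = ℓ v)
    (g : V →ₗ[F] V) (g' : A →ₗ[F] A) (hg : ∀ v, e (g v) = g' (e v)) (U : Submodule F V) :
    quotPiece f φ A ℓ' g' (U.map (e : V →ₗ[F] A)) = quotPiece f φ V ℓ g U := by
  by_cases hU : U ≤ U.comap g ∧ U ≤ ℓ.ker
  · rw [quotPiece_eq hf hφ ((e : V →ₗ[F] A) ∘ₗ U.subtype)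
      (e.injective.comp U.subtype_injective) (by rw [LinearMap.range_comp, U.range_subtype])
      (U.mkQ ∘ₗ (e.symm : A →ₗ[F] V)) ((U.mkQ_surjective).comp e.symm.surjective)
      (ker_mkQ_comp_symm e U) (U.liftQ ℓ hU.2)
      (by
        intro x
        obtain ⟨v, rfl⟩ := e.surjective x
        simp [← hℓ])
      (g.restrict hU.1) (by intro x; simp [LinearMap.restrict_apply, hg]) (U.mapQ U g hU.1)
      (by
        intro x
        obtain ⟨v, rfl⟩ := e.surjective x
        simp [← hg])]
    rw [quotPiece, dif_pos hU]
  · rw [quotPiece, quotPiece, dif_neg hU, dif_neg]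
    rwa [le_comap_map_iff e g g' hg, le_ker_map_iff e ℓ ℓ' hℓ]

theorem prod_le_comap_blk_iff {a : A →ₗ[F] A} {u : B →ₗ[F] A} {b : B →ₗ[F] B}
    {A₁ : Submodule F A} {B₁ : Submodule F B} :
    A₁.prod B₁ ≤ (A₁.prod B₁).comap (blk a u b) ↔
      A₁ ≤ A₁.comap a ∧ B₁ ≤ B₁.comap b ∧ ∀ y ∈ B₁, u y ∈ A₁ := by
  constructor
  · intro h
    refine ⟨fun x hx => ?_, fun y hy => ?_, fun y hy => ?_⟩
    · have := h (show (x, (0 : B)) ∈ A₁.prod B₁ from ⟨hx, zero_mem _⟩)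
      simpa using this
    · have := h (show ((0 : A), y) ∈ A₁.prod B₁ from ⟨zero_mem _, hy⟩)
      exact this.2
    · have := h (show ((0 : A), y) ∈ A₁.prod B₁ from ⟨zero_mem _, hy⟩)
      simpa using this.1
  · rintro ⟨h1, h2, h3⟩ ⟨x, y⟩ ⟨hx, hy⟩
    exact ⟨add_mem (h1 hx) (h3 y hy), h2 hy⟩

end Pieces

theorem bot_ne_top_submodule_self : (⊥ : Submodule F F) ≠ ⊤ := bot_ne_top

theorem eq_bot_or_eq_top_submodule_self (B : Submodule F F) : B = ⊥ ∨ B = ⊤ :=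
  eq_bot_or_eq_top B

theorem sum_submodule_self [Finite F] {M : Type*} [AddCommMonoid M] (f : Submodule F F → M) :
    ∑ B, f B = f ⊥ + f ⊤ := by
  classical
  have h : (⊥ : Submodule F F) ≠ ⊤ := bot_ne_top_submodule_self
  rw [← Finset.sum_pair h]
  exact Finset.sum_congr (Finset.ext fun x => by
    simpa only [Finset.mem_insert, Finset.mem_singleton, Finset.mem_univ, true_iff] using
      eq_bot_or_eq_top_submodule_self x) fun _ _ => rfl

section Leibniz

variable [Finite F] {V : Type u} [AddCommGroup V] [Module F V] [Finite V]

/-- The term depends on `u` only modulo `A₁`. If `ℓ` kills `A₁`, the average descends to the Fourier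
transform on `V ⧸ A₁`; otherwise a translation of `u` by a vector of `A₁` on which `ψ ∘ ℓ` is not 1
makes it vanish. -/
theorem sum_quotPiece_blk {f : EndFun F} {φ : FlagFun F} (hf : IsInv f) (hφ : IsInvFlag φ)
    {ψ : AddChar F ℂ} (hψ : ψ ≠ 1) (ℓ : V →ₗ[F] F) (g : V →ₗ[F] V) (A₁ : Submodule F V) :
    (Fintype.card (F →ₗ[F] V) : ℂ)⁻¹ * ∑ u : F →ₗ[F] V, ψ (ℓ (u 1)) *
        quotPiece f φ (V × F) (LinearMap.snd F V F) (blk g u LinearMap.id) (A₁.prod ⊥) =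
      quotPiece f (fourier ψ φ) V ℓ g A₁ := by
  by_cases hA : A₁ ≤ A₁.comap g
  · have h1 : ∀ u : F →ₗ[F] V,
        quotPiece f φ (V × F) (LinearMap.snd F V F) (blk g u LinearMap.id) (A₁.prod ⊥) =
        f A₁ (g.restrict hA) * φ ((V ⧸ A₁) × F) (LinearMap.snd F _ F)
          (blk (A₁.mapQ A₁ g hA) (A₁.mkQ ∘ₗ u) LinearMap.id) := by
      intro u
      refine quotPiece_eq hf hφ (LinearMap.inl F V F ∘ₗ A₁.subtype)
        (LinearMap.inl_injective.comp A₁.subtype_injective) ?_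
        (A₁.mkQ.prodMap LinearMap.id) (A₁.mkQ_surjective.prodMap Function.surjective_id) ?_ _
        ?_ _ ?_ _ ?_
      · ext ⟨x, y⟩
        simp [eq_comm]
      · ext ⟨x, y⟩
        simp
      · simp
      · intro x; simp [LinearMap.restrict_apply]
      · intro x; simp
    simp_rw [h1]
    by_cases hℓ : A₁ ≤ ℓ.ker
    · rw [quotPiece, dif_pos ⟨hA, hℓ⟩, fourier_eq, ← card_inv_mul_sum_mkQ_comp, Finset.mul_sum,
        Finset.mul_sum, Finset.mul_sum]
      refine Finset.sum_congr rfl fun u _ => ?_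
      simp
      ring
    · rw [quotPiece, dif_neg fun h => hℓ h.2]
      have h2 : ℓ ∘ₗ A₁.subtype ≠ 0 := by
        intro h
        exact hℓ fun x hx => LinearMap.congr_fun h ⟨x, hx⟩
      obtain ⟨x, hx⟩ := exists_char_ne_one hψ h2
      rw [sum_eq_zero_of_translate _ (LinearMap.toSpanSingleton F V x) _ hx, mul_zero]
      intro u
      have h3 : A₁.mkQ ∘ₗ (u + LinearMap.toSpanSingleton F V x) = A₁.mkQ ∘ₗ u := by
        ext; simp
      rw [h3]
      simp [AddChar.map_add_eq_mul]
      ring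
  · rw [quotPiece, dif_neg fun h => hA h.1, Finset.sum_eq_zero, mul_zero]
    intro u _
    rw [quotPiece, dif_neg, mul_zero]
    rw [prod_le_comap_blk_iff]
    exact fun h => hA h.1.1

/-- `A₁ × F` is stable only when `u` takes values in `A₁`, so the sum is a Fourier sum on `A₁`. This
is why the normalisation is by `Hom(F, A₁)` rather than `Hom(F, V)`. -/
theorem sum_subPiece_blk {φ : FlagFun F} {h : EndFun F} (hφ : IsInvFlag φ) (hh : IsInv h)
    (ψ : AddChar F ℂ) (ℓ : V →ₗ[F] F) (g : V →ₗ[F] V) (A₁ : Submodule F V) :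
    (Fintype.card (F →ₗ[F] A₁) : ℂ)⁻¹ * ∑ u : F →ₗ[F] V, ψ (ℓ (u 1)) *
        subPiece φ h (V × F) (LinearMap.snd F V F) (blk g u LinearMap.id) (A₁.prod ⊤) =
      subPiece (fourier ψ φ) h V ℓ g A₁ := by
  by_cases hA : A₁ ≤ A₁.comap g
  · rw [subPiece, dif_pos hA, fourier_eq, mul_assoc]
    congr 1
    rw [Finset.sum_mul]
    refine (Fintype.sum_of_injective (fun u : F →ₗ[F] A₁ => A₁.subtype ∘ₗ u) ?_ _ _ ?_ ?_).symm
    · intro u v huv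
      ext
      exact congrArg (fun w : F →ₗ[F] V => w 1) huv
    · intro u hu
      rw [subPiece, dif_neg, mul_zero]
      intro h'
      rw [prod_le_comap_blk_iff] at h'
      exact hu ⟨u.codRestrict A₁ fun y => h'.2.2 y trivial, by ext; rfl⟩
    · intro u
      rw [subPiece_eq hφ hh (A₁.subtype.prodMap LinearMap.id)
        (Prod.map_injective.2 ⟨A₁.subtype_injective, Function.injective_id⟩) ?_
        (A₁.mkQ ∘ₗ LinearMap.fst F V F) (A₁.mkQ_surjective.comp LinearMap.fst_surjective) ?_
        (blk (g.restrict hA) u LinearMap.id) ?_ (A₁.mapQ A₁ g hA) ?_]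
      · have : LinearMap.snd F V F ∘ₗ A₁.subtype.prodMap LinearMap.id = LinearMap.snd F A₁ F := by
          ext <;> simp
        rw [this]
        simp [mul_assoc]
      · ext ⟨x, y⟩
        simp
      · ext ⟨x, y⟩
        simp
      · intro x; simp [LinearMap.restrict_apply]
      · intro x; simp
  · rw [subPiece, dif_neg hA, Finset.sum_eq_zero, mul_zero]
    intro u _
    rw [subPiece, dif_neg, mul_zero]
    rw [prod_le_comap_blk_iff]
    exact fun h => hA h.1

omit [Finite F] [Finite V] in
-- When `ℓ` vanishes on `U` the first factor sees the zero form, so its iterated transform is a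
-- derivative. This supplies the boundary term of the Leibniz rule.
theorem subPiece_eq_quotPiece {φ : FlagFun F} {h : EndFun F} {ℓ : V →ₗ[F] F} {g : V →ₗ[F] V}
    {U : Submodule F V} (hU : U ≤ ℓ.ker) :
    subPiece φ h V ℓ g U = quotPiece (fun V _ _ g => φ V 0 g)
      (fun V [AddCommGroup V] [Module F V] _ g => h V g) V ℓ g U := by
  rw [subPiece, quotPiece]
  by_cases hg : U ≤ U.comap g
  · rw [dif_pos hg, dif_pos ⟨hg, hU⟩]
    congr 2
    ext x
    exact hU x.2
  · rw [dif_neg hg, dif_neg fun h => hg h.1]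

open Classical in
-- The Leibniz rule with a general linear form, as the induction requires. Subspaces inside the
-- kernel of `ℓ` let the form pass to the quotient, and the orders split in all ways; on the other
-- subspaces the form stays on the first factor, which takes the whole transform. The condition that
-- `g` fixes `ℓ` makes the weight `ψ (ℓ (u 1))` invariant under shears, and it holds automatically
-- for `snd` on `V × F`.
theorem iterFourier_hall {f h : EndFun F} (hf : IsInv f) (hh : IsInv h) {ψ : AddChar F ℂ}
    (hψ : ψ ≠ 1) (k : ℕ) : ∀ (V : Type u) [AddCommGroup V] [Module F V] [Finite V]
    (ℓ : V →ₗ[F] F) (g : V →ₗ[F] V), (∀ v, ℓ (g v) = ℓ v) →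
    iterFourier ψ k (hall f h) V ℓ g = ∑ U : Submodule F V,
      if U ≤ ℓ.ker then
        ∑ p ∈ Finset.HasAntidiagonal.antidiagonal k, quotPiece (derivative ψ p.1 f) (iterFourier ψ p.2 h) V ℓ g U
      else subPiece (iterFourier ψ k f) h V ℓ g U := by
  induction k with
  | zero =>
    intro V _ _ _ ℓ g _
    change ∑ᶠ U, hallTerm f h V g U = _
    rw [finsum_eq_sum_of_fintype]
    refine Finset.sum_congr rfl fun U _ => ?_
    split_ifs with hU
    · simp only [Finset.Nat.antidiagonal_zero, Finset.sum_singleton, quotPiece, hallTerm, hU, and_true]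
      rfl
    · rfl
  | succ k ih =>
    intro V _ _ _ ℓ g hℓ
    set Φ : Submodule F (V × F) → ((V × F) →ₗ[F] (V × F)) → ℂ := fun U G =>
      if U ≤ (LinearMap.snd F V F).ker then
        ∑ p ∈ Finset.HasAntidiagonal.antidiagonal k, quotPiece (derivative ψ p.1 f) (iterFourier ψ p.2 h) (V × F)
          (LinearMap.snd F V F) G U
      else subPiece (iterFourier ψ k f) h (V × F) (LinearMap.snd F V F) G U with hΦ
    have hΦi : ∀ (U : Submodule F (V × F)) (G G' : (V × F) →ₗ[F] (V × F)) (s : F →ₗ[F] V),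
        (∀ p, shear s (G p) = G' (shear s p)) →
          Φ (U.map (shear s : (V × F) →ₗ[F] (V × F))) G' = Φ U G := by
      intro U G G' s hG
      have hs : ∀ v, LinearMap.snd F V F (shear s v) = LinearMap.snd F V F v := fun v => rfl
      simp only [hΦ, le_ker_map_iff (shear s) _ _ hs]
      split_ifs with hU
      · exact Finset.sum_congr rfl fun p _ =>
          quotPiece_map (hf.derivative ψ _) (hh.iterFourier ψ _) _ _ _ hs _ _ hG U
      · exact subPiece_map (hf.iterFourier ψ _) hh _ _ _ hs _ _ hG U
    have hω : ∀ u s : F →ₗ[F] V,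
        ψ (ℓ ((u + (s ∘ₗ LinearMap.id - g ∘ₗ s)) 1)) = ψ (ℓ (u 1)) := by
      intro u s
      simp [hℓ]
    have hbot : ∀ A₁ : Submodule F V, A₁.prod (⊥ : Submodule F F) ≤ (LinearMap.snd F V F).ker := by
      rintro A₁ ⟨x, y⟩ ⟨_, hy⟩
      exact hy
    have htop : ∀ A₁ : Submodule F V,
        ¬ A₁.prod (⊤ : Submodule F F) ≤ (LinearMap.snd F V F).ker := by
      intro A₁ h'
      have := h' (show ((0 : V), (1 : F)) ∈ A₁.prod ⊤ from ⟨zero_mem _, trivial⟩)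
      simp at this
    have hcard : (Fintype.card (F →ₗ[F] V) : ℂ) ≠ 0 := by exact_mod_cast Fintype.card_ne_zero
    rw [iterFourier_succ, fourier_eq]
    have h1 : ∀ u : F →ₗ[F] V, iterFourier ψ k (hall f h) (V × F) (LinearMap.snd F V F)
        (blk g u LinearMap.id) = ∑ A₁ : Submodule F V, ∑ B₁ : Submodule F F, ∑ U,
          if HasType A₁ B₁ U then Φ U (blk g u LinearMap.id) else 0 := by
      intro u
      rw [ih _ _ _ (by simp), ← sum_submodule_eq_sum_hasType]
    simp_rw [h1, Finset.mul_sum (s := (Finset.univ : Finset (Submodule F V))),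
      Finset.mul_sum (s := (Finset.univ : Finset (Submodule F F)))]
    rw [Finset.sum_comm, Finset.mul_sum]
    refine Finset.sum_congr rfl fun A₁ _ => ?_
    rw [Finset.sum_comm]
    simp_rw [sum_blk_hasType g LinearMap.id (fun u : F →ₗ[F] V => ψ (ℓ (u 1))) hω Φ hΦi]
    -- The projection of a subspace of `V × F` to `F` is `⊥` or `⊤`: in the first case the new
    -- transform falls on the second factor, in the second case on the first.
    rw [← Finset.mul_sum, inv_mul_cancel_left₀ hcard,
      sum_submodule_self]
    have hb : (Fintype.card {s : F →ₗ[F] V // ∀ y ∈ (⊥ : Submodule F F), s y ∈ A₁} : ℂ) =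
        Fintype.card (F →ₗ[F] V) := by
      rw [Fintype.card_congr (Equiv.subtypeUnivEquiv fun s y hy => ?_)]
      rw [(Submodule.mem_bot F).1 hy, map_zero]
      exact zero_mem _
    have ht : (Fintype.card {s : F →ₗ[F] V // ∀ y ∈ (⊤ : Submodule F F), s y ∈ A₁} : ℂ) =
        Fintype.card (F →ₗ[F] A₁) := by
      congr 1
      exact Fintype.card_congr
        { toFun := fun s => s.1.codRestrict A₁ fun y => s.2 y trivial
          invFun := fun s => ⟨A₁.subtype ∘ₗ s, fun y _ => (s y).2⟩
          left_inv := fun s => by ext; rfl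
          right_inv := fun s => by ext; rfl }
    rw [hb, ht]
    simp only [hΦ, if_pos (hbot A₁), if_neg (htop A₁)]
    rw [sum_subPiece_blk (hf.iterFourier ψ k) hh, ← iterFourier_succ]
    have h2 : (Fintype.card (F →ₗ[F] V) : ℂ)⁻¹ * ∑ u : F →ₗ[F] V, ψ (ℓ (u 1)) *
        ∑ p ∈ Finset.HasAntidiagonal.antidiagonal k, quotPiece (derivative ψ p.1 f)
          (iterFourier ψ p.2 h) (V × F) (LinearMap.snd F V F) (blk g u LinearMap.id) (A₁.prod ⊥) =
        ∑ p ∈ Finset.HasAntidiagonal.antidiagonal k, quotPiece (derivative ψ p.1 f)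
          (iterFourier ψ (p.2 + 1) h) V ℓ g A₁ := by
      simp_rw [Finset.mul_sum]
      rw [Finset.sum_comm]
      refine Finset.sum_congr rfl fun p _ => ?_
      rw [iterFourier_succ, ← sum_quotPiece_blk (hf.derivative ψ _) (hh.iterFourier ψ _) hψ ℓ g A₁,
        Finset.mul_sum]
    rw [h2]
    split_ifs with hA
    -- The `⊤` term is the pair `(k + 1, 0)`, absent from the shifted antidiagonal.
    · rw [Finset.Nat.sum_antidiagonal_succ', subPiece_eq_quotPiece hA, add_comm]
      rfl
    · rw [Finset.sum_eq_zero, zero_add]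
      intro p _
      rw [quotPiece, dif_neg fun h => hA h.2]

theorem derivative_hall {f h : EndFun F} (hf : IsInv f) (hh : IsInv h) {ψ : AddChar F ℂ}
    (hψ : ψ ≠ 1) (k : ℕ) (g : V →ₗ[F] V) :
    derivative ψ k (hall f h) V g =
      ∑ p ∈ Finset.HasAntidiagonal.antidiagonal k, hall (derivative ψ p.1 f) (derivative ψ p.2 h) V g := by
  rw [derivative, iterFourier_hall hf hh hψ k V 0 g (by simp)]
  simp_rw [hall, finsum_eq_sum_of_fintype]
  rw [Finset.sum_comm]
  refine Finset.sum_congr rfl fun U _ => ?_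
  have hU : U ≤ (0 : V →ₗ[F] F).ker := by simp
  rw [if_pos hU]
  refine Finset.sum_congr rfl fun p _ => ?_
  rw [quotPiece, hallTerm]
  by_cases hg : U ≤ U.comap g
  · rw [dif_pos ⟨hg, hU⟩, dif_pos hg]
    congr 2
    ext x
    simp
  · rw [dif_neg fun h => hg h.1, dif_neg hg]

end Leibniz

end

end FiniteGL

/-! ### Cuspidal functions and the derivatives of their products. -/

namespace FiniteGL

universe u

section

variable {F : Type u} [Field F]

/-- The function `f` sums to zero over the unipotent radical of every proper parabolic subgroup. -/
def SumsToZero (f : EndFun F) : Prop :=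
  ∀ (A B : Type u) [AddCommGroup A] [Module F A] [AddCommGroup B] [Module F B] [Finite A]
    [Finite B] [Nontrivial A] [Nontrivial B] (a : A →ₗ[F] A) (b : B →ₗ[F] B),
    ∑ u : B →ₗ[F] A, f (A × B) (blk a u b) = 0

/-- The function `f` is supported on spaces of dimension `n`. -/
def HasDegree (n : ℕ) (f : EndFun F) : Prop :=
  ∀ (V : Type u) [AddCommGroup V] [Module F V] [Finite V] (g : V →ₗ[F] V),
    Module.finrank F V ≠ n → f V g = 0

/-- The unit of the Hall product. -/
noncomputable def hallOne (F : Type u) [Field F] : EndFun F :=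
  fun V [AddCommGroup V] [Module F V] _ => if Module.finrank F V = 0 then 1 else 0

theorem isInv_hallOne : IsInv (hallOne F) := by
  intro V W _ _ _ _ e g h _
  rw [hallOne, hallOne, e.finrank_eq]

theorem hasDegree_hallOne : HasDegree 0 (hallOne F) := fun _ _ _ _ _ h => if_neg h

theorem hall_congr {f f' h h' : EndFun F} {V : Type u} [AddCommGroup V] [Module F V]
    [Finite V] (g : V →ₗ[F] V)
    (hf : ∀ (W : Type u) [AddCommGroup W] [Module F W] [Finite W] (g : W →ₗ[F] W),
      f W g = f' W g)
    (hh : ∀ (W : Type u) [AddCommGroup W] [Module F W] [Finite W] (g : W →ₗ[F] W),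
      h W g = h' W g) : hall f h V g = hall f' h' V g := by
  refine finsum_congr fun U => ?_
  rw [hallTerm, hallTerm]
  split_ifs with hU
  · rw [hf, hh]
  · rfl

theorem hall_zero_left {h : EndFun F} {V : Type u} [AddCommGroup V] [Module F V]
    (g : V →ₗ[F] V) : hall (fun _ _ _ _ => 0) h V g = 0 := by
  rw [hall, finsum_eq_zero_of_forall_eq_zero]
  intro U
  rw [hallTerm]
  split_ifs
  · rw [zero_mul]
  · rfl

theorem HasDegree.hall [Finite F] {f h : EndFun F} {n k : ℕ} (hf : HasDegree n f)
    (hh : HasDegree k h) : HasDegree (n + k) (hall f h) := by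
  intro V _ _ _ g hV
  rw [FiniteGL.hall, finsum_eq_zero_of_forall_eq_zero]
  intro U
  rw [hallTerm]
  split_ifs with hU
  · by_cases h1 : Module.finrank F U = n
    · have := U.finrank_quotient_add_finrank
      rw [hh (V ⧸ U) _ (by omega), mul_zero]
    · rw [hf U _ h1, zero_mul]
  · rfl

theorem hall_hallOne_left [Finite F] {h : EndFun F} (hh : IsInv h) {V : Type u} [AddCommGroup V]
    [Module F V] [Finite V] (g : V →ₗ[F] V) : hall (hallOne F) h V g = h V g := by
  rw [hall, finsum_eq_single _ (⊥ : Submodule F V)]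
  · rw [hallTerm_eq isInv_hallOne hh (A := PUnit.{u + 1}) (B := V) 0
      (Function.injective_of_subsingleton _) (by simp) LinearMap.id Function.surjective_id
      (by simp) 0 (by simp) g (by simp), hallOne, if_pos Module.finrank_zero_of_subsingleton, one_mul]
  · intro U hU
    rw [hallTerm]
    split_ifs with hg
    · have : Module.finrank F U ≠ 0 := by
        rwa [Ne, Submodule.finrank_eq_zero]
      rw [hallOne, if_neg this, zero_mul]
    · rfl

theorem iterFourier_eq_zero_of_finrank [Finite F] {f : EndFun F} {n : ℕ} (hf : HasDegree n f)
    (ψ : AddChar F ℂ) (k : ℕ) : ∀ {V : Type u} [AddCommGroup V] [Module F V] [Finite V]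
    (ℓ : V →ₗ[F] F) (g : V →ₗ[F] V), Module.finrank F V + k ≠ n →
    iterFourier ψ k f V ℓ g = 0 := by
  induction k with
  | zero => intro V _ _ _ ℓ g h; exact hf V g h
  | succ k ih =>
    intro V _ _ _ ℓ g h
    rw [iterFourier_succ, fourier_eq, Finset.sum_eq_zero, mul_zero]
    intro u _
    rw [ih _ _ (by rw [Module.finrank_prod, Module.finrank_self]; omega), mul_zero]

/-- Splitting off the first components of a pair of linear maps. -/
def homProdEquiv (A B C : Type*) [AddCommGroup A] [Module F A] [AddCommGroup B] [Module F B]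
    [AddCommGroup C] [Module F C] :
    (B →ₗ[F] A) × (C →ₗ[F] A × B) ≃ (C →ₗ[F] B) × (B × C →ₗ[F] A) where
  toFun p := (LinearMap.snd F A B ∘ₗ p.2, p.1.coprod (LinearMap.fst F A B ∘ₗ p.2))
  invFun p := (p.2 ∘ₗ LinearMap.inl F B C, (p.2 ∘ₗ LinearMap.inr F B C).prod p.1)
  left_inv p := by ext <;> simp
  right_inv p := by ext <;> simp

/-- Fourier transforms preserve cuspidality. The variables `B → A` and `F → A × B` regroup into `F →
B` and `B × F → A`; the sum over the latter is the previous case for `A` and `B × F`. Since `B × F`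
is never zero, `B` itself may be zero once `k` is positive. -/
theorem sum_iterFourier_blk [Finite F] {f : EndFun F} (hf : IsInv f) (hc : SumsToZero f)
    (ψ : AddChar F ℂ) (k : ℕ) : ∀ (A B : Type u) [AddCommGroup A] [Module F A] [AddCommGroup B]
    [Module F B] [Finite A] [Finite B] (a : A →ₗ[F] A) (b : B →ₗ[F] B) (ℓ : B →ₗ[F] F),
    Nontrivial A → (Nontrivial B ∨ 0 < k) →
    ∑ u : B →ₗ[F] A, iterFourier ψ k f (A × B) (ℓ ∘ₗ LinearMap.snd F A B) (blk a u b) = 0 := by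
  induction k with
  | zero =>
    intro A B _ _ _ _ _ _ a b ℓ hA hB
    have := hB.resolve_right (lt_irrefl 0)
    exact hc A B a b
  | succ k ih =>
    intro A B _ _ _ _ _ _ a b ℓ hA _
    have key := fun w : F →ₗ[F] B => ih A (B × F) a (blk b w LinearMap.id) (LinearMap.snd F B F) hA
      (Or.inl inferInstance)
    rw [iterFourier_succ]
    simp_rw [fourier_eq]
    rw [← Finset.mul_sum, ← Fintype.sum_prod_type', ← (homProdEquiv A B F).symm.sum_comp,
      Fintype.sum_prod_type, Finset.sum_eq_zero, mul_zero]
    intro w _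
    rw [← mul_zero (ψ (ℓ (w 1))), ← key w, Finset.mul_sum]
    refine Finset.sum_congr rfl fun v _ => ?_
    congr 1
    refine hf.iterFourier ψ k (LinearEquiv.prodAssoc F A B F) _ _ _ _ ?_ ?_
    · exact fun p => rfl
    · intro p
      have : v (p.1.2, p.2) = v (p.1.2, 0) + v (0, p.2) := by rw [← map_add]; simp
      simp [homProdEquiv, this, add_assoc]

/-- The case `B = 0` of the preceding vanishing, where the sum over `B → A` has the single term
wanted. -/
theorem derivative_eq_zero [Finite F] {f : EndFun F} (hf : IsInv f) (hc : SumsToZero f)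
    (ψ : AddChar F ℂ) {k : ℕ} (hk : 0 < k) {V : Type u} [AddCommGroup V] [Module F V] [Finite V]
    [Nontrivial V] (g : V →ₗ[F] V) : derivative ψ k f V g = 0 := by
  have := sum_iterFourier_blk hf hc ψ k V PUnit.{u + 1} g 0 0 inferInstance (Or.inr hk)
  rw [Fintype.sum_eq_single 0 fun u hu => absurd (Subsingleton.elim _ _) hu] at this
  rw [← this]
  refine hf.iterFourier ψ k (LinearEquiv.prodUnique (R := F) (M := V) (M₂ := PUnit.{u + 1})).symm
    _ _ _ _ (by simp) ?_
  intro v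
  ext; simp

/-- The properties of the character of an irreducible cuspidal representation of `GL_n(F)` which
matter for the computation of derivatives and Hall products. -/
structure IsCuspidalFun (n : ℕ) (f : EndFun F) : Prop where
  isInv : IsInv f
  pos : 0 < n
  hasDegree : HasDegree n f
  sumsToZero : SumsToZero f
  whittaker : ∀ ψ : AddChar F ℂ, ψ ≠ 1 → derivative ψ n f PUnit.{u + 1} 0 = 1

theorem IsCuspidalFun.derivative_eq [Finite F] {f : EndFun F} {n : ℕ} (hf : IsCuspidalFun n f)
    {ψ : AddChar F ℂ} (hψ : ψ ≠ 1) {k : ℕ} (hk : 0 < k) {V : Type u} [AddCommGroup V] [Module F V]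
    [Finite V] (g : V →ₗ[F] V) :
    derivative ψ k f V g = if k = n then hallOne F V g else 0 := by
  rcases subsingleton_or_nontrivial V with hV | hV
  · have h0 : Module.finrank F V = 0 := Module.finrank_zero_of_subsingleton
    split_ifs with hkn
    · subst hkn
      rw [hallOne, if_pos h0, ← hf.whittaker ψ hψ]
      exact hf.isInv.derivative ψ k (0 : V ≃ₗ[F] PUnit.{u + 1}) _ _
        fun v => Subsingleton.elim _ _
    · exact iterFourier_eq_zero_of_finrank hf.hasDegree ψ k _ _ (by omega)
  · rw [derivative_eq_zero hf.isInv hf.sumsToZero ψ hk]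
    have : Module.finrank F V ≠ 0 := (Module.finrank_pos (R := F) (M := V)).ne'
    rw [hallOne, if_neg this, ite_self]

section Lists

variable {ι : Type*} (n : ι → ℕ) (f : ι → EndFun F)

/-- The iterated Hall product. -/
noncomputable def hallProd : List ι → EndFun F
  | [] => hallOne F
  | i :: l => hall (f i) (hallProd l)

/-- The sum of the Hall products over all sublists. -/
noncomputable def hallProdSum : List ι → EndFun F
  | [] => hallOne F
  | i :: l => fun V [_] [_] g => hallProdSum l V g + hall (f i) (hallProdSum l) V g

variable {n f}

theorem isInv_hallProd (hf : ∀ i, IsInv (f i)) (l : List ι) : IsInv (hallProd f l) := by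
  induction l with
  | nil => exact isInv_hallOne
  | cons i l ih => exact (hf i).hall ih

theorem isInv_hallProdSum (hf : ∀ i, IsInv (f i)) (l : List ι) : IsInv (hallProdSum f l) := by
  induction l with
  | nil => exact isInv_hallOne
  | cons i l ih =>
    intro V W _ _ _ _ e g h hg
    exact congrArg₂ _ (ih e g h hg) ((hf i).hall ih e g h hg)

theorem hasDegree_hallProd [Finite F] (hf : ∀ i, HasDegree (n i) (f i)) (l : List ι) :
    HasDegree (l.map n).sum (hallProd f l) := by
  induction l with
  | nil => exact hasDegree_hallOne
  | cons i l ih => rw [List.map_cons, List.sum_cons]; exact (hf i).hall ih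

theorem hallProdSum_eq_zero [Finite F] (hf : ∀ i, HasDegree (n i) (f i)) (l : List ι) :
    ∀ {V : Type u} [AddCommGroup V] [Module F V] [Finite V] (g : V →ₗ[F] V),
      (l.map n).sum < Module.finrank F V → hallProdSum f l V g = 0 := by
  induction l with
  | nil =>
    intro V _ _ _ g hV
    exact hasDegree_hallOne V g hV.ne'
  | cons i l ih =>
    intro V _ _ _ g hV
    rw [List.map_cons, List.sum_cons] at hV
    change hallProdSum f l V g + hall (f i) (hallProdSum f l) V g = 0
    rw [ih g (by omega), zero_add, hall, finsum_eq_zero_of_forall_eq_zero]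
    intro U
    rw [hallTerm]
    split_ifs with hU
    · by_cases h1 : Module.finrank F U = n i
      · have := U.finrank_quotient_add_finrank
        rw [ih _ (by omega), mul_zero]
      · rw [hf i U _ h1, zero_mul]
    · rfl

/-- By the Leibniz rule a derivative distributes over the factors, and each cuspidal factor either
survives untouched or is replaced by the unit. The order of the derivative then only selects the
degree of the part of `∏ (1 + f i)` that is seen on `V`. -/
theorem derivative_hallProd [Finite F] (hf : ∀ i, IsCuspidalFun (n i) (f i)) {ψ : AddChar F ℂ}
    (hψ : ψ ≠ 1) (l : List ι) (k : ℕ) {V : Type u} [AddCommGroup V] [Module F V] [Finite V]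
    (g : V →ₗ[F] V) (hk : Module.finrank F V + k = (l.map n).sum) :
    derivative ψ k (hallProd f l) V g = hallProdSum f l V g := by
  -- Stated for every order, with value 0 off the matching degree, so that the induction hypothesis
  -- applies to all terms of the Leibniz sum.
  have aux : ∀ (l : List ι) (k : ℕ) {V : Type u} [AddCommGroup V] [Module F V] [Finite V]
      (g : V →ₗ[F] V), derivative ψ k (hallProd f l) V g =
        if Module.finrank F V + k = (l.map n).sum then hallProdSum f l V g else 0 := by
    intro l
    induction l with
    | nil =>
      intro k V _ _ _ g
      split_ifs with h
      · have hk : k = 0 := by simp at h; omega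
        subst hk
        rfl
      · exact iterFourier_eq_zero_of_finrank hasDegree_hallOne ψ k _ _ h
    | cons i l ih =>
      intro k V _ _ _ g
      have hP := isInv_hallProd (fun i => (hf i).isInv) l
      split_ifs with h
      · rw [List.map_cons, List.sum_cons] at h
        rw [hallProd, derivative_hall (hf i).isInv hP hψ]
        -- Only the orders 0 and `n i` of the derivative of `f i` are nonzero.
        have key : ∀ p ∈ Finset.HasAntidiagonal.antidiagonal k,
            hall (derivative ψ p.1 (f i)) (derivative ψ p.2 (hallProd f l)) V g =
            (if p.1 = 0 then hall (f i) (hallProdSum f l) V g else 0) +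
              if p.1 = n i then hallProdSum f l V g else 0 := by
          rintro ⟨x, y⟩ hp
          rw [Finset.HasAntidiagonal.mem_antidiagonal] at hp
          dsimp only at hp ⊢
          rcases Nat.eq_zero_or_pos x with rfl | hx
          · rw [if_pos rfl, if_neg (hf i).pos.ne, add_zero, derivative_zero, hall, hall]
            refine finsum_congr fun U => ?_
            rw [hallTerm, hallTerm]
            split_ifs with hU
            · by_cases hd : Module.finrank F U = n i
              · have := U.finrank_quotient_add_finrank
                rw [ih, if_pos (by omega)]
              · rw [(hf i).hasDegree U _ hd, zero_mul, zero_mul]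
            · rfl
          · rw [if_neg hx.ne', zero_add]
            split_ifs with hn
            · subst hn
              rw [hall_congr (f' := hallOne F) (h' := derivative ψ y (hallProd f l)) g
                (fun W _ _ _ g => by rw [(hf i).derivative_eq hψ hx, if_pos rfl])
                (fun _ _ _ _ _ => rfl), hall_hallOne_left (hP.derivative ψ y), ih,
                if_pos (by omega)]
            · rw [hall_congr (f' := fun _ _ _ _ => 0) (h' := derivative ψ y (hallProd f l)) g
                (fun W _ _ _ g => by rw [(hf i).derivative_eq hψ hx, if_neg hn])
                (fun _ _ _ _ _ => rfl), hall_zero_left]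
        rw [Finset.sum_congr rfl key, Finset.sum_add_distrib, hallProdSum, add_comm]
        congr 1
        · by_cases hk : n i ≤ k
          · rw [Finset.sum_eq_single (n i, k - n i)]
            · simp
            · rintro ⟨x, y⟩ hp hne
              rw [Finset.HasAntidiagonal.mem_antidiagonal] at hp
              rw [if_neg]
              rintro rfl
              exact hne (by ext <;> simp; dsimp only at hp; omega)
            · intro h'
              exact absurd (Finset.HasAntidiagonal.mem_antidiagonal.2 (by simp; omega)) h'
          -- If `k < n i` the pair `(n i, k - n i)` does not exist, but then `V` is too large for
          -- the part coming from `l`.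
          · have h1 : hallProdSum f l V g = 0 := by
              refine hallProdSum_eq_zero (fun i => (hf i).hasDegree) l g ?_
              omega
            simp [h1]
        · rw [Finset.sum_eq_single (0, k)]
          · simp
          · rintro ⟨x, y⟩ hp hne
            rw [Finset.HasAntidiagonal.mem_antidiagonal] at hp
            rw [if_neg]
            rintro rfl
            exact hne (by ext <;> simp; dsimp only at hp; omega)
          · intro h'
            exact absurd (Finset.HasAntidiagonal.mem_antidiagonal.2 (by simp)) h'
      · exact iterFourier_eq_zero_of_finrank
          (hasDegree_hallProd (fun i => (hf i).hasDegree) (i :: l)) ψ k _ _ h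
  rw [aux, if_pos hk]

end Lists

end

end FiniteGL

/-! ### The branching rule in terms of derivatives. -/

namespace FiniteGL

universe u

section

variable {F : Type u} [Field F] [Finite F]

omit [Finite F] in
theorem fintype_card_linearMap (V W : Type*) [AddCommGroup V] [Module F V] [AddCommGroup W]
    [Module F W] [Finite V] [Finite W] :
    Fintype.card (V →ₗ[F] W) =
      Nat.card F ^ (Module.finrank F V * Module.finrank F W) := by
  rw [← Nat.card_eq_fintype_card, Module.natCard_eq_pow_finrank (K := F), Module.finrank_linearMap]

/-- The first two factors count the nonzero linear forms on `F ^ (m + 1)` and the columns `u`; they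
cancel the constants in the descent from `m + 1` to `m`. -/
theorem card_GL_succ (m : ℕ) : Nat.card (GL (Fin (m + 1)) F) =
    (Nat.card F ^ (m + 1) - 1) * Nat.card F ^ m * Nat.card (GL (Fin m) F) := by
  have := Fintype.ofFinite F
  rw [Matrix.card_GL_field, Matrix.card_GL_field, Fin.prod_univ_succ, mul_assoc]
  simp only [Nat.card_eq_fintype_card, Fin.val_zero, pow_zero, Fin.val_succ]
  congr 1
  have : ∀ i : Fin m, Fintype.card F ^ (m + 1) - Fintype.card F ^ ((i : ℕ) + 1) =
      Fintype.card F * (Fintype.card F ^ m - Fintype.card F ^ (i : ℕ)) := by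
    intro i
    rw [Nat.mul_sub, pow_succ', pow_succ']
  simp_rw [this]
  rw [Finset.prod_mul_distrib, Finset.prod_const, Finset.card_univ, Fintype.card_fin]

/-- Conjugation by the shear of a vector `v` translates `u` by `g v - v`, up to sign, without
changing `φ`, while the character changes by `ψ (ℓ (g v) - ℓ v)`. Hence a Fourier transform lives on
pairs where `g` fixes `ℓ`, the mirabolic condition when `ℓ ≠ 0`. -/
theorem fourier_eq_zero {φ : FlagFun F} (hφ : IsInvFlag φ) {ψ : AddChar F ℂ} (hψ : ψ ≠ 1)
    {V : Type u} [AddCommGroup V] [Module F V] [Finite V] {ℓ : V →ₗ[F] F} {g : V →ₗ[F] V}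
    (h : ℓ ∘ₗ g ≠ ℓ) : fourier ψ φ V ℓ g = 0 := by
  obtain ⟨v, hv⟩ := exists_char_ne_one hψ (sub_ne_zero.2 h)
  rw [fourier_eq]
  set s := LinearMap.toSpanSingleton F V v with hs
  rw [sum_eq_zero_of_translate _ (g ∘ₗ s - s ∘ₗ LinearMap.id) _ hv, mul_zero]
  intro u
  have h1 : φ (V × F) (LinearMap.snd F V F)
      (blk g (u + (g ∘ₗ s - s ∘ₗ LinearMap.id)) LinearMap.id) =
      φ (V × F) (LinearMap.snd F V F) (blk g u LinearMap.id) := by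
    refine hφ (shear s) _ _ _ _ (fun p => rfl) fun p => ?_
    rw [shear_blk]
    congr 2
    abel
  rw [h1, ← mul_assoc, ← AddChar.map_add_eq_mul]
  congr 2
  simp [hs, add_comm]

theorem sum_char_dual {ψ : AddChar F ℂ} (hψ : ψ ≠ 1) {V : Type u} [AddCommGroup V]
    [Module F V] [Finite V] [DecidableEq (F →ₗ[F] V)] (u : F →ₗ[F] V) :
    ∑ ℓ : V →ₗ[F] F, ψ (ℓ (u 1)) = if u = 0 then (Fintype.card (F →ₗ[F] V) : ℂ) else 0 := by
  split_ifs with hu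
  · subst hu
    simp [fintype_card_linearMap]
  · have hv : u 1 ≠ 0 := by
      intro h
      exact hu (LinearMap.ext_ring (by simpa using h))
    obtain ⟨x, hx⟩ := AddChar.ne_one_iff.1 hψ
    obtain ⟨ℓ, hℓ⟩ := Module.Projective.exists_dual_ne_zero F hv
    refine sum_eq_zero_of_translate _ ((x * (ℓ (u 1))⁻¹) • ℓ) (ψ x) hx fun ℓ' => ?_
    rw [← AddChar.map_add_eq_mul]
    congr 1
    rw [LinearMap.add_apply, LinearMap.smul_apply, smul_eq_mul, inv_mul_cancel_right₀ hℓ, add_comm]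

/-- Fourier inversion at the column `u = 0`. -/
theorem sum_fourier {φ : FlagFun F} {ψ : AddChar F ℂ} (hψ : ψ ≠ 1)
    {V : Type u} [AddCommGroup V] [Module F V] [Finite V] (g : V →ₗ[F] V) :
    ∑ ℓ : V →ₗ[F] F, fourier ψ φ V ℓ g =
      φ (V × F) (LinearMap.snd F V F) (blk g 0 LinearMap.id) := by
  classical
  simp_rw [fourier_eq]
  rw [← Finset.mul_sum, Finset.sum_comm]
  simp_rw [← Finset.sum_mul, sum_char_dual hψ]
  have : (Fintype.card (F →ₗ[F] V) : ℂ) ≠ 0 := by exact_mod_cast Fintype.card_ne_zero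
  simp [this]

/-- Parseval's formula; the pairing being bilinear, the second transform uses `ψ⁻¹` in place of a
complex conjugate. -/
theorem sum_fourier_mul_fourier {φ η : FlagFun F} {ψ : AddChar F ℂ} (hψ : ψ ≠ 1)
    {V : Type u} [AddCommGroup V] [Module F V] [Finite V] (g : V →ₗ[F] V) :
    ∑ u : F →ₗ[F] V, φ (V × F) (LinearMap.snd F V F) (blk g u LinearMap.id) *
        η (V × F) (LinearMap.snd F V F) (blk g u LinearMap.id) =
      Fintype.card (F →ₗ[F] V) * ∑ ℓ : V →ₗ[F] F, fourier ψ φ V ℓ g * fourier ψ⁻¹ η V ℓ g := by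
  classical
  have hc : (Fintype.card (F →ₗ[F] V) : ℂ) ≠ 0 := by exact_mod_cast Fintype.card_ne_zero
  set a := fun u : F →ₗ[F] V => φ (V × F) (LinearMap.snd F V F) (blk g u LinearMap.id)
  set b := fun u : F →ₗ[F] V => η (V × F) (LinearMap.snd F V F) (blk g u LinearMap.id)
  have h1 : ∀ ℓ : V →ₗ[F] F, fourier ψ φ V ℓ g * fourier ψ⁻¹ η V ℓ g =
      (Fintype.card (F →ₗ[F] V) : ℂ)⁻¹ ^ 2 *
        ∑ u : F →ₗ[F] V, ∑ v : F →ₗ[F] V, ψ (ℓ ((u - v) 1)) * (a u * b v) := by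
    intro ℓ
    rw [fourier_eq, fourier_eq, mul_mul_mul_comm, Finset.sum_mul_sum, ← sq]
    congr 1
    refine Finset.sum_congr rfl fun u _ => Finset.sum_congr rfl fun v _ => ?_
    rw [AddChar.inv_apply, mul_mul_mul_comm, ← AddChar.map_add_eq_mul, LinearMap.sub_apply,
      map_sub, sub_eq_add_neg]
  simp_rw [h1]
  rw [← Finset.mul_sum, Finset.sum_comm]
  have h2 : ∀ u : F →ₗ[F] V, ∑ ℓ : V →ₗ[F] F, ∑ v : F →ₗ[F] V,
      ψ (ℓ ((u - v) 1)) * (a u * b v) = Fintype.card (F →ₗ[F] V) * (a u * b u) := by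
    intro u
    rw [Finset.sum_comm]
    simp_rw [← Finset.sum_mul, sum_char_dual hψ, sub_eq_zero]
    simp
  simp_rw [h2, ← Finset.mul_sum]
  field_simp
  rfl

theorem sum_eq_add_sum_ne {X : Type*} [Fintype X] (a : X) [DecidablePred fun x => x ≠ a]
    (f : X → ℂ) : ∑ x, f x = f a + ∑ x with x ≠ a, f x := by
  classical
  rw [← Finset.add_sum_erase _ _ (Finset.mem_univ a)]
  congr 1
  refine Finset.sum_congr ?_ fun _ _ => rfl
  ext
  simp

omit [Finite F] in
theorem exists_equiv_prod_snd {V W : Type u} [AddCommGroup V] [Module F V] [Finite V]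
    [AddCommGroup W] [Module F W] [Finite W]
    (hd : Module.finrank F V = Module.finrank F W + 1) {ℓ : V →ₗ[F] F} (hℓ : ℓ ≠ 0) :
    ∃ e : V ≃ₗ[F] W × F, ∀ v, (e v).2 = ℓ v := by
  have hs := LinearMap.surjective hℓ
  obtain ⟨v₀, hv₀⟩ := hs 1
  have hk : Module.finrank F W = Module.finrank F ℓ.ker := by
    have := ℓ.finrank_range_add_finrank_ker
    rw [LinearMap.range_eq_top.2 hs, finrank_top, Module.finrank_self] at this
    omega
  have e₀ : W ≃ₗ[F] ℓ.ker := LinearEquiv.ofFinrankEq _ _ hk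
  let i : W × F →ₗ[F] V := (ℓ.ker.subtype ∘ₗ (e₀ : W →ₗ[F] ℓ.ker)).coprod
    (LinearMap.toSpanSingleton F V v₀)
  have hi2 : ∀ p, ℓ (i p) = p.2 := by
    intro p
    have : ℓ (e₀ p.1 : V) = 0 := (e₀ p.1).2
    simp [i, hv₀, this]
  have hi : Function.Injective i := by
    rw [injective_iff_map_eq_zero]
    intro p hp
    have h2 : p.2 = 0 := by rw [← hi2, hp, map_zero]
    ext
    · simpa [i, h2] using hp
    · exact h2
  refine ⟨(i.linearEquivOfInjective hi (by
    rw [Module.finrank_prod, Module.finrank_self, hd])).symm, fun v => ?_⟩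
  rw [← hi2]
  congr 1
  exact (i.linearEquivOfInjective hi _).apply_symm_apply v

/-- Any nonzero form is carried to `snd` by an isomorphism `V ≃ W × F`, so all of them contribute
alike. -/
theorem sum_flag_ne_zero {α : FlagFun F} (hα : IsInvFlag α) {V W : Type u} [AddCommGroup V]
    [Module F V] [Finite V] [AddCommGroup W] [Module F W] [Finite W]
    [DecidablePred fun ℓ : V →ₗ[F] F => ℓ ≠ 0]
    (hd : Module.finrank F V = Module.finrank F W + 1) :
    ∑ ℓ : V →ₗ[F] F with ℓ ≠ 0, ∑ g : V →ₗ[F] V, α V ℓ g =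
      (Nat.card F ^ (Module.finrank F W + 1) - 1 : ℕ) *
        ∑ g : W × F →ₗ[F] W × F, α (W × F) (LinearMap.snd F W F) g := by
  have h1 : ∀ ℓ ∈ Finset.univ.filter (fun ℓ : V →ₗ[F] F => ℓ ≠ 0), ∑ g : V →ₗ[F] V, α V ℓ g =
      ∑ g : W × F →ₗ[F] W × F, α (W × F) (LinearMap.snd F W F) g := by
    intro ℓ hℓ
    obtain ⟨e, he⟩ := exists_equiv_prod_snd (W := W) hd (Finset.mem_filter.1 hℓ).2
    refine Fintype.sum_equiv e.conj.toEquiv _ _ fun g => hα e _ _ _ _ he fun v => ?_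
    simp [LinearEquiv.conj_apply]
  rw [Finset.sum_congr rfl h1, Finset.sum_const, nsmul_eq_mul]
  congr 2
  have h2 := Finset.card_filter_add_card_filter_not (s := (Finset.univ : Finset (V →ₗ[F] F)))
    (fun ℓ => ℓ ≠ 0)
  have h3 : (Finset.univ.filter fun ℓ : V →ₗ[F] F => ¬ ℓ ≠ 0) = {0} := by ext; simp
  rw [h3, Finset.card_singleton, Finset.card_univ, fintype_card_linearMap, hd, Module.finrank_self,
    mul_one] at h2
  omega

theorem sum_flag_snd {α : FlagFun F} {W : Type u} [AddCommGroup W] [Module F W] [Finite W]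
    (hα : ∀ g : W × F →ₗ[F] W × F, LinearMap.snd F W F ∘ₗ g ≠ LinearMap.snd F W F →
      α (W × F) (LinearMap.snd F W F) g = 0) :
    ∑ g : W × F →ₗ[F] W × F, α (W × F) (LinearMap.snd F W F) g =
      ∑ g : W →ₗ[F] W, ∑ u : F →ₗ[F] W,
        α (W × F) (LinearMap.snd F W F) (blk g u LinearMap.id) := by
  rw [← Fintype.sum_prod_type']
  refine (Fintype.sum_of_injective
    (fun p : (W →ₗ[F] W) × (F →ₗ[F] W) => blk p.1 p.2 LinearMap.id) ?_ _ _ ?_ ?_).symm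
  · rintro ⟨g, u⟩ ⟨g', u'⟩ h
    have h' := fun p => congrArg Prod.fst (LinearMap.congr_fun h p)
    ext x
    · simpa using h' (x, 0)
    · simpa using h' (0, 1)
  · intro g hg
    refine hα g fun h => hg ⟨(LinearMap.fst F W F ∘ₗ g ∘ₗ LinearMap.inl F W F,
      LinearMap.fst F W F ∘ₗ g ∘ₗ LinearMap.inr F W F), ?_⟩
    refine LinearMap.ext fun p => Prod.ext ?_ ?_
    · have : g p = g (p.1, 0) + g (0, p.2) := by rw [← map_add]; simp
      simp [this]
    · exact (LinearMap.congr_fun h p).symm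
  · intro p; rfl

/-- The bilinear pairing of functions on the endomorphisms of `F ^ d`. -/
noncomputable def pairing (d : ℕ) (f h : EndFun F) : ℂ :=
  (Nat.card (GL (Fin d) F) : ℂ)⁻¹ *
    ∑ g : (Fin d → F) →ₗ[F] (Fin d → F), f (Fin d → F) g * h (Fin d → F) g

theorem card_GL_ne_zero (d : ℕ) : (Nat.card (GL (Fin d) F) : ℂ) ≠ 0 := by
  exact_mod_cast Nat.card_pos.ne'

/-- Separate the forms `ℓ = 0` and `ℓ ≠ 0`. The zero form gives the pairing of derivatives with `i =
0`. The nonzero forms reduce to `snd` on `F ^ (m - 1) × F`, where the transform of positive order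
forces `g` to fix `snd`; Parseval in the last column then gives the same sum with `m` lowered and
`j` raised by one. -/
theorem sum_flag_eq_sum_pairing {f h : EndFun F} (hf : IsInv f) (hh : IsInv h)
    {ψ : AddChar F ℂ} (hψ : ψ ≠ 1) (m : ℕ) : ∀ j : ℕ,
    (Nat.card (GL (Fin m) F) : ℂ)⁻¹ * ∑ ℓ : (Fin m → F) →ₗ[F] F,
        ∑ g : (Fin m → F) →ₗ[F] (Fin m → F),
          iterFourier ψ (j + 1) f _ ℓ g * iterFourier ψ⁻¹ j h _ ℓ g =
      ∑ i ∈ Finset.range (m + 1),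
        pairing (m - i) (derivative ψ (j + i + 1) f) (derivative ψ⁻¹ (j + i) h) := by
  classical
  have split : ∀ (m j : ℕ), ∑ ℓ : (Fin m → F) →ₗ[F] F, ∑ g : (Fin m → F) →ₗ[F] (Fin m → F),
          iterFourier ψ (j + 1) f _ ℓ g * iterFourier ψ⁻¹ j h _ ℓ g =
      Nat.card (GL (Fin m) F) * pairing m (derivative ψ (j + 1) f) (derivative ψ⁻¹ j h) +
      ∑ ℓ : (Fin m → F) →ₗ[F] F with ℓ ≠ 0, ∑ g : (Fin m → F) →ₗ[F] (Fin m → F),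
          iterFourier ψ (j + 1) f _ ℓ g * iterFourier ψ⁻¹ j h _ ℓ g := by
    intro m j
    rw [pairing, mul_inv_cancel_left₀ (card_GL_ne_zero m), sum_eq_add_sum_ne 0]
    rfl
  induction m with
  | zero =>
    intro j
    rw [split, Finset.sum_eq_zero, add_zero, inv_mul_cancel_left₀ (card_GL_ne_zero 0)]
    · simp
    · intro ℓ hℓ
      simp only [Finset.mem_filter, Finset.mem_univ, true_and] at hℓ
      exact absurd (Subsingleton.elim _ _) hℓ
  | succ m ih =>
    intro j
    rw [split, mul_add, inv_mul_cancel_left₀ (card_GL_ne_zero (m + 1)), Finset.sum_range_succ',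
      add_comm]
    congr 1
    have hα : IsInvFlag fun V [_] [_] ℓ g =>
        iterFourier ψ (j + 1) f V ℓ g * iterFourier ψ⁻¹ j h V ℓ g := by
      intro V W _ _ _ _ e k l g h' hk hg
      exact congrArg₂ _ (hf.iterFourier ψ _ e k l g h' hk hg)
        (hh.iterFourier ψ⁻¹ _ e k l g h' hk hg)
    have key := sum_flag_ne_zero hα (V := Fin (m + 1) → F) (W := Fin m → F) (by simp)
    rw [sum_flag_snd (α := fun V [_] [_] ℓ g =>
        iterFourier ψ (j + 1) f V ℓ g * iterFourier ψ⁻¹ j h V ℓ g) (fun g hg => by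
      rw [iterFourier_succ, fourier_eq_zero (hf.iterFourier ψ j) hψ hg, zero_mul])] at key
    simp_rw [sum_fourier_mul_fourier hψ, ← iterFourier_succ] at key
    rw [key, ← Finset.mul_sum, Finset.sum_comm, card_GL_succ, fintype_card_linearMap,
      Module.finrank_self, Module.finrank_fin_fun, one_mul]
    have hq : 1 < Nat.card F := Finite.one_lt_card
    have h1 : ((Nat.card F ^ (m + 1) - 1 : ℕ) : ℂ) ≠ 0 := by
      exact_mod_cast (Nat.sub_pos_of_lt (Nat.one_lt_pow (by omega) hq)).ne'
    have h2 : ((Nat.card F ^ m : ℕ) : ℂ) ≠ 0 := by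
      exact_mod_cast (pow_pos (by omega) m).ne'
    have h3 := ih (j + 1)
    rw [inv_mul_eq_iff_eq_mul₀ (card_GL_ne_zero _)] at h3
    rw [h3]
    have h4 : ∀ i ∈ Finset.range (m + 1),
        pairing (m - i) (derivative ψ (j + 1 + i + 1) f) (derivative ψ⁻¹ (j + 1 + i) h) =
        pairing (m + 1 - (i + 1)) (derivative ψ (j + (i + 1) + 1) f)
          (derivative ψ⁻¹ (j + (i + 1)) h) := by
      intro i _
      rw [Nat.add_sub_add_right, add_assoc j 1 i, add_comm 1 i]
    rw [Finset.sum_congr rfl h4]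
    push_cast
    push_cast at h1 h2
    have h5 := card_GL_ne_zero (F := F) m
    field_simp

/-- The branching rule from `GL_{m+1}` to `GL_m` in terms of derivatives. -/
theorem sum_blk_mul_eq_sum_pairing {f h : EndFun F} (hf : IsInv f) (hh : IsInv h)
    {ψ : AddChar F ℂ} (hψ : ψ ≠ 1) (m : ℕ) :
    (Nat.card (GL (Fin m) F) : ℂ)⁻¹ * ∑ g : (Fin m → F) →ₗ[F] (Fin m → F),
        f ((Fin m → F) × F) (blk g 0 LinearMap.id) * h (Fin m → F) g =
      ∑ i ∈ Finset.range (m + 1),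
        pairing (m - i) (derivative ψ (i + 1) f) (derivative ψ⁻¹ i h) := by
  have := sum_flag_eq_sum_pairing hf hh hψ m 0
  simp_rw [zero_add] at this
  rw [← this, Finset.sum_comm]
  congr 1
  refine Finset.sum_congr rfl fun g _ => ?_
  rw [iterFourier_zero, ← Finset.sum_mul]
  congr 1
  -- Inversion turns the sum over forms of the first transform of `f` into its value at `diag(g,
  -- 1)`; `h` carries no form at order 0.
  rw [iterFourier_succ, sum_fourier hψ]
  rfl

end

end FiniteGL

/-! ### Frobenius reciprocity for Hall products. -/

namespace FiniteGL

universe u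

section

variable {F : Type u} [Field F] [Finite F]

instance {V W : Type*} [AddCommGroup V] [Module F V] [Finite V] [AddCommGroup W] [Module F W]
    [Finite W] : Finite (V ≃ₗ[F] W) := DFunLike.finite _

open Classical in
noncomputable instance {V W : Type*} [AddCommGroup V] [Module F V] [Finite V] [AddCommGroup W]
    [Module F W] [Finite W] : Fintype (V ≃ₗ[F] W) := Fintype.ofFinite _

omit [Finite F] in
theorem card_linearEquiv_self {V : Type*} [AddCommGroup V] [Module F V] [Finite V] {d : ℕ}
    (hd : Module.finrank F V = d) :
    Fintype.card (V ≃ₗ[F] V) = Nat.card (GL (Fin d) F) := by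
  have e : V ≃ₗ[F] (Fin d → F) := LinearEquiv.ofFinrankEq _ _ (by simp [hd])
  rw [← Nat.card_eq_fintype_card]
  refine Nat.card_congr ?_
  refine Equiv.trans ?_ (Matrix.GeneralLinearGroup.toLin (n := Fin d) (R := F)).symm.toEquiv
  refine Equiv.trans ?_ (LinearMap.GeneralLinearGroup.generalLinearEquiv F _).symm.toEquiv
  exact
    { toFun := fun x => (e.symm.trans x).trans e
      invFun := fun x => (e.trans x).trans e.symm
      left_inv := fun x => by ext; simp
      right_inv := fun x => by ext; simp }

omit [Finite F] in
theorem card_linearEquiv_ne_zero {V : Type*} [AddCommGroup V] [Module F V] [Finite V] :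
    (Fintype.card (V ≃ₗ[F] V) : ℂ) ≠ 0 := by
  exact_mod_cast Fintype.card_ne_zero

theorem pairing_eq {f h : EndFun F} (hf : IsInv f) (hh : IsInv h) {V : Type u} [AddCommGroup V]
    [Module F V] [Finite V] {d : ℕ} (hd : Module.finrank F V = d) :
    pairing d f h = (Fintype.card (V ≃ₗ[F] V) : ℂ)⁻¹ * ∑ g : V →ₗ[F] V, f V g * h V g := by
  rw [pairing, card_linearEquiv_self hd]
  congr 1
  have e : (Fin d → F) ≃ₗ[F] V := LinearEquiv.ofFinrankEq _ _ (by simp [hd])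
  refine Fintype.sum_equiv e.conj.toEquiv _ _ fun g => ?_
  have : ∀ v, e (g v) = e.conj g (e v) := by intro v; simp [LinearEquiv.conj_apply]
  exact congrArg₂ _ (hf e _ _ this) (hh e _ _ this)

section Induction

variable {A B : Type u} [AddCommGroup A] [Module F A] [AddCommGroup B] [Module F B] [Finite A]
  [Finite B]

omit [Finite F] in
theorem exists_map_range_inl_eq {U : Submodule F (A × B)}
    (hU : Module.finrank F U = Module.finrank F A) :
    ∃ e : (A × B) ≃ₗ[F] (A × B),
      (LinearMap.inl F A B).range.map (e : (A × B) →ₗ[F] (A × B)) = U := by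
  obtain ⟨C, hC⟩ := U.exists_isCompl
  have h1 := Submodule.finrank_add_eq_of_isCompl hC
  rw [Module.finrank_prod] at h1
  let e₁ : A ≃ₗ[F] U := LinearEquiv.ofFinrankEq _ _ hU.symm
  let e₂ : B ≃ₗ[F] C := LinearEquiv.ofFinrankEq _ _ (by omega)
  refine ⟨(e₁.prodCongr e₂).trans (U.prodEquivOfIsCompl C hC), ?_⟩
  rw [← LinearMap.range_comp]
  ext v
  constructor
  · rintro ⟨x, rfl⟩
    simp
  · intro hv
    exact ⟨e₁.symm ⟨v, hv⟩, by simp⟩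

/-- Block upper triangular automorphisms of `A × B`. -/
def blkEquiv (a : A ≃ₗ[F] A) (u : B →ₗ[F] A) (b : B ≃ₗ[F] B) : (A × B) ≃ₗ[F] (A × B) :=
  (a.prodCongr b).trans (shear (u ∘ₗ (b.symm : B →ₗ[F] B)))

omit [Finite F] [Finite A] [Finite B] in
theorem blkEquiv_apply (a : A ≃ₗ[F] A) (u : B →ₗ[F] A) (b : B ≃ₗ[F] B) (p : A × B) :
    blkEquiv a u b p = (a p.1 + u p.2, b p.2) := by
  simp [blkEquiv]

omit [Finite F] [Finite A] [Finite B] in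
theorem mem_range_inl_iff {p : A × B} : p ∈ (LinearMap.inl F A B).range ↔ p.2 = 0 := by
  constructor
  · rintro ⟨x, rfl⟩; rfl
  · intro h; exact ⟨p.1, Prod.ext rfl h.symm⟩

omit [Finite F] [Finite A] [Finite B] in
theorem blkEquiv_inj {a a' : A ≃ₗ[F] A} {u u' : B →ₗ[F] A} {b b' : B ≃ₗ[F] B}
    (h : blkEquiv a u b = blkEquiv a' u' b') : a = a' ∧ u = u' ∧ b = b' := by
  have h' := fun p => LinearEquiv.congr_fun h p
  simp only [blkEquiv_apply, Prod.mk.injEq] at h'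
  refine ⟨?_, ?_, ?_⟩
  · ext x; simpa using (h' (x, 0)).1
  · ext y; simpa using (h' (0, y)).1
  · ext y; exact (h' (0, y)).2

omit [Finite F] in
theorem exists_blkEquiv_eq {e : (A × B) ≃ₗ[F] (A × B)} (h0 : ∀ x, (e (x, 0)).2 = 0) :
    ∃ a u b, blkEquiv a u b = e := by
  have hadd : ∀ p : A × B, e p = e (p.1, 0) + e (0, p.2) := by
    intro p; rw [← map_add]; simp
  let a : A →ₗ[F] A := LinearMap.fst F A B ∘ₗ (e : (A × B) →ₗ[F] (A × B)) ∘ₗ LinearMap.inl F A B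
  let b : B →ₗ[F] B := LinearMap.snd F A B ∘ₗ (e : (A × B) →ₗ[F] (A × B)) ∘ₗ LinearMap.inr F A B
  have ha : Function.Injective a := by
    intro x y hxy
    have : e (x, 0) = e (y, 0) := Prod.ext hxy (by rw [h0, h0])
    simpa using e.injective this
  have hb : Function.Surjective b := by
    intro y
    obtain ⟨p, hp⟩ := e.surjective (0, y)
    refine ⟨p.2, ?_⟩
    have := congrArg Prod.snd hp
    rw [hadd, Prod.snd_add, h0, zero_add] at this
    exact this
  refine ⟨LinearEquiv.ofBijective a ⟨ha, Finite.surjective_of_injective ha⟩,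
    LinearMap.fst F A B ∘ₗ (e : (A × B) →ₗ[F] (A × B)) ∘ₗ LinearMap.inr F A B,
    LinearEquiv.ofBijective b ⟨Finite.injective_iff_surjective.2 hb, hb⟩, ?_⟩
  refine LinearEquiv.ext fun p => ?_
  rw [blkEquiv_apply, hadd p]
  refine Prod.ext ?_ ?_
  · rw [Prod.fst_add]; rfl
  · rw [Prod.snd_add, h0, zero_add]; rfl

omit [Finite F] in
open Classical in
theorem card_stabilizer_range_inl :
    Fintype.card {e : (A × B) ≃ₗ[F] (A × B) // (LinearMap.inl F A B).range.map
      (e : (A × B) →ₗ[F] (A × B)) = (LinearMap.inl F A B).range} =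
    Fintype.card (A ≃ₗ[F] A) * Fintype.card (B →ₗ[F] A) * Fintype.card (B ≃ₗ[F] B) := by
  rw [← Fintype.card_prod, ← Fintype.card_prod]
  symm
  refine Fintype.card_of_bijective (f := fun t : ((A ≃ₗ[F] A) × (B →ₗ[F] A)) × (B ≃ₗ[F] B) =>
    ⟨blkEquiv t.1.1 t.1.2 t.2, ?_⟩) ⟨?_, ?_⟩
  · ext p
    rw [Submodule.mem_map_equiv, mem_range_inl_iff, mem_range_inl_iff]
    obtain ⟨q, rfl⟩ := (blkEquiv t.1.1 t.1.2 t.2).surjective p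
    rw [LinearEquiv.symm_apply_apply]
    simp [blkEquiv_apply]
  · rintro ⟨⟨a, u⟩, b⟩ ⟨⟨a', u'⟩, b'⟩ h
    obtain ⟨h1, h2, h3⟩ := blkEquiv_inj (congrArg Subtype.val h)
    exact Prod.ext (Prod.ext h1 h2) h3
  · rintro ⟨e, he⟩
    obtain ⟨a, u, b, h⟩ := exists_blkEquiv_eq (e := e) fun x => by
      rw [← mem_range_inl_iff (F := F), ← he]
      exact Submodule.mem_map_of_mem ⟨x, rfl⟩
    exact ⟨((a, u), b), Subtype.ext h⟩

omit [Finite F] in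
open Classical in
-- The Hall product as an average over the whole group: every subspace of the dimension of `A` is
-- the image of `A` under as many automorphisms as its stabilizer has elements, and subspaces of
-- other dimensions contribute nothing because `f` has a degree.
theorem sum_hallTerm_conj {f h : EndFun F} (hf : IsInv f) (hh : IsInv h)
    (hd : HasDegree (Module.finrank F A) f) (g : (A × B) →ₗ[F] (A × B)) :
    ∑ e : (A × B) ≃ₗ[F] (A × B),
        hallTerm f h (A × B) (e.symm.conj g) (LinearMap.inl F A B).range =
      (Fintype.card (A ≃ₗ[F] A) * Fintype.card (B →ₗ[F] A) * Fintype.card (B ≃ₗ[F] B) : ℕ) *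
        hall f h (A × B) g := by
  have h1 : ∀ e : (A × B) ≃ₗ[F] (A × B),
      hallTerm f h (A × B) (e.symm.conj g) (LinearMap.inl F A B).range =
      hallTerm f h (A × B) g ((LinearMap.inl F A B).range.map (e : (A × B) →ₗ[F] (A × B))) := by
    intro e
    refine (hallTerm_map hf hh e _ _ (fun v => ?_) _).symm
    simp [LinearEquiv.conj_apply]
  simp_rw [h1]
  rw [← card_stabilizer_range_inl, hall, finsum_eq_sum_of_fintype, Finset.mul_sum,
    ← Finset.sum_fiberwise Finset.univ fun e : (A × B) ≃ₗ[F] (A × B) =>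
      (LinearMap.inl F A B).range.map (e : (A × B) →ₗ[F] (A × B))]
  refine Finset.sum_congr rfl fun U _ => ?_
  rw [Finset.sum_congr rfl (g := fun _ => hallTerm f h (A × B) g U), Finset.sum_const,
    nsmul_eq_mul]
  swap
  · intro e he
    rw [(Finset.mem_filter.1 he).2]
  by_cases hU : Module.finrank F U = Module.finrank F A
  · congr 2
    obtain ⟨e₀, he₀⟩ := exists_map_range_inl_eq hU
    rw [Fintype.card_subtype]
    refine Finset.card_bij' (fun e _ => e.trans e₀.symm) (fun e _ => e.trans e₀) ?_ ?_ ?_ ?_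
    · intro e he
      simp only [Finset.mem_filter, Finset.mem_univ, true_and] at he ⊢
      have h2 := Submodule.map_comp (e : (A × B) →ₗ[F] (A × B))
        (e₀.symm : (A × B) →ₗ[F] (A × B)) (LinearMap.inl F A B).range
      have h3 := Submodule.map_comp (e₀ : (A × B) →ₗ[F] (A × B))
        (e₀.symm : (A × B) →ₗ[F] (A × B)) (LinearMap.inl F A B).range
      rw [he, ← he₀, ← h3] at h2
      refine h2.trans ?_
      simp
    · intro e he
      simp only [Finset.mem_filter, Finset.mem_univ, true_and] at he ⊢
      have h2 := Submodule.map_comp (e : (A × B) →ₗ[F] (A × B))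
        (e₀ : (A × B) →ₗ[F] (A × B)) (LinearMap.inl F A B).range
      rw [he, he₀] at h2
      exact h2
    · intro e _; exact LinearEquiv.ext fun p => by simp
    · intro e _; exact LinearEquiv.ext fun p => by simp
  · have : hallTerm f h (A × B) g U = 0 := by
      rw [hallTerm]
      split_ifs
      · rw [hd U _ hU, zero_mul]
      · rfl
    rw [this, mul_zero, mul_zero]

omit [Finite F] in
theorem sum_mul_hallTerm {f h : EndFun F} (hf : IsInv f) (hh : IsInv h)
    (X : ((A × B) →ₗ[F] (A × B)) → ℂ) :
    ∑ g : (A × B) →ₗ[F] (A × B), X g * hallTerm f h (A × B) g (LinearMap.inl F A B).range =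
      ∑ a : A →ₗ[F] A, ∑ b : B →ₗ[F] B, ∑ u : B →ₗ[F] A, X (blk a u b) * (f A a * h B b) := by
  refine Eq.trans (Fintype.sum_of_injective
    (fun t : ((A →ₗ[F] A) × (B →ₗ[F] B)) × (B →ₗ[F] A) => blk t.1.1 t.2 t.1.2) ?_
    (fun t => X (blk t.1.1 t.2 t.1.2) * (f A t.1.1 * h B t.1.2)) _ ?_ ?_).symm
    (by simp_rw [Fintype.sum_prod_type])
  · rintro ⟨⟨a, b⟩, u⟩ ⟨⟨a', b'⟩, u'⟩ h
    have h' := fun p => LinearMap.congr_fun h p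
    simp only [blk_apply, Prod.mk.injEq] at h'
    refine Prod.ext (Prod.ext ?_ ?_) ?_
    · ext x; simpa using (h' (x, 0)).1
    · ext y; exact (h' (0, y)).2
    · ext y; simpa using (h' (0, y)).1
  · intro g hg
    rw [hallTerm, dif_neg, mul_zero]
    intro h
    have h0 : ∀ x, (g (x, 0)).2 = 0 := fun x => by
      rw [← mem_range_inl_iff (F := F)]
      exact h ⟨x, rfl⟩
    refine hg ⟨((LinearMap.fst F A B ∘ₗ g ∘ₗ LinearMap.inl F A B,
      LinearMap.snd F A B ∘ₗ g ∘ₗ LinearMap.inr F A B),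
      LinearMap.fst F A B ∘ₗ g ∘ₗ LinearMap.inr F A B), LinearMap.ext fun p => ?_⟩
    have : g p = g (p.1, 0) + g (0, p.2) := by rw [← map_add]; simp
    exact Prod.ext (by simp [this]) (by simp [this, h0])
  · rintro ⟨⟨a, b⟩, u⟩
    congr 1
    refine (hallTerm_eq hf hh (LinearMap.inl F A B) LinearMap.inl_injective rfl
      (LinearMap.snd F A B) LinearMap.snd_surjective ?_ a ?_ b ?_).symm
    · ext p; rw [LinearMap.mem_ker, mem_range_inl_iff]; rfl
    · intro x; simp
    · intro x; simp

end Induction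

/-- The adjoint of Hall multiplication by a function of degree `p`. -/
noncomputable def skew (p : ℕ) (a f : EndFun F) : EndFun F := fun B [_] [_] y =>
  (Nat.card (GL (Fin p) F) : ℂ)⁻¹ * ∑ x : (Fin p → F) →ₗ[F] (Fin p → F), a (Fin p → F) x *
    ((Nat.card (B →ₗ[F] (Fin p → F)) : ℂ)⁻¹ *
      ∑ᶠ u : B →ₗ[F] (Fin p → F), f ((Fin p → F) × B) (blk x u y))

theorem skew_eq (p : ℕ) (a f : EndFun F) {B : Type u} [AddCommGroup B] [Module F B] [Finite B]
    (y : B →ₗ[F] B) : skew p a f B y =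
  (Nat.card (GL (Fin p) F) : ℂ)⁻¹ * ∑ x : (Fin p → F) →ₗ[F] (Fin p → F), a (Fin p → F) x *
    ((Fintype.card (B →ₗ[F] (Fin p → F)) : ℂ)⁻¹ *
      ∑ u : B →ₗ[F] (Fin p → F), f ((Fin p → F) × B) (blk x u y)) := by
  simp_rw [skew, finsum_eq_sum_of_fintype, Nat.card_eq_fintype_card]

/-- Frobenius reciprocity. -/
theorem pairing_hall {a f h : EndFun F} (ha : IsInv a) (hf : IsInv f) (hh : IsInv h) {p : ℕ}
    (hd : HasDegree p a) (d : ℕ) : pairing (p + d) f (hall a h) = pairing d (skew p a f) h := by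
  have hp : Module.finrank F (Fin p → F) = p := by simp
  have hd' : Module.finrank F (Fin d → F) = d := by simp
  rw [pairing_eq hf (ha.hall hh) (V := (Fin p → F) × (Fin d → F)) (by simp), pairing]
  have key := fun g => sum_hallTerm_conj (A := Fin p → F) (B := Fin d → F) ha hh
    (by rwa [hp]) g
  rw [card_linearEquiv_self hp, card_linearEquiv_self hd'] at key
  have hc : (Fintype.card ((Fin d → F) →ₗ[F] (Fin p → F)) : ℂ) ≠ 0 := by
    exact_mod_cast Fintype.card_ne_zero
  have h1 := card_GL_ne_zero (F := F) p
  have h2 := card_GL_ne_zero (F := F) d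
  have key' : ∀ g, hall a h ((Fin p → F) × (Fin d → F)) g =
      ((Nat.card (GL (Fin p) F) : ℂ)⁻¹ * (Fintype.card ((Fin d → F) →ₗ[F] (Fin p → F)) : ℂ)⁻¹ *
        (Nat.card (GL (Fin d) F) : ℂ)⁻¹) * ∑ e : ((Fin p → F) × (Fin d → F)) ≃ₗ[F] _,
        hallTerm a h _ (e.symm.conj g) (LinearMap.inl F (Fin p → F) (Fin d → F)).range := by
    intro g
    rw [key g]
    push_cast
    field_simp
  simp_rw [key']
  -- As `f` is conjugation invariant, every `e` contributes the same, and only block triangular `g`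
  -- remain.
  have h3 : ∑ g : ((Fin p → F) × (Fin d → F)) →ₗ[F] _, f _ g * ∑ e : ((Fin p → F) × (Fin d → F))
      ≃ₗ[F] _, hallTerm a h _ (e.symm.conj g) (LinearMap.inl F (Fin p → F) (Fin d → F)).range =
      Fintype.card (((Fin p → F) × (Fin d → F)) ≃ₗ[F] ((Fin p → F) × (Fin d → F))) *
      ∑ x : (Fin p → F) →ₗ[F] _, ∑ y : (Fin d → F) →ₗ[F] _, ∑ u : (Fin d → F) →ₗ[F] (Fin p → F),
        f _ (blk x u y) * (a _ x * h _ y) := by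
    rw [← sum_mul_hallTerm ha hh]
    simp_rw [Finset.mul_sum]
    rw [Finset.sum_comm, ← Finset.mul_sum, ← nsmul_eq_mul, ← Finset.card_univ, ← Finset.sum_const]
    refine Finset.sum_congr rfl fun e _ => ?_
    refine Fintype.sum_equiv e.symm.conj.toEquiv _ _ fun g => ?_
    congr 1
    refine hf e.symm _ _ fun v => ?_
    simp [LinearEquiv.conj_apply]
  simp_rw [mul_left_comm (f _ _), ← Finset.mul_sum, h3]
  rw [mul_left_comm, inv_mul_cancel_left₀ card_linearEquiv_ne_zero]
  simp_rw [skew_eq, Finset.mul_sum, Finset.sum_mul, Finset.mul_sum]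
  rw [Finset.sum_comm]
  refine Finset.sum_congr rfl fun y _ => Finset.sum_congr rfl fun x _ =>
    Finset.sum_congr rfl fun u _ => ?_
  ring

end

end FiniteGL

/-! ### The adjoint of multiplication by a cuspidal function is a derivation. -/

namespace FiniteGL

universe u

section

variable {F : Type u} [Field F]

section SubQuotient

variable {V : Type u} [AddCommGroup V] [Module F V] [Finite V]

/-- A coordinate-free form of cuspidality: a splitting `V ≃ U × V ⧸ U` turns the translates of `x`
by `Hom(V ⧸ U, U)` into the block matrices with fixed diagonal blocks. -/
theorem SumsToZero.sum_add_comp_mkQ {f : EndFun F} (hf : IsInv f) (hc : SumsToZero f)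
    {U : Submodule F V} (h0 : U ≠ ⊥) (h1 : U ≠ ⊤) {x : V →ₗ[F] V} (hx : U ≤ U.comap x) :
    ∑ v : (V ⧸ U) →ₗ[F] U, f V (x + U.subtype ∘ₗ v ∘ₗ U.mkQ) = 0 := by
  obtain ⟨s, hs⟩ := U.mkQ.exists_rightInverse_of_surjective U.range_mkQ
  have hs' : ∀ q, U.mkQ (s q) = q := fun q => LinearMap.congr_fun hs q
  let φ : (U × (V ⧸ U)) →ₗ[F] V := U.subtype.coprod s
  have hφ : ∀ p, φ p = p.1 + s p.2 := fun p => by simp [φ]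
  have hm : ∀ p, U.mkQ (φ p) = p.2 := fun p => by
    rw [hφ, map_add, hs', Submodule.mkQ_apply, (Submodule.Quotient.mk_eq_zero U).2 p.1.2, zero_add]
  have hb : Function.Bijective φ := by
    constructor
    · intro p q hpq
      have h2 : p.2 = q.2 := by rw [← hm, hpq, hm]
      refine Prod.ext (Subtype.ext ?_) h2
      rw [hφ, hφ, h2] at hpq
      exact add_right_cancel hpq
    · intro v
      refine ⟨(⟨v - s (U.mkQ v), ?_⟩, U.mkQ v), ?_⟩
      · rw [← Submodule.Quotient.mk_eq_zero, ← Submodule.mkQ_apply, map_sub, hs', sub_self]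
      · rw [hφ]; simp
  let e := LinearEquiv.ofBijective φ hb
  have he : ∀ p, e p = p.1 + s p.2 := hφ
  -- The off-diagonal block of `x` in the chosen splitting, to be absorbed by translating the
  -- summation variable.
  let w : (V ⧸ U) →ₗ[F] U := (x ∘ₗ s - s ∘ₗ U.mapQ U x hx).codRestrict U fun q => by
    have hq : U.mapQ U x hx q = U.mkQ (x (s q)) := by
      conv_lhs => rw [← hs' q]
      rfl
    rw [← Submodule.Quotient.mk_eq_zero, ← Submodule.mkQ_apply, LinearMap.sub_apply, map_sub,
      LinearMap.comp_apply, LinearMap.comp_apply, hs', hq, sub_self]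
  have hw : ∀ q, (w q : V) = x (s q) - s (U.mapQ U x hx q) := fun q => rfl
  have : Nontrivial U := Submodule.nontrivial_iff_ne_bot.2 h0
  have : Nontrivial (V ⧸ U) := Submodule.Quotient.nontrivial_iff.2 h1
  rw [← hc U (V ⧸ U) (x.restrict hx) (U.mapQ U x hx)]
  conv_rhs => rw [← Equiv.sum_comp (Equiv.addLeft w)]
  refine Finset.sum_congr rfl fun v _ => (hf e _ _ fun p => ?_).symm
  have h3 : U.mkQ (e p) = p.2 := hm p
  rw [LinearMap.add_apply, LinearMap.comp_apply, LinearMap.comp_apply, h3, he, he, blk_apply]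
  simp only [Equiv.coe_addLeft, LinearMap.add_apply, Submodule.coe_add, hw,
    LinearMap.coe_restrict_apply, map_add, Submodule.subtype_apply]
  abel

end SubQuotient

section Skew

variable {A B : Type u} [AddCommGroup A] [Module F A] [AddCommGroup B] [Module F B]

theorem hallTerm_prod {f h : EndFun F} (hf : IsInv f) (hh : IsInv h) {x : A →ₗ[F] A}
    {u : B →ₗ[F] A} {y : B →ₗ[F] B} {A₁ : Submodule F A} {B₁ : Submodule F B}
    (hx : A₁ ≤ A₁.comap x) (hu : B₁ ≤ A₁.comap u) (hy : B₁ ≤ B₁.comap y) :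
    hallTerm f h (A × B) (blk x u y) (A₁.prod B₁) =
      f (A₁ × B₁) (blk (x.restrict hx) (u.restrict hu) (y.restrict hy)) *
        h ((A ⧸ A₁) × (B ⧸ B₁)) (blk (A₁.mapQ A₁ x hx) (B₁.mapQ A₁ u hu) (B₁.mapQ B₁ y hy)) := by
  refine hallTerm_eq hf hh (A₁.subtype.prodMap B₁.subtype) ?_ ?_ (A₁.mkQ.prodMap B₁.mkQ) ?_ ?_
    _ ?_ _ ?_
  · exact A₁.subtype_injective.prodMap B₁.subtype_injective
  · rw [LinearMap.range_prodMap, Submodule.range_subtype, Submodule.range_subtype]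
  · exact A₁.mkQ_surjective.prodMap B₁.mkQ_surjective
  · rw [LinearMap.ker_prodMap, Submodule.ker_mkQ, Submodule.ker_mkQ]
  · intro p
    ext <;> simp
  · intro p
    simp

variable [Finite A] [Finite B]

/-- Adding to `u` a map `B₁ → A₁`, extended through a retraction `r : B → B₁`, changes only the
restriction to `A₁ × B₁` and not the quotient. Summing over such maps sums `b` over a proper
unipotent radical. -/
theorem sum_hallTerm_prod_eq_zero {b h : EndFun F} (hb : IsInv b) (hh : IsInv h)
    (hc : SumsToZero b) (x : A →ₗ[F] A) (y : B →ₗ[F] B) {A₁ : Submodule F A} {B₁ : Submodule F B}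
    (hA : A₁ ≠ ⊥) (hB : B₁ ≠ ⊥) :
    ∑ u : B →ₗ[F] A, hallTerm b h (A × B) (blk x u y) (A₁.prod B₁) = 0 := by
  have : Nontrivial A₁ := Submodule.nontrivial_iff_ne_bot.2 hA
  have : Nontrivial B₁ := Submodule.nontrivial_iff_ne_bot.2 hB
  obtain ⟨r, hr⟩ := B₁.subtype.exists_leftInverse_of_injective B₁.ker_subtype
  have hr' : ∀ y : B₁, r y = y := fun y => LinearMap.congr_fun hr y
  have key : ∀ u : B →ₗ[F] A, ∑ v : B₁ →ₗ[F] A₁, hallTerm b h (A × B)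
      (blk x (u + A₁.subtype ∘ₗ v ∘ₗ r) y) (A₁.prod B₁) = 0 := by
    intro u
    by_cases H : A₁ ≤ A₁.comap x ∧ B₁ ≤ B₁.comap y ∧ B₁ ≤ A₁.comap u
    · obtain ⟨hx, hy, hu⟩ := H
      have hu' : ∀ v : B₁ →ₗ[F] A₁, B₁ ≤ A₁.comap (u + A₁.subtype ∘ₗ v ∘ₗ r) := fun v z hz =>
        A₁.add_mem (hu hz) (v (r z)).2
      have h1 : ∀ v : B₁ →ₗ[F] A₁, hallTerm b h (A × B)
          (blk x (u + A₁.subtype ∘ₗ v ∘ₗ r) y) (A₁.prod B₁) =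
          b (A₁ × B₁) (blk (x.restrict hx) (u.restrict hu + v) (y.restrict hy)) *
            h ((A ⧸ A₁) × (B ⧸ B₁))
              (blk (A₁.mapQ A₁ x hx) (B₁.mapQ A₁ u hu) (B₁.mapQ B₁ y hy)) := by
        intro v
        rw [hallTerm_prod hb hh hx (hu' v) hy]
        congr 3
        · ext z
          simp [hr']
        · ext z
          simp
      simp_rw [h1]
      rw [← Finset.sum_mul]
      have h2 := hc A₁ B₁ (x.restrict hx) (y.restrict hy)
      rw [← Equiv.sum_comp (Equiv.addLeft (u.restrict hu))] at h2
      simp only [Equiv.coe_addLeft] at h2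
      rw [h2, zero_mul]
    · refine Finset.sum_eq_zero fun v _ => ?_
      rw [hallTerm, dif_neg]
      rw [prod_le_comap_blk_iff]
      rintro ⟨hx, hy, hu⟩
      refine H ⟨hx, hy, fun z hz => ?_⟩
      have := A₁.sub_mem (hu z hz) (v (r z)).2
      simpa using this
  -- Repeating the sum once for each `v`, with `u` translated by `v`, brings out the inner sums that
  -- vanish.
  have h3 : (Fintype.card (B₁ →ₗ[F] A₁) : ℂ) * ∑ u : B →ₗ[F] A, hallTerm b h (A × B)
      (blk x u y) (A₁.prod B₁) = 0 := by
    rw [← nsmul_eq_mul, ← Finset.card_univ, ← Finset.sum_const]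
    rw [Finset.sum_congr rfl fun v _ => (Equiv.sum_comp (Equiv.addRight (A₁.subtype ∘ₗ v ∘ₗ r))
      fun u : B →ₗ[F] A => hallTerm b h (A × B) (blk x u y) (A₁.prod B₁)).symm, Finset.sum_comm]
    exact Finset.sum_eq_zero fun u _ => key u
  exact (mul_eq_zero.1 h3).resolve_left (by exact_mod_cast Fintype.card_ne_zero)

open Classical in
-- Stability of `0 × B₁` forces `u` to factor through `B ⧸ B₁`. What is left is a term of the Hall
-- product of `b` with the adjoint applied to `h`.
theorem sum_hallTerm_bot_prod {b h : EndFun F} (hb : IsInv b) (hh : IsInv h) (x : A →ₗ[F] A)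
    (y : B →ₗ[F] B) (B₁ : Submodule F B) (hy : B₁ ≤ B₁.comap y) :
    (Fintype.card {s : B →ₗ[F] A // ∀ y ∈ B₁, s y ∈ (⊥ : Submodule F A)} : ℂ)⁻¹ *
      ∑ u : B →ₗ[F] A, hallTerm b h (A × B) (blk x u y) ((⊥ : Submodule F A).prod B₁) =
    b B₁ (y.restrict hy) * ((Fintype.card ((B ⧸ B₁) →ₗ[F] A) : ℂ)⁻¹ *
      ∑ u : (B ⧸ B₁) →ₗ[F] A, h (A × (B ⧸ B₁)) (blk x u (B₁.mapQ B₁ y hy))) := by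
  have hinj : Function.Injective fun u : (B ⧸ B₁) →ₗ[F] A => u ∘ₗ B₁.mkQ := fun u v h =>
    (LinearMap.cancel_right B₁.mkQ_surjective).1 h
  have hlift : ∀ s : B →ₗ[F] A, (∀ y ∈ B₁, s y ∈ (⊥ : Submodule F A)) →
      ∃ u : (B ⧸ B₁) →ₗ[F] A, u ∘ₗ B₁.mkQ = s := fun s hs =>
    ⟨B₁.liftQ s fun y hy => (Submodule.mem_bot F).1 (hs y hy), B₁.liftQ_mkQ s _⟩
  have hcard : Fintype.card {s : B →ₗ[F] A // ∀ y ∈ B₁, s y ∈ (⊥ : Submodule F A)} =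
      Fintype.card ((B ⧸ B₁) →ₗ[F] A) := by
    symm
    refine Fintype.card_of_bijective (f := fun u => ⟨u ∘ₗ B₁.mkQ, fun y hy => ?_⟩) ⟨?_, ?_⟩
    · rw [Submodule.mem_bot, LinearMap.comp_apply, Submodule.mkQ_apply,
        (Submodule.Quotient.mk_eq_zero B₁).2 hy, map_zero]
    · intro u v h
      exact hinj (congrArg Subtype.val h)
    · rintro ⟨s, hs⟩
      obtain ⟨u, hu⟩ := hlift s hs
      exact ⟨u, Subtype.ext hu⟩
  rw [hcard, mul_left_comm (b _ _)]
  congr 1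
  rw [Finset.mul_sum]
  refine (Fintype.sum_of_injective (fun u : (B ⧸ B₁) →ₗ[F] A => u ∘ₗ B₁.mkQ) hinj
    (fun u => b B₁ (y.restrict hy) * h (A × (B ⧸ B₁)) (blk x u (B₁.mapQ B₁ y hy)))
    (fun u => hallTerm b h (A × B) (blk x u y) ((⊥ : Submodule F A).prod B₁)) ?_ ?_).symm
  · intro s hs
    rw [hallTerm, dif_neg]
    rw [prod_le_comap_blk_iff]
    rintro ⟨-, -, h'⟩
    exact hs (hlift s h')
  · intro u
    symm
    refine hallTerm_eq hb hh (LinearMap.inr F A B ∘ₗ B₁.subtype)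
      (LinearMap.inr_injective.comp B₁.subtype_injective) ?_
      (LinearMap.id.prodMap B₁.mkQ) (Function.surjective_id.prodMap B₁.mkQ_surjective) ?_ _ ?_ _ ?_
    · ext p
      rw [LinearMap.range_comp, Submodule.range_subtype, Submodule.mem_prod, Submodule.mem_bot,
        Submodule.mem_map]
      constructor
      · rintro ⟨z, hz, rfl⟩
        exact ⟨rfl, hz⟩
      · intro hp
        exact ⟨p.2, hp.2, Prod.ext hp.1.symm rfl⟩
    · rw [LinearMap.ker_prodMap, Submodule.ker_mkQ, LinearMap.ker_id]
    · intro z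
      have : Submodule.Quotient.mk (p := B₁) (z : B) = 0 :=
        (Submodule.Quotient.mk_eq_zero B₁).2 z.2
      ext <;> simp [this]
    · intro p
      simp

omit [Finite A] [Finite B] in
theorem hallTerm_top_prod_bot {b h : EndFun F} (hb : IsInv b) (hh : IsInv h) (x : A →ₗ[F] A)
    (u : B →ₗ[F] A) (y : B →ₗ[F] B) :
    hallTerm b h (A × B) (blk x u y) ((⊤ : Submodule F A).prod ⊥) = b A x * h B y := by
  refine hallTerm_eq hb hh (LinearMap.inl F A B) LinearMap.inl_injective ?_ (LinearMap.snd F A B)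
    LinearMap.snd_surjective ?_ x ?_ y ?_
  · ext p; rw [mem_range_inl_iff]; simp
  · ext p; simp
  · intro x; simp
  · intro x; simp

omit [Finite B] in
-- Translating `x` by `Hom(A ⧸ A₁, A₁)` affects neither its restriction to `A₁` nor its quotient, so
-- the Hall term is constant and the cuspidality of `a` kills the sum.
theorem sum_mul_hallTerm_prod_bot {a b h : EndFun F} (ha : IsInv a) (hac : SumsToZero a)
    (hb : IsInv b) (hh : IsInv h) (u : B →ₗ[F] A) (y : B →ₗ[F] B) {A₁ : Submodule F A}
    (h0 : A₁ ≠ ⊥) (h1 : A₁ ≠ ⊤) :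
    ∑ x : A →ₗ[F] A, a A x * hallTerm b h (A × B) (blk x u y) (A₁.prod ⊥) = 0 := by
  have hu : (⊥ : Submodule F B) ≤ A₁.comap u := bot_le
  have hy : (⊥ : Submodule F B) ≤ (⊥ : Submodule F B).comap y := bot_le
  have key : ∀ x : A →ₗ[F] A, ∑ v : (A ⧸ A₁) →ₗ[F] A₁, a A (x + A₁.subtype ∘ₗ v ∘ₗ A₁.mkQ) *
      hallTerm b h (A × B) (blk (x + A₁.subtype ∘ₗ v ∘ₗ A₁.mkQ) u y) (A₁.prod ⊥) = 0 := by
    intro x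
    by_cases hx : A₁ ≤ A₁.comap x
    · have hx' : ∀ v : (A ⧸ A₁) →ₗ[F] A₁, A₁ ≤ A₁.comap (x + A₁.subtype ∘ₗ v ∘ₗ A₁.mkQ) :=
        fun v z hz => A₁.add_mem (hx hz) (v (A₁.mkQ z)).2
      have h2 : ∀ v : (A ⧸ A₁) →ₗ[F] A₁, hallTerm b h (A × B)
          (blk (x + A₁.subtype ∘ₗ v ∘ₗ A₁.mkQ) u y) (A₁.prod ⊥) =
          hallTerm b h (A × B) (blk x u y) (A₁.prod ⊥) := by
        intro v
        rw [hallTerm_prod hb hh (hx' v) hu hy, hallTerm_prod hb hh hx hu hy]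
        congr 3
        · ext z
          have : Submodule.Quotient.mk (p := A₁) (z : A) = 0 :=
            (Submodule.Quotient.mk_eq_zero A₁).2 z.2
          simp [this]
        · ext z
          simp
      simp_rw [h2]
      rw [← Finset.sum_mul, hac.sum_add_comp_mkQ ha h0 h1 hx, zero_mul]
    · refine Finset.sum_eq_zero fun v _ => ?_
      rw [hallTerm, dif_neg, mul_zero]
      rw [prod_le_comap_blk_iff]
      rintro ⟨h', -, -⟩
      refine hx fun z hz => ?_
      have := A₁.sub_mem (h' hz) (v (A₁.mkQ z)).2
      simpa using this
  have h3 : (Fintype.card ((A ⧸ A₁) →ₗ[F] A₁) : ℂ) *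
      ∑ x : A →ₗ[F] A, a A x * hallTerm b h (A × B) (blk x u y) (A₁.prod ⊥) = 0 := by
    rw [← nsmul_eq_mul, ← Finset.card_univ, ← Finset.sum_const]
    rw [Finset.sum_congr rfl fun v _ => (Equiv.sum_comp
      (Equiv.addRight (A₁.subtype ∘ₗ v ∘ₗ A₁.mkQ))
      fun x : A →ₗ[F] A => a A x * hallTerm b h (A × B) (blk x u y) (A₁.prod ⊥)).symm,
      Finset.sum_comm]
    exact Finset.sum_eq_zero fun x _ => key x
  exact (mul_eq_zero.1 h3).resolve_left (by exact_mod_cast Fintype.card_ne_zero)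

open Classical in
-- The geometric lemma for cuspidal functions. Subspaces of `A × B` are sorted by type `(A₁, B₁)`.
-- Cuspidality of `b` removes the types with both parts nonzero, and that of `a` those with `A₁`
-- proper nonzero and `B₁ = ⊥`. The type `(⊤, ⊥)` pairs `a` with `b`, and the types `(⊥, B₁)` apply
-- the adjoint to `h`.
theorem sum_mul_sum_hall {a b h : EndFun F} (ha : IsInv a) (hac : SumsToZero a)
    (hb : IsInv b) (hbc : SumsToZero b) (hh : IsInv h) [Nontrivial A] (y : B →ₗ[F] B) :
    ∑ x : A →ₗ[F] A, a A x * ((Fintype.card (B →ₗ[F] A) : ℂ)⁻¹ *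
        ∑ u : B →ₗ[F] A, hall b h (A × B) (blk x u y)) =
      (∑ x : A →ₗ[F] A, a A x * b A x) * h B y +
      ∑ x : A →ₗ[F] A, a A x * ∑ B₁ : Submodule F B, if hy : B₁ ≤ B₁.comap y then
        b B₁ (y.restrict hy) * ((Fintype.card ((B ⧸ B₁) →ₗ[F] A) : ℂ)⁻¹ *
        ∑ u : (B ⧸ B₁) →ₗ[F] A, h (A × (B ⧸ B₁)) (blk x u (B₁.mapQ B₁ y hy))) else 0 := by
  have hc : (Fintype.card (B →ₗ[F] A) : ℂ) ≠ 0 := by exact_mod_cast Fintype.card_ne_zero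
  let E : (A →ₗ[F] A) → Submodule F A → Submodule F B → ℂ := fun x A₁ B₁ =>
    (Fintype.card {s : B →ₗ[F] A // ∀ y ∈ B₁, s y ∈ A₁} : ℂ)⁻¹ *
          ∑ u, hallTerm b h (A × B) (blk x u y) (A₁.prod B₁)
  have h1 : ∀ x : A →ₗ[F] A, (Fintype.card (B →ₗ[F] A) : ℂ)⁻¹ *
      ∑ u : B →ₗ[F] A, hall b h (A × B) (blk x u y) = ∑ A₁, ∑ B₁, E x A₁ B₁ := by
    intro x
    rw [Finset.sum_congr rfl fun u _ => show hall b h (A × B) (blk x u y) = _ by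
      rw [hall, finsum_eq_sum_of_fintype, sum_submodule_eq_sum_hasType], Finset.sum_comm,
      Finset.mul_sum]
    refine Finset.sum_congr rfl fun A₁ _ => ?_
    rw [Finset.sum_comm, Finset.mul_sum]
    refine Finset.sum_congr rfl fun B₁ _ => ?_
    have := sum_blk_hasType x y (fun _ => 1) (fun _ _ => rfl)
      (fun U g => hallTerm b h (A × B) g U) (fun U g g' s hs => hallTerm_map hb hh _ _ _ hs _) A₁ B₁
    simp only [one_mul] at this
    rw [this, inv_mul_cancel_left₀ hc]
  have h2 : ∀ (A₁ : Submodule F A) (B₁ : Submodule F B), ∑ x, a A x * E x A₁ B₁ =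
      (if A₁ = ⊤ then if B₁ = ⊥ then (∑ x : A →ₗ[F] A, a A x * b A x) * h B y else 0 else 0) +
      if A₁ = ⊥ then ∑ x, a A x * E x ⊥ B₁ else 0 := by
    intro A₁ B₁
    by_cases hA : A₁ = ⊥
    · subst hA
      rw [if_neg bot_ne_top, if_pos rfl, zero_add]
    · rw [if_neg hA, add_zero]
      by_cases hB : B₁ = ⊥
      · subst hB
        rw [if_pos rfl]
        split_ifs with hT
        · subst hT
          rw [Finset.sum_mul]
          refine Finset.sum_congr rfl fun x _ => ?_
          have h4 : Fintype.card {s : B →ₗ[F] A // ∀ y ∈ (⊥ : Submodule F B),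
              s y ∈ (⊤ : Submodule F A)} = Fintype.card (B →ₗ[F] A) :=
            Fintype.card_congr (Equiv.subtypeUnivEquiv fun s y _ => Submodule.mem_top)
          simp only [E]
          simp_rw [hallTerm_top_prod_bot hb hh]
          rw [h4, Finset.sum_const, Finset.card_univ, nsmul_eq_mul, inv_mul_cancel_left₀ hc,
            mul_assoc]
        · simp only [E]
          simp_rw [mul_left_comm (a A _)]
          rw [← Finset.mul_sum]
          simp_rw [Finset.mul_sum]
          rw [Finset.sum_comm, Finset.sum_eq_zero]
          intro u _
          rw [← Finset.mul_sum, sum_mul_hallTerm_prod_bot ha hac hb hh u y hA hT, mul_zero]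
      · rw [if_neg hB, ite_self]
        refine Finset.sum_eq_zero fun x _ => ?_
        simp only [E]
        rw [sum_hallTerm_prod_eq_zero hb hh hbc x y hA hB, mul_zero, mul_zero]
  have h3 : ∀ (x : A →ₗ[F] A) (B₁ : Submodule F B), E x ⊥ B₁ = if hy : B₁ ≤ B₁.comap y then
        b B₁ (y.restrict hy) * ((Fintype.card ((B ⧸ B₁) →ₗ[F] A) : ℂ)⁻¹ *
        ∑ u : (B ⧸ B₁) →ₗ[F] A, h (A × (B ⧸ B₁)) (blk x u (B₁.mapQ B₁ y hy))) else 0 := by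
    intro x B₁
    split_ifs with hy
    · exact sum_hallTerm_bot_prod hb hh x y B₁ hy
    · simp only [E]
      rw [Finset.sum_eq_zero, mul_zero]
      intro u _
      rw [hallTerm, dif_neg]
      rw [prod_le_comap_blk_iff]
      exact fun h' => hy h'.2.1
  simp_rw [h1, ← h3, Finset.mul_sum]
  rw [Finset.sum_comm, Finset.sum_congr rfl fun A₁ _ => Finset.sum_comm]
  rw [Finset.sum_congr rfl fun A₁ _ => Finset.sum_congr rfl fun B₁ _ => h2 A₁ B₁]
  simp_rw [Finset.sum_add_distrib]
  congr 1
  · simp [Finset.sum_ite_eq']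
  · rw [Finset.sum_comm (s := (Finset.univ : Finset (A →ₗ[F] A)))]
    simp

end Skew

/-- The adjoint of Hall multiplication by a cuspidal function is a derivation. -/
theorem skew_hall [Finite F] {a b h : EndFun F} (ha : IsInv a) (hac : SumsToZero a)
    (hb : IsInv b) (hbc : SumsToZero b) (hh : IsInv h) {p : ℕ} (hp : 0 < p) {B : Type u}
    [AddCommGroup B] [Module F B] [Finite B] (y : B →ₗ[F] B) :
    skew p a (hall b h) B y = pairing p a b * h B y + hall b (skew p a h) B y := by
  have : Nonempty (Fin p) := ⟨⟨0, hp⟩⟩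
  rw [skew_eq, sum_mul_sum_hall ha hac hb hbc hh, mul_add, pairing, mul_assoc]
  congr 1
  simp_rw [Finset.mul_sum]
  rw [Finset.sum_comm, hall, finsum_eq_sum_of_fintype]
  refine Finset.sum_congr rfl fun B₁ _ => ?_
  rw [hallTerm]
  split_ifs with hy
  · rw [skew_eq]
    simp_rw [Finset.mul_sum]
    refine Finset.sum_congr rfl fun x _ => Finset.sum_congr rfl fun u _ => ?_
    ring
  · simp

end

end FiniteGL

/-! ### Pairings of products of cuspidal functions. -/

namespace FiniteGL

universe u

section

variable {F : Type u} [Field F] [Finite F]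

theorem pairing_add_right (d : ℕ) (f h h' : EndFun F) :
    pairing d f (fun V [_] [_] g => h V g + h' V g) = pairing d f h + pairing d f h' := by
  simp_rw [pairing, mul_add, Finset.sum_add_distrib, mul_add]

theorem pairing_sum_left {κ : Type*} (d : ℕ) (s : Finset κ) (c : κ → ℂ) (G : κ → EndFun F)
    {f : EndFun F} (h : EndFun F)
    (hf : ∀ g : (Fin d → F) →ₗ[F] (Fin d → F), f _ g = ∑ k ∈ s, c k * G k _ g) :
    pairing d f h = ∑ k ∈ s, c k * pairing d (G k) h := by
  simp_rw [pairing, hf, Finset.sum_mul, Finset.mul_sum]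
  rw [Finset.sum_comm]
  refine Finset.sum_congr rfl fun k _ => Finset.sum_congr rfl fun g _ => ?_
  ring

theorem pairing_eq_zero_of_right {d m : ℕ} (f : EndFun F) {h : EndFun F} (hh : HasDegree m h)
    (hd : d ≠ m) : pairing d f h = 0 := by
  rw [pairing, Finset.sum_eq_zero, mul_zero]
  intro g _
  rw [hh _ _ (by simpa using hd), mul_zero]

omit [Finite F] in
theorem hall_sum_right {κ : Type*} (s : Finset κ) (c : κ → ℂ) (G : κ → EndFun F) (f : EndFun F)
    {V : Type u} [AddCommGroup V] [Module F V] [Finite V] (g : V →ₗ[F] V) :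
    hall f (fun V [_] [_] g => ∑ k ∈ s, c k * G k V g) V g = ∑ k ∈ s, c k * hall f (G k) V g := by
  simp_rw [hall, finsum_eq_sum_of_fintype, Finset.mul_sum]
  rw [Finset.sum_comm]
  refine Finset.sum_congr rfl fun U _ => ?_
  simp_rw [hallTerm]
  split_ifs
  · rw [Finset.mul_sum]
    exact Finset.sum_congr rfl fun k _ => by ring
  · simp

theorem skew_add (p : ℕ) (a f f' : EndFun F) {B : Type u} [AddCommGroup B] [Module F B] [Finite B]
    (y : B →ₗ[F] B) :
    skew p a (fun V [_] [_] g => f V g + f' V g) B y = skew p a f B y + skew p a f' B y := by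
  simp_rw [skew_eq, Finset.sum_add_distrib, mul_add, Finset.sum_add_distrib, mul_add]

theorem skew_hallOne {p : ℕ} (hp : 0 < p) (a : EndFun F) {B : Type u} [AddCommGroup B] [Module F B]
    [Finite B] (y : B →ₗ[F] B) : skew p a (hallOne F) B y = 0 := by
  rw [skew_eq, Finset.sum_eq_zero, mul_zero]
  intro x _
  rw [Finset.sum_eq_zero, mul_zero, mul_zero]
  intro u _
  refine hasDegree_hallOne _ _ ?_
  rw [Module.finrank_prod, Module.finrank_fin_fun]
  omega

variable {ι : Type*} [DecidableEq ι] {n : ι → ℕ} {f : ι → EndFun F}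

theorem skew_hallProd (hf : ∀ i, IsCuspidalFun (n i) (f i)) {p : ℕ} (hp : 0 < p) {a : EndFun F}
    (ha : IsInv a) (hac : SumsToZero a) (l : List ι) (hl : l.Nodup) : ∀ {B : Type u}
    [AddCommGroup B] [Module F B] [Finite B] (y : B →ₗ[F] B), skew p a (hallProd f l) B y =
      ∑ k ∈ l.toFinset, pairing p a (f k) * hallProd f (l.erase k) B y := by
  induction l with
  | nil =>
    intro B _ _ _ y
    exact skew_hallOne hp a y
  | cons i l ih =>
    intro B _ _ _ y
    obtain ⟨hi, hl⟩ := List.nodup_cons.1 hl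
    rw [hallProd, skew_hall ha hac (hf i).isInv (hf i).sumsToZero
      (isInv_hallProd (fun i => (hf i).isInv) l) hp, List.toFinset_cons,
      Finset.sum_insert (by simpa using hi), List.erase_cons_head]
    congr 1
    rw [hall_congr (f' := f i) y (fun _ _ _ _ _ => rfl) (fun W _ _ _ g => ih hl g),
      hall_sum_right]
    refine Finset.sum_congr rfl fun k hk => ?_
    have : i ≠ k := by rintro rfl; exact hi (by simpa using hk)
    rw [List.erase_cons_tail (by simpa using this), hallProd]

/-- A derivation kills the 1 in each factor `1 + f k` and sends `f k` to a scalar, so it deletes one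
whole factor at a time. -/
theorem skew_hallProdSum (hf : ∀ i, IsCuspidalFun (n i) (f i)) {p : ℕ} (hp : 0 < p) {a : EndFun F}
    (ha : IsInv a) (hac : SumsToZero a) (l : List ι) (hl : l.Nodup) : ∀ {B : Type u}
    [AddCommGroup B] [Module F B] [Finite B] (y : B →ₗ[F] B), skew p a (hallProdSum f l) B y =
      ∑ k ∈ l.toFinset, pairing p a (f k) * hallProdSum f (l.erase k) B y := by
  induction l with
  | nil =>
    intro B _ _ _ y
    exact skew_hallOne hp a y
  | cons i l ih =>
    intro B _ _ _ y
    obtain ⟨hi, hl⟩ := List.nodup_cons.1 hl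
    rw [hallProdSum, skew_add, skew_hall ha hac (hf i).isInv (hf i).sumsToZero
      (isInv_hallProdSum (fun i => (hf i).isInv) l) hp, List.toFinset_cons,
      Finset.sum_insert (by simpa using hi), List.erase_cons_head, add_left_comm, ih hl]
    congr 1
    rw [hall_congr (f' := f i) y (fun _ _ _ _ _ => rfl) (fun W _ _ _ g => ih hl g),
      hall_sum_right, ← Finset.sum_add_distrib]
    refine Finset.sum_congr rfl fun k hk => ?_
    have : i ≠ k := by rintro rfl; exact hi (by simpa using hk)
    rw [List.erase_cons_tail (by simpa using this), hallProdSum, mul_add]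

omit [Finite F] [DecidableEq ι] in
theorem hallProdSum_eq_one (hf : ∀ i, IsCuspidalFun (n i) (f i)) (l : List ι) {V : Type u}
    [AddCommGroup V] [Module F V] [Finite V] (hV : Module.finrank F V = 0) (g : V →ₗ[F] V) :
    hallProdSum f l V g = 1 := by
  induction l with
  | nil => exact if_pos hV
  | cons i l ih =>
    rw [hallProdSum]
    dsimp only
    rw [ih, add_eq_left, hall, finsum_eq_zero_of_forall_eq_zero]
    intro U
    rw [hallTerm]
    split_ifs
    · rw [(hf i).hasDegree, zero_mul]
      have := (hf i).pos
      have := U.finrank_le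
      omega
    · rfl

theorem pairing_zero (f h : EndFun F) :
    pairing 0 f h = f (Fin 0 → F) 0 * h (Fin 0 → F) 0 := by
  have h1 : Nat.card (GL (Fin 0) F) = 1 := Nat.card_unique
  rw [pairing, h1, Fintype.sum_eq_single 0 fun g hg => absurd (Subsingleton.elim _ _) hg]
  simp

/-- Induction on the factors `1 + h j`: the 1 leaves the pairing for `M`, and `h j` moves across by
Frobenius reciprocity and deletes a factor `1 + f k`. By `hc`, an `f k` not orthogonal to `h j` is
orthogonal to all other `h j'`, so its deletion does not disturb the remaining factors. A free bound
`b` on the degrees is needed because moving `h j` across lowers it by `m j`. -/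
theorem sum_pairing_hallProdSum {κ : Type*} [DecidableEq κ] {m : κ → ℕ} {h : κ → EndFun F}
    (hf : ∀ i, IsCuspidalFun (n i) (f i)) (hh : ∀ j, IsCuspidalFun (m j) (h j))
    (hc : ∀ i j j', j ≠ j' → pairing (m j) (h j) (f i) ≠ 0 → pairing (m j') (h j') (f i) = 0)
    (M : List κ) (hM : M.Nodup) : ∀ (l : List ι), l.Nodup → ∀ b, (M.map m).sum ≤ b →
      ∑ d ∈ Finset.range (b + 1), pairing d (hallProdSum f l) (hallProdSum h M) =
        ∏ j ∈ M.toFinset, (1 + ∑ i ∈ l.toFinset, pairing (m j) (h j) (f i)) := by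
  induction M with
  | nil =>
    intro l _ b _
    rw [hallProdSum, Finset.sum_eq_single 0 (fun d _ hd => pairing_eq_zero_of_right _ hasDegree_hallOne hd)
      (by simp), pairing_zero, hallProdSum_eq_one hf l (by simp)]
    simp [hallOne]
  | cons j M ih =>
    intro l hl b hb
    obtain ⟨hj, hM⟩ := List.nodup_cons.1 hM
    rw [List.map_cons, List.sum_cons] at hb
    rw [hallProdSum]
    simp_rw [pairing_add_right]
    rw [Finset.sum_add_distrib, ih hM l hl b (by omega), List.toFinset_cons,
      Finset.prod_insert (by simpa using hj), add_mul, one_mul]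
    congr 1
    obtain ⟨b', rfl⟩ := Nat.exists_eq_add_of_le (show m j ≤ b by omega)
    -- In degrees below `m j` the product with `h j` vanishes; the other degrees are shifted down by
    -- `m j`.
    rw [add_assoc, Finset.sum_range_add, Finset.sum_eq_zero, zero_add]
    · have hS := isInv_hallProdSum (fun j => (hh j).isInv) M
      have hS' := isInv_hallProdSum (fun i => (hf i).isInv) l
      simp_rw [pairing_hall (hh j).isInv hS' hS (hh j).hasDegree]
      rw [Finset.sum_congr rfl fun d _ => pairing_sum_left d l.toFinset _
        (fun k => hallProdSum f (l.erase k)) _ fun g =>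
          skew_hallProdSum hf (hh j).pos (hh j).isInv (hh j).sumsToZero l hl g, Finset.sum_comm,
        Finset.sum_mul]
      refine Finset.sum_congr rfl fun k hk => ?_
      rw [← Finset.mul_sum]
      by_cases h0 : pairing (m j) (h j) (f k) = 0
      · rw [h0, zero_mul, zero_mul]
      · rw [ih hM _ (hl.erase k) b' (by omega)]
        congr 1
        refine Finset.prod_congr rfl fun j' hj' => ?_
        have hne : j ≠ j' := by rintro rfl; exact hj (by simpa using hj')
        have he : (l.erase k).toFinset = l.toFinset.erase k := by
          ext x
          simp [hl.mem_erase_iff, Finset.mem_erase]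
        rw [he, Finset.sum_erase (f := fun i => pairing (m j') (h j') (f i)) _
          (hc k j j' hne h0)]
    · intro d hd
      rw [pairing, Finset.sum_eq_zero, mul_zero]
      intro g _
      rw [hall, finsum_eq_zero_of_forall_eq_zero, mul_zero]
      intro U
      rw [hallTerm]
      split_ifs
      · rw [(hh j).hasDegree, zero_mul]
        have := U.finrank_le
        rw [Module.finrank_fin_fun] at this
        have := Finset.mem_range.1 hd
        omega
      · rfl

/-- Moving `h i` across deletes exactly `f i`, by orthogonality, and leaves the same problem for the
shorter list. -/
theorem pairing_hallProd_self {h : ι → EndFun F} (hf : ∀ i, IsCuspidalFun (n i) (f i))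
    (hh : ∀ i, IsCuspidalFun (n i) (h i)) (hc : ∀ i, pairing (n i) (h i) (f i) = 1)
    (hc' : ∀ i j, i ≠ j → pairing (n i) (h i) (f j) = 0) (l : List ι) (hl : l.Nodup) :
    pairing (l.map n).sum (hallProd f l) (hallProd h l) = 1 := by
  induction l with
  | nil =>
    rw [List.map_nil, List.sum_nil, pairing_zero]
    simp [hallProd, hallOne]
  | cons i l ih =>
    obtain ⟨hi, hl'⟩ := List.nodup_cons.1 hl
    have hP : hallProd h (i :: l) = hall (h i) (hallProd h l) := rfl
    rw [List.map_cons, List.sum_cons, hP, pairing_hall (hh i).isInv (isInv_hallProd (fun i => (hf i).isInv) _)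
      (isInv_hallProd (fun i => (hh i).isInv) _) (hh i).hasDegree,
      pairing_sum_left _ _ _ (fun k => hallProd f ((i :: l).erase k)) _ fun g =>
        skew_hallProd hf (hh i).pos (hh i).isInv (hh i).sumsToZero (i :: l) hl g,
      Finset.sum_eq_single i, hc, one_mul, List.erase_cons_head, ih hl']
    · intro k _ hk
      rw [hc' i k hk.symm, zero_mul]
    · simp

/-- The branching rule for products of cuspidal functions. -/
theorem sum_blk_mul_hallProd {κ : Type*} [DecidableEq κ] {m : κ → ℕ} {h : κ → EndFun F}
    (hf : ∀ i, IsCuspidalFun (n i) (f i)) (hh : ∀ j, IsCuspidalFun (m j) (h j))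
    (hc : ∀ i j j', j ≠ j' → pairing (m j) (h j) (f i) ≠ 0 → pairing (m j') (h j') (f i) = 0)
    {ψ : AddChar F ℂ} (hψ : ψ ≠ 1) {N : ℕ}
    (l : List ι) (hl : l.Nodup) (hlN : (l.map n).sum = N + 1)
    (M : List κ) (hM : M.Nodup) (hMN : (M.map m).sum = N) :
    (Nat.card (GL (Fin N) F) : ℂ)⁻¹ * ∑ g : (Fin N → F) →ₗ[F] (Fin N → F),
        hallProd f l ((Fin N → F) × F) (blk g 0 LinearMap.id) * hallProd h M (Fin N → F) g =
      ∏ j ∈ M.toFinset, (1 + ∑ i ∈ l.toFinset, pairing (m j) (h j) (f i)) := by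
  rw [sum_blk_mul_eq_sum_pairing (isInv_hallProd (fun i => (hf i).isInv) l)
    (isInv_hallProd (fun j => (hh j).isInv) M) hψ,
    -- The order `i` of the derivative corresponds to the dimension `d = N - i` on which it is
    -- evaluated.
    ← sum_pairing_hallProdSum hf hh hc M hM l hl N hMN.le, ← Finset.sum_range_reflect]
  refine Finset.sum_congr rfl fun d hd => ?_
  have := Finset.mem_range.1 hd
  have hd' : N - (N + 1 - 1 - d) = d := by omega
  rw [hd', pairing, pairing]
  congr 1
  refine Finset.sum_congr rfl fun g _ => ?_
  rw [derivative_hallProd hf hψ l _ g (by rw [Module.finrank_fin_fun]; omega),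
    derivative_hallProd hh (inv_ne_one.2 hψ) M _ g (by rw [Module.finrank_fin_fun]; omega)]

end

end FiniteGL

/-! ### Class functions of `GL_n` and characters of cuspidal representations. -/

namespace FiniteGL

universe u

section

variable {F : Type u} [Field F]

section GLOf

variable {ι : Type*} [Fintype ι] [DecidableEq ι] {V W : Type*} [AddCommGroup V] [Module F V]
  [AddCommGroup W] [Module F W]

/-- The matrix of an automorphism in given coordinates. -/
def glOf (e : V ≃ₗ[F] (ι → F)) : (V ≃ₗ[F] V) ≃* GL ι F :=
  ((LinearMap.GeneralLinearGroup.generalLinearEquiv F V).symm.trans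
    (LinearMap.GeneralLinearGroup.congrLinearEquiv e)).trans Matrix.GeneralLinearGroup.toLin.symm

theorem glOf_mulVec (e : V ≃ₗ[F] (ι → F)) (g : V ≃ₗ[F] V) (v : V) :
    (glOf e g).val.mulVec (e v) = e (g v) := by
  rw [← Matrix.mulVecLin_apply, ← Matrix.GeneralLinearGroup.toLin_apply]
  simp only [glOf, MulEquiv.trans_apply, MulEquiv.apply_symm_apply]
  simp
  rfl

theorem GL_ext_mulVec {x y : GL ι F} (h : ∀ v, x.val.mulVec v = y.val.mulVec v) : x = y :=
  Units.ext (Matrix.ext_of_mulVec_single fun _ => h _)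

theorem glOf_eq (e : V ≃ₗ[F] (ι → F)) (g : V ≃ₗ[F] V) (x : GL ι F)
    (h : ∀ v, e (g v) = x.val.mulVec (e v)) : glOf e g = x :=
  GL_ext_mulVec fun v => by
    obtain ⟨v, rfl⟩ := e.surjective v
    rw [glOf_mulVec, h]

theorem glOf_conj (e e' : V ≃ₗ[F] (ι → F)) :
    ∃ y : GL ι F, ∀ g, glOf e' g = y * glOf e g * y⁻¹ := by
  refine ⟨glOf (LinearEquiv.refl F _) (e.symm.trans e'), fun g => ?_⟩
  have hy : ∀ v, (glOf (LinearEquiv.refl F (ι → F)) (e.symm.trans e')).val.mulVec (e v) = e' v := by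
    intro v
    have := glOf_mulVec (LinearEquiv.refl F (ι → F)) (e.symm.trans e') (e v)
    simpa using this
  rw [eq_mul_inv_iff_mul_eq]
  refine GL_ext_mulVec fun v => ?_
  obtain ⟨v, rfl⟩ := e.surjective v
  rw [Units.val_mul, Units.val_mul, ← Matrix.mulVec_mulVec, ← Matrix.mulVec_mulVec, hy,
    glOf_mulVec, glOf_mulVec, hy]

end GLOf

section ToEndFun

variable {n : ℕ}

open Classical in
/-- The extension of a class function on `GL_n(F)` to endomorphisms of vector spaces, by zero
outside the automorphisms of `n`-dimensional spaces. -/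
noncomputable def toEndFun (χ : GL (Fin n) F → ℂ) : EndFun F := fun V [_] [_] g =>
  if h : ∃ x : GL (Fin n) F, ∃ e : V ≃ₗ[F] (Fin n → F), ∀ v, e (g v) = x.val.mulVec (e v) then
    χ h.choose else 0

variable {χ : GL (Fin n) F → ℂ}

/-- Two coordinate systems give conjugate matrices, so the choices in the definition are harmless
for class functions. -/
theorem toEndFun_eq (hχ : ∀ x y, χ (y * x * y⁻¹) = χ x) {V : Type u} [AddCommGroup V] [Module F V]
    {g : V →ₗ[F] V} (e : V ≃ₗ[F] (Fin n → F)) {x : GL (Fin n) F}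
    (h : ∀ v, e (g v) = x.val.mulVec (e v)) : toEndFun χ V g = χ x := by
  have h' : ∃ x : GL (Fin n) F, ∃ e : V ≃ₗ[F] (Fin n → F), ∀ v, e (g v) = x.val.mulVec (e v) :=
    ⟨x, e, h⟩
  rw [toEndFun, dif_pos h']
  obtain ⟨e', he'⟩ := h'.choose_spec
  set x' := h'.choose
  obtain ⟨y, hy⟩ := glOf_conj e e'
  let g' := (glOf e).symm x
  have hg' : ∀ v, e (g' v) = x.val.mulVec (e v) := fun v => by
    rw [← glOf_mulVec e, MulEquiv.apply_symm_apply]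
  have hgg : ∀ v, g v = g' v := fun v => e.injective (by rw [h, hg'])
  have h1 : glOf e g' = x := MulEquiv.apply_symm_apply _ _
  have h2 : glOf e' g' = x' := glOf_eq e' g' x' fun v => by rw [← hgg, he']
  rw [← h2, hy, h1, hχ]

theorem toEndFun_linearEquiv (hχ : ∀ x y, χ (y * x * y⁻¹) = χ x) {V : Type u} [AddCommGroup V]
    [Module F V] (e : V ≃ₗ[F] (Fin n → F)) (g : V ≃ₗ[F] V) :
    toEndFun χ V (g : V →ₗ[F] V) = χ (glOf e g) :=
  toEndFun_eq hχ e fun v => (glOf_mulVec e g v).symm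

theorem toEndFun_eq_zero {V : Type u} [AddCommGroup V] [Module F V] {g : V →ₗ[F] V}
    (h : ¬ Function.Bijective g) : toEndFun χ V g = 0 := by
  rw [toEndFun, dif_neg]
  rintro ⟨x, e, he⟩
  refine h ?_
  have h1 : ⇑g = ⇑((glOf e).symm x) := funext fun v => e.injective (by
    rw [he, ← glOf_mulVec e, MulEquiv.apply_symm_apply])
  rw [h1]
  exact LinearEquiv.bijective _

theorem hasDegree_toEndFun : HasDegree n (toEndFun χ) := by
  intro V _ _ _ g hV
  rw [toEndFun, dif_neg]
  rintro ⟨x, e, -⟩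
  exact hV (by rw [e.finrank_eq, Module.finrank_fin_fun])

theorem isInv_toEndFun (hχ : ∀ x y, χ (y * x * y⁻¹) = χ x) : IsInv (toEndFun χ) := by
  intro V W _ _ _ _ e g h hg
  by_cases H : ∃ x : GL (Fin n) F, ∃ e : V ≃ₗ[F] (Fin n → F), ∀ v, e (g v) = x.val.mulVec (e v)
  · obtain ⟨x, e', he'⟩ := H
    rw [toEndFun_eq hχ e' he', toEndFun_eq hχ (e.symm.trans e') (x := x)]
    intro w
    obtain ⟨v, rfl⟩ := e.surjective w
    rw [← hg]
    simp [he']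
  · rw [toEndFun, toEndFun, dif_neg H, dif_neg]
    rintro ⟨x, e', he'⟩
    exact H ⟨x, e.trans e', fun v => by simp [hg, he']⟩

instance [Finite F] : Finite (GL (Fin n) F) := Finite.of_injective _ Units.val_injective

theorem pairing_toEndFun [Finite F] [Fintype (GL (Fin n) F)] {χ' : GL (Fin n) F → ℂ}
    (hχ : ∀ x y, χ (y * x * y⁻¹) = χ x) (hχ' : ∀ x y, χ' (y * x * y⁻¹) = χ' x) :
    pairing n (toEndFun χ) (toEndFun χ') =
      (Nat.card (GL (Fin n) F) : ℂ)⁻¹ * ∑ x : GL (Fin n) F, χ x * χ' x := by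
  rw [pairing]
  congr 1
  let e := LinearEquiv.refl F (Fin n → F)
  have h1 : ∀ (x : GL (Fin n) F) v, e (Matrix.mulVecLin x.val v) = x.val.mulVec (e v) :=
    fun _ _ => rfl
  refine (Fintype.sum_of_injective (fun x : GL (Fin n) F => Matrix.mulVecLin x.val) ?_ _ _ ?_
    ?_).symm
  · exact fun x y h => GL_ext_mulVec fun v => LinearMap.congr_fun h v
  · intro g hg
    rw [toEndFun_eq_zero, zero_mul]
    intro hb
    refine hg ⟨glOf e (LinearEquiv.ofBijective g hb), LinearMap.ext fun v => ?_⟩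
    exact glOf_mulVec e _ v
  · intro x
    rw [toEndFun_eq hχ e (h1 x), toEndFun_eq hχ' e (h1 x)]

end ToEndFun

section Cuspidal

variable {n : ℕ} {V : Type*} [AddCommGroup V] [Module ℂ V]

theorem shear_add {A B : Type u} [AddCommGroup A] [Module F A] [AddCommGroup B] [Module F B]
    (s t : B →ₗ[F] A) : shear (s + t) = shear s * shear t := by
  refine LinearEquiv.ext fun p => ?_
  rw [LinearEquiv.mul_apply]
  simp [add_comm, add_left_comm]

/-- Concatenation of vectors. -/
def appendEquiv (F : Type*) [Field F] (k l : ℕ) :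
    ((Fin k → F) × (Fin l → F)) ≃ₗ[F] (Fin (k + l) → F) :=
  { Fin.appendEquiv k l with
    map_add' := fun p q => by
      funext i
      refine Fin.addCases (fun i => ?_) (fun i => ?_) i <;> simp [Fin.appendEquiv]
    map_smul' := fun c p => by
      funext i
      refine Fin.addCases (fun i => ?_) (fun i => ?_) i <;> simp [Fin.appendEquiv] }

theorem appendEquiv_apply (k l : ℕ) (p : (Fin k → F) × (Fin l → F)) :
    appendEquiv F k l p = Fin.append p.1 p.2 := rfl

theorem exists_glOf_shear_eq {k l : ℕ} {g : GL (Fin (k + l)) F}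
    (hg : g ∈ unipotentRadical F (k + l) k) :
    ∃ s : (Fin l → F) →ₗ[F] (Fin k → F), glOf (appendEquiv F k l) (shear s) = g := by
  refine ⟨Matrix.mulVecLin fun i j => g.val (Fin.castAdd l i) (Fin.natAdd k j), ?_⟩
  refine glOf_eq _ _ _ fun p => ?_
  have h1 : ∀ i i', g.val (Fin.castAdd l i) (Fin.castAdd l i') = if i = i' then 1 else 0 := by
    intro i i'
    rw [hg _ _ (by simp), Matrix.one_apply]
    simp
  have h2 : ∀ i j, g.val (Fin.natAdd k i) (Fin.castAdd l j) = 0 := by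
    intro i j
    rw [hg _ _ (by simp), Matrix.one_apply_ne]
    intro h
    have := congrArg Fin.val h
    simp at this
    omega
  have h3 : ∀ i i', g.val (Fin.natAdd k i) (Fin.natAdd k i') = if i = i' then 1 else 0 := by
    intro i i'
    rw [hg _ _ (by simp), Matrix.one_apply]
    simp
  rw [appendEquiv_apply, appendEquiv_apply]
  funext i
  refine Fin.addCases (fun i => ?_) (fun i => ?_) i
  · rw [Fin.append_left, Matrix.mulVec, dotProduct, Fin.sum_univ_add]
    simp [h1]
    rfl
  · rw [Fin.append_right, Matrix.mulVec, dotProduct, Fin.sum_univ_add]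
    simp [h2, h3]

/-- The operators of the unipotent radicals of the proper parabolic subgroups sum to zero. -/
def OperatorsSumToZero (ρ : Representation ℂ (GL (Fin n) F) V) : Prop :=
  ∀ (A B : Type u) [AddCommGroup A] [Module F A] [AddCommGroup B] [Module F B] [Finite A]
    [Finite B] [Nontrivial A] [Nontrivial B] (e : (A × B) ≃ₗ[F] (Fin n → F)),
    ∑ s : B →ₗ[F] A, ρ (glOf e (shear s)) = 0

/-- The image of the sum of the operators of a unipotent radical consists of vectors fixed by that
radical, hence is zero. Arbitrary coordinates `e` are reduced to the standard ones by conjugation.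
-/
theorem IsCuspidal.operatorsSumToZero {ρ : Representation ℂ (GL (Fin n) F) V} (hρ : IsCuspidal ρ) :
    OperatorsSumToZero ρ := by
  intro A B _ _ _ _ _ _ _ _ e
  obtain ⟨k, hk⟩ : ∃ k, Module.finrank F A = k := ⟨_, rfl⟩
  obtain ⟨l, hl⟩ : ∃ l, Module.finrank F B = l := ⟨_, rfl⟩
  have hkl : n = k + l := by
    have := e.finrank_eq
    rw [Module.finrank_prod, Module.finrank_fin_fun] at this
    omega
  subst hkl
  have hk0 : 0 < k := hk ▸ Module.finrank_pos
  have hl0 : 0 < l := hl ▸ Module.finrank_pos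
  let eA : A ≃ₗ[F] (Fin k → F) := LinearEquiv.ofFinrankEq _ _ (by simp [hk])
  let eB : B ≃ₗ[F] (Fin l → F) := LinearEquiv.ofFinrankEq _ _ (by simp [hl])
  let e' : (A × B) ≃ₗ[F] (Fin (k + l) → F) := (eA.prodCongr eB).trans (appendEquiv F k l)
  obtain ⟨y, hy⟩ := glOf_conj e' e
  have key : ∑ s : B →ₗ[F] A, ρ (glOf e' (shear s)) = 0 := by
    refine LinearMap.ext fun v => hρ k hk0 (by omega) _ fun g hg => ?_
    obtain ⟨s, rfl⟩ := exists_glOf_shear_eq hg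
    have h1 : glOf (appendEquiv F k l) (shear s) =
        glOf e' (shear ((eA.symm : (Fin k → F) →ₗ[F] A) ∘ₗ s ∘ₗ (eB : B →ₗ[F] (Fin l → F)))) := by
      symm
      refine glOf_eq _ _ _ fun p => ?_
      have : e' p = appendEquiv F k l (eA p.1, eB p.2) := rfl
      rw [this, glOf_mulVec]
      simp [e']
    rw [h1, ← LinearMap.comp_apply, ← Module.End.mul_eq_comp, Finset.mul_sum]
    simp_rw [← map_mul, ← shear_add]
    congr 1
    exact Fintype.sum_equiv (Equiv.addLeft _) _ _ fun t => rfl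
  simp_rw [hy, map_mul]
  rw [← Finset.sum_mul, ← Finset.mul_sum, key, mul_zero, zero_mul]

theorem OperatorsSumToZero.dual {ρ : Representation ℂ (GL (Fin n) F) V}
    (hρ : OperatorsSumToZero ρ) : OperatorsSumToZero ρ.dual := by
  intro A B _ _ _ _ _ _ _ _ e
  have h1 : ∀ s : B →ₗ[F] A, ρ.dual (glOf e (shear s)) =
      Module.Dual.transpose (ρ (glOf e (shear (-s)))) := by
    intro s
    have : (glOf e (shear s))⁻¹ = glOf e (shear (-s)) := by
      rw [← map_inv, inv_eq_of_mul_eq_one_right (b := shear (-s))]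
      rw [← shear_add, add_neg_cancel]
      exact LinearEquiv.ext fun p => by simp
    rw [Representation.dual_apply, this]
  simp_rw [h1]
  have h2 := Equiv.sum_comp (Equiv.neg _) fun s : B →ₗ[F] A => ρ (glOf e (shear s))
  simp only [Equiv.neg_apply] at h2
  rw [← map_sum, h2, hρ A B e, map_zero]

/-- For invertible `a` and `b`, substituting `u = s ∘ b` factors the block matrix as a shear times
`diag(a, b)`, so the sum is the trace of a zero operator. For singular blocks each term is zero
already. -/
theorem OperatorsSumToZero.sumsToZero {ρ : Representation ℂ (GL (Fin n) F) V}
    (hρ : OperatorsSumToZero ρ) : SumsToZero (toEndFun ρ.character) := by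
  intro A B _ _ _ _ _ _ _ _ a b
  by_cases hd : Module.finrank F (A × B) = n
  swap
  · exact Finset.sum_eq_zero fun u _ => hasDegree_toEndFun _ _ hd
  by_cases ha : Function.Injective a
  swap
  · refine Finset.sum_eq_zero fun u _ => toEndFun_eq_zero fun h => ha fun x y hxy => ?_
    have := @h.1 (x, 0) (y, 0) (by simp [hxy])
    exact congrArg Prod.fst this
  by_cases hb : Function.Surjective b
  swap
  · refine Finset.sum_eq_zero fun u _ => toEndFun_eq_zero fun h => hb fun y => ?_
    obtain ⟨p, hp⟩ := h.2 (0, y)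
    exact ⟨p.2, congrArg Prod.snd hp⟩
  let a' := LinearEquiv.ofBijective a ⟨ha, Finite.surjective_of_injective ha⟩
  let b' := LinearEquiv.ofBijective b ⟨Finite.injective_iff_surjective.2 hb, hb⟩
  let e : (A × B) ≃ₗ[F] (Fin n → F) := LinearEquiv.ofFinrankEq _ _ (by
    rw [hd, Module.finrank_fin_fun])
  have h1 : ∀ s : B →ₗ[F] A, toEndFun ρ.character (A × B) (blk a (s ∘ₗ b) b) =
      LinearMap.trace ℂ V (ρ (glOf e (shear s)) * ρ (glOf e (a'.prodCongr b'))) := by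
    intro s
    rw [← map_mul, ← map_mul]
    exact toEndFun_linearEquiv (χ := ρ.character) (fun x y => ρ.char_conj x y) e
      (shear s * a'.prodCongr b')
  have h2 : ∑ u : B →ₗ[F] A, toEndFun ρ.character (A × B) (blk a u b) =
      ∑ s : B →ₗ[F] A, toEndFun ρ.character (A × B) (blk a (s ∘ₗ b) b) := by
    refine (Fintype.sum_bijective (fun s : B →ₗ[F] A => s ∘ₗ b) ?_ _ _ fun s => rfl).symm
    refine Function.bijective_iff_has_inverse.2
      ⟨fun u => u ∘ₗ (b'.symm : B →ₗ[F] B), fun s => ?_, fun u => ?_⟩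
    · ext y
      exact congrArg s (b'.apply_symm_apply y)
    · ext y
      exact congrArg u (b'.symm_apply_apply y)
  rw [h2]
  simp_rw [h1]
  rw [← map_sum, ← Finset.sum_mul, hρ A B e, zero_mul, map_zero]

end Cuspidal

end

end FiniteGL

/-! ### Unitriangular matrices, the generic character and reflection in the antidiagonal. -/

namespace FiniteGL

universe u

section

variable {F : Type u} [Field F] {n : ℕ}

/-- Upper triangular matrices with ones on the diagonal. -/
def IsUnitri (M : Matrix (Fin n) (Fin n) F) : Prop :=
  ∀ i j, j ≤ i → M i j = (1 : Matrix (Fin n) (Fin n) F) i j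

/-- The sum of the entries just above the diagonal. -/
def superdiag (n : ℕ) : Matrix (Fin n) (Fin n) F →ₗ[F] F where
  toFun M := ∑ p : Fin n × Fin n with (p.1 : ℕ) + 1 = p.2, M p.1 p.2
  map_add' M M' := by simp [Finset.sum_add_distrib]
  map_smul' c M := by simp [Finset.mul_sum]

theorem superdiag_apply (M : Matrix (Fin n) (Fin n) F) :
    superdiag n M = ∑ p : Fin n × Fin n with (p.1 : ℕ) + 1 = p.2, M p.1 p.2 := rfl

theorem isUnitri_one : IsUnitri (1 : Matrix (Fin n) (Fin n) F) := fun _ _ _ => rfl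

theorem superdiag_one : superdiag n (1 : Matrix (Fin n) (Fin n) F) = 0 := by
  rw [superdiag_apply]
  refine Finset.sum_eq_zero fun p hp => Matrix.one_apply_ne fun h => ?_
  have := (Finset.mem_filter.1 hp).2
  rw [h] at this
  omega

theorem IsUnitri.mul {M M' : Matrix (Fin n) (Fin n) F} (h : IsUnitri M) (h' : IsUnitri M') :
    IsUnitri (M * M') := by
  intro i j hij
  rw [Matrix.mul_apply, Finset.sum_eq_single i]
  · rw [h i i le_rfl, h' i j hij, Matrix.one_apply_eq, one_mul]
  · intro l _ hl
    rcases lt_or_gt_of_ne hl with hl | hl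
    · rw [h i l hl.le, Matrix.one_apply_ne hl.ne', zero_mul]
    · rw [h' l j (hij.trans hl.le), Matrix.one_apply_ne (hij.trans_lt hl).ne', mul_zero]
  · simp

theorem IsUnitri.superdiag_mul {M M' : Matrix (Fin n) (Fin n) F} (h : IsUnitri M)
    (h' : IsUnitri M') : superdiag n (M * M') = superdiag n M + superdiag n M' := by
  simp_rw [superdiag_apply]
  rw [← Finset.sum_add_distrib]
  refine Finset.sum_congr rfl fun p hp => ?_
  obtain ⟨i, j⟩ := p
  have hij : (i : ℕ) + 1 = j := (Finset.mem_filter.1 hp).2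
  have hne : i ≠ j := fun h => by rw [h] at hij; omega
  dsimp only
  rw [Matrix.mul_apply, Finset.sum_eq_add i j hne]
  · rw [h i i le_rfl, h' j j le_rfl, Matrix.one_apply_eq, Matrix.one_apply_eq, one_mul, mul_one,
      add_comm]
  · intro l _ hl
    rcases lt_or_gt_of_ne hl.1 with hl1 | hl1
    · rw [h i l hl1.le, Matrix.one_apply_ne hl1.ne', zero_mul]
    · have : j < l := lt_of_le_of_ne (by rw [Fin.le_def]; have := Fin.lt_def.1 hl1; omega)
        hl.2.symm
      rw [h' l j this.le, Matrix.one_apply_ne this.ne', mul_zero]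
  · simp
  · simp

theorem IsUnitri.det {M : Matrix (Fin n) (Fin n) F} (h : IsUnitri M) : M.det = 1 := by
  rw [Matrix.det_of_isUpperTriangular fun i j hij => by
    have hij : j < i := hij
    rw [h i j hij.le, Matrix.one_apply_ne hij.ne']]
  exact Finset.prod_eq_one fun i _ => by rw [h i i le_rfl, Matrix.one_apply_eq]

theorem IsUnitri.inv {M : Matrix (Fin n) (Fin n) F} (h : IsUnitri M) : IsUnitri M⁻¹ := by
  have hu : IsUnit M.det := by rw [h.det]; exact isUnit_one
  have hI := Matrix.invertibleOfIsUnitDet _ hu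
  have ht : M.BlockTriangular id := fun i j hij => by
    have hij : j < i := hij
    rw [h i j hij.le, Matrix.one_apply_ne hij.ne']
  have ht' := Matrix.blockTriangular_inv_of_blockTriangular ht
  intro i j hij
  rcases hij.lt_or_eq with hij | rfl
  · rw [Matrix.one_apply_ne hij.ne']
    exact ht' hij
  · have h1 := congrFun (congrFun (Matrix.mul_nonsing_inv M hu) j) j
    rw [Matrix.mul_apply, Finset.sum_eq_single j, h j j le_rfl, Matrix.one_apply_eq,
      one_mul] at h1
    · rw [h1, Matrix.one_apply_eq]
    · intro l _ hl
      rcases lt_or_gt_of_ne hl with hl | hl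
      · rw [h j l hl.le, Matrix.one_apply_ne hl.ne', zero_mul]
      · rw [ht' (show id j < id l from hl), mul_zero]
    · simp

/-- A unitriangular matrix as an element of the general linear group. -/
noncomputable def IsUnitri.toGL {M : Matrix (Fin n) (Fin n) F} (h : IsUnitri M) : GL (Fin n) F :=
  Matrix.GeneralLinearGroup.mkOfDetNeZero M (by rw [h.det]; exact one_ne_zero)

theorem IsUnitri.val_toGL {M : Matrix (Fin n) (Fin n) F} (h : IsUnitri M) : h.toGL.val = M := rfl

/-- Reflection of a matrix in the antidiagonal. -/
def antiTranspose (M : Matrix (Fin n) (Fin n) F) : Matrix (Fin n) (Fin n) F :=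
  Matrix.reindex Fin.revPerm Fin.revPerm M.transpose

omit [Field F] in
theorem antiTranspose_apply (M : Matrix (Fin n) (Fin n) F) (i j : Fin n) :
    antiTranspose M i j = M j.rev i.rev := rfl

theorem antiTranspose_mul (M M' : Matrix (Fin n) (Fin n) F) :
    antiTranspose (M * M') = antiTranspose M' * antiTranspose M := by
  ext i j
  simp_rw [Matrix.mul_apply, antiTranspose_apply, Matrix.mul_apply]
  exact Fintype.sum_equiv Fin.revPerm _ _ fun l => by simp [mul_comm]

theorem antiTranspose_one : antiTranspose (1 : Matrix (Fin n) (Fin n) F) = 1 := by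
  ext i j
  simp [antiTranspose_apply, Matrix.one_apply, eq_comm]

theorem antiTranspose_pow (M : Matrix (Fin n) (Fin n) F) (k : ℕ) :
    antiTranspose (M ^ k) = antiTranspose M ^ k := by
  induction k with
  | zero => rw [pow_zero, pow_zero, antiTranspose_one]
  | succ k ih => rw [pow_succ, antiTranspose_mul, ih, pow_succ']

theorem IsUnitri.antiTranspose {M : Matrix (Fin n) (Fin n) F} (h : IsUnitri M) :
    IsUnitri (antiTranspose M) := by
  intro i j hij
  rw [antiTranspose_apply, h _ _ (Fin.rev_le_rev.2 hij)]
  simp [Matrix.one_apply, eq_comm]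

theorem superdiag_antiTranspose (M : Matrix (Fin n) (Fin n) F) :
    superdiag n (antiTranspose M) = superdiag n M := by
  rw [superdiag_apply, superdiag_apply]
  refine Finset.sum_bij' (fun p _ => (p.2.rev, p.1.rev)) (fun p _ => (p.2.rev, p.1.rev)) ?_ ?_ ?_
    ?_ ?_
  · intro p hp
    have := (Finset.mem_filter.1 hp).2
    refine Finset.mem_filter.2 ⟨Finset.mem_univ _, ?_⟩
    simp only [Fin.val_rev]
    omega
  · intro p hp
    have := (Finset.mem_filter.1 hp).2
    refine Finset.mem_filter.2 ⟨Finset.mem_univ _, ?_⟩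
    simp only [Fin.val_rev]
    omega
  · intro p _; simp
  · intro p _; simp
  · intro p _; rfl

/-- Reflection in the antidiagonal on the general linear group. -/
def antiTransposeGL (g : GL (Fin n) F) : GL (Fin n) F where
  val := antiTranspose g.val
  inv := antiTranspose g⁻¹.val
  val_inv := by rw [← antiTranspose_mul, ← Units.val_mul, inv_mul_cancel, Units.val_one,
    antiTranspose_one]
  inv_val := by rw [← antiTranspose_mul, ← Units.val_mul, mul_inv_cancel, Units.val_one,
    antiTranspose_one]

theorem antiTransposeGL_mul (g h : GL (Fin n) F) :
    antiTransposeGL (g * h) = antiTransposeGL h * antiTransposeGL g :=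
  Units.ext (antiTranspose_mul _ _)

/-! ### Hessenberg matrices and their cyclic vector. -/

section Hessenberg

/-- Upper Hessenberg matrices with ones below the diagonal. -/
def IsHessenberg (A : Matrix (Fin n) (Fin n) F) : Prop :=
  ∀ i j, j < i → A i j = if (j : ℕ) + 1 = i then 1 else 0

theorem IsHessenberg.antiTranspose {A : Matrix (Fin n) (Fin n) F} (h : IsHessenberg A) :
    IsHessenberg (antiTranspose A) := by
  intro i j hij
  rw [antiTranspose_apply, h _ _ (Fin.rev_lt_rev.2 hij)]
  congr 1
  simp only [Fin.val_rev, eq_iff_iff]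
  omega

/-- Each application of `A` pushes the lowest nonzero entry of the iterate of the first basis vector
down by one and keeps it equal to 1. Hence the Krylov matrix is unitriangular and that vector is
cyclic. -/
theorem IsHessenberg.pow_apply_zero {A : Matrix (Fin (n + 1)) (Fin (n + 1)) F}
    (h : IsHessenberg A) (k : ℕ) : ∀ i : Fin (n + 1), k ≤ i →
      (A ^ k) i 0 = if (i : ℕ) = k then 1 else 0 := by
  induction k with
  | zero =>
    intro i _
    rw [pow_zero, Matrix.one_apply]
    congr 1
    exact propext Fin.ext_iff
  | succ k ih =>
    intro i hi
    let j : Fin (n + 1) := ⟨k, by omega⟩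
    rw [pow_succ', Matrix.mul_apply, Finset.sum_eq_single j]
    · rw [ih j le_rfl, if_pos rfl, mul_one, h i j (Fin.lt_def.2 (by simp [j]; omega))]
      congr 1
      simp [j, eq_comm]
    · intro l _ hl
      have hl' : (l : ℕ) ≠ k := fun h => hl (Fin.ext h)
      rcases lt_or_gt_of_ne hl' with hl' | hl'
      · rw [h i l (Fin.lt_def.2 (by omega)), if_neg (by omega), zero_mul]
      · rw [ih l hl'.le, if_neg hl'.ne', mul_zero]
    · simp

/-- The matrix of the iterates of the first basis vector. -/
def krylov (A : Matrix (Fin (n + 1)) (Fin (n + 1)) F) : Matrix (Fin (n + 1)) (Fin (n + 1)) F :=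
  fun i k => (A ^ (k : ℕ)) i 0

theorem IsHessenberg.isUnitri_krylov {A : Matrix (Fin (n + 1)) (Fin (n + 1)) F}
    (h : IsHessenberg A) : IsUnitri (krylov A) := by
  intro i j hij
  rw [krylov, h.pow_apply_zero j i hij, Matrix.one_apply]
  congr 1
  simp [Fin.ext_iff]

theorem krylov_mulVec (A : Matrix (Fin (n + 1)) (Fin (n + 1)) F) (a : Fin (n + 1) → F) :
    (krylov A).mulVec a = fun i => (∑ k : Fin (n + 1), a k • A ^ (k : ℕ)) i 0 := by
  funext i
  rw [Matrix.mulVec, dotProduct, Matrix.sum_apply]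
  exact Finset.sum_congr rfl fun k _ => by rw [Matrix.smul_apply, smul_eq_mul, mul_comm]; rfl

/-- The iterates of the first basis vector form a basis, so they determine a matrix. -/
theorem eq_of_mul_krylov {A M M' : Matrix (Fin (n + 1)) (Fin (n + 1)) F} (h : IsHessenberg A)
    (hM : ∀ k : Fin (n + 1), ∀ i, (M * A ^ (k : ℕ)) i 0 = (M' * A ^ (k : ℕ)) i 0) : M = M' := by
  have hu : IsUnit (krylov A) := by
    rw [Matrix.isUnit_iff_isUnit_det, h.isUnitri_krylov.det]; exact isUnit_one
  refine hu.mul_right_cancel ?_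
  ext i k
  have := hM k i
  rw [Matrix.mul_apply, Matrix.mul_apply] at this ⊢
  exact this

theorem pow_eq_sum_of_charpoly (A : Matrix (Fin (n + 1)) (Fin (n + 1)) F) :
    A ^ (n + 1) = -∑ k ∈ Finset.range (n + 1), A.charpoly.coeff k • A ^ k := by
  have h1 := A.aeval_self_charpoly
  have h2 : A.charpoly.natDegree = n + 1 := by rw [Matrix.charpoly_natDegree_eq_dim]; simp
  rw [Polynomial.aeval_eq_sum_range, h2, Finset.sum_range_succ] at h1
  have h3 : A.charpoly.coeff (n + 1) = 1 := by
    have := A.charpoly_monic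
    rwa [Polynomial.Monic, Polynomial.leadingCoeff, h2] at this
  rw [h3, one_smul] at h1
  exact eq_neg_of_add_eq_zero_right h1

/-- Hessenberg matrices with the same characteristic polynomial are conjugate under the
unitriangular group. -/
theorem IsHessenberg.exists_conj {A B : Matrix (Fin (n + 1)) (Fin (n + 1)) F}
    (hA : IsHessenberg A) (hB : IsHessenberg B) (h : A.charpoly = B.charpoly) :
    ∃ M : Matrix (Fin (n + 1)) (Fin (n + 1)) F, IsUnitri M ∧ A * M = M * B := by
  have hu : IsUnit (krylov B).det := by rw [hB.isUnitri_krylov.det]; exact isUnit_one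
  refine ⟨krylov A * (krylov B)⁻¹, hA.isUnitri_krylov.mul hB.isUnitri_krylov.inv, ?_⟩
  set M := krylov A * (krylov B)⁻¹ with hM
  have hMB : M * krylov B = krylov A := by
    rw [hM, Matrix.mul_assoc, Matrix.nonsing_inv_mul _ hu, Matrix.mul_one]
  have h1 : ∀ k : ℕ, k < n + 1 → ∀ i, (M * B ^ k) i 0 = (A ^ k) i 0 := by
    intro k hk i
    have := congrFun (congrFun hMB i) ⟨k, hk⟩
    rw [Matrix.mul_apply] at this ⊢
    exact this
  have h2 : ∀ k : ℕ, k ≤ n + 1 → ∀ i, (M * B ^ k) i 0 = (A ^ k) i 0 := by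
    intro k hk i
    rcases hk.lt_or_eq with hk | rfl
    · exact h1 k hk i
    -- At the exponent `n + 1`, Cayley–Hamilton with the common characteristic polynomial reduces to
    -- the lower powers.
    · rw [pow_eq_sum_of_charpoly, pow_eq_sum_of_charpoly, Matrix.mul_neg, Matrix.mul_sum,
        Matrix.neg_apply, Matrix.neg_apply, Matrix.sum_apply, Matrix.sum_apply, h]
      congr 1
      refine Finset.sum_congr rfl fun k hk => ?_
      rw [Matrix.mul_smul, Matrix.smul_apply, Matrix.smul_apply, h1 k (Finset.mem_range.1 hk)]
  refine eq_of_mul_krylov hB fun k i => ?_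
  rw [Matrix.mul_assoc M, ← pow_succ', h2 (k + 1) (by omega), pow_succ', Matrix.mul_assoc,
    Matrix.mul_apply, Matrix.mul_apply]
  exact Finset.sum_congr rfl fun l _ => by rw [h1 k k.2]

/-- A matrix commuting with a Hessenberg matrix is a polynomial in it. -/
theorem IsHessenberg.exists_eq_sum_pow {A x : Matrix (Fin (n + 1)) (Fin (n + 1)) F}
    (hA : IsHessenberg A) (hx : Commute x A) :
    ∃ a : Fin (n + 1) → F, x = ∑ k, a k • A ^ (k : ℕ) := by
  have hu : IsUnit (krylov A).det := by rw [hA.isUnitri_krylov.det]; exact isUnit_one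
  refine ⟨(krylov A)⁻¹.mulVec fun i => x i 0, ?_⟩
  set a := (krylov A)⁻¹.mulVec fun i => x i 0 with ha
  have h1 : ∀ i, x i 0 = (∑ k, a k • A ^ (k : ℕ)) i 0 := by
    intro i
    have := congrFun (krylov_mulVec A a) i
    rw [← this, ha, Matrix.mulVec_mulVec, Matrix.mul_nonsing_inv _ hu, Matrix.one_mulVec]
  have hcomm : Commute (∑ k : Fin (n + 1), a k • A ^ (k : ℕ)) A :=
    Commute.sum_left _ _ _ fun k _ => ((Commute.refl A).pow_left k).smul_left _
  refine eq_of_mul_krylov hA fun k i => ?_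
  rw [(hx.pow_right k).eq, (hcomm.pow_right k).eq, Matrix.mul_apply, Matrix.mul_apply]
  exact Finset.sum_congr rfl fun l _ => by rw [h1]

end Hessenberg

/-! ### The Gelfand–Kazhdan lemma. -/

section GelfandKazhdan

/-- The strictly upper triangular part of a matrix. -/
def strictUpper (n : ℕ) : Matrix (Fin n) (Fin n) F →ₗ[F] Matrix (Fin n) (Fin n) F where
  toFun X := Matrix.of fun i j => if i < j then X i j else 0
  map_add' X Y := by ext i j; by_cases h : i < j <;> simp [h]
  map_smul' c X := by ext i j; by_cases h : i < j <;> simp [h]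

theorem isUnitri_one_add_strictUpper (X : Matrix (Fin n) (Fin n) F) :
    IsUnitri (1 + strictUpper n X) := by
  intro i j hij
  rw [Matrix.add_apply, add_eq_left]
  exact if_neg hij.not_gt

theorem strictUpper_single {i j : Fin n} (hij : i < j) :
    strictUpper n (Matrix.single i j (1 : F)) = Matrix.single i j 1 := by
  ext a b
  change (if a < b then _ else _) = _
  rw [ite_eq_left_iff]
  intro hab
  rw [Matrix.single_apply_of_ne]
  rintro ⟨rfl, rfl⟩
  exact hab hij

theorem superdiag_single {i j : Fin n} :
    superdiag n (Matrix.single i j (1 : F)) = if (i : ℕ) + 1 = j then 1 else 0 := by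
  rw [superdiag_apply]
  split_ifs with h
  · rw [Finset.sum_eq_single (i, j)]
    · simp
    · intro p _ hp
      rw [Matrix.single_apply_of_ne]
      rintro ⟨h1, h2⟩
      exact hp (Prod.ext h1.symm h2.symm)
    · simp [h]
  · refine Finset.sum_eq_zero fun p hp => ?_
    rw [Matrix.single_apply_of_ne]
    rintro ⟨rfl, rfl⟩
    exact h (Finset.mem_filter.1 hp).2

/-- Either some one-parameter relation in the double coset of `g` is incompatible with the
generic character, or `g` intertwines two Hessenberg matrices. -/
theorem exists_relation_or_hessenberg (g : Matrix (Fin n) (Fin n) F) :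
    (∃ X Y : Matrix (Fin n) (Fin n) F, strictUpper n X * g = g * strictUpper n Y ∧
      superdiag n (strictUpper n X) ≠ superdiag n (strictUpper n Y)) ∨
    ∃ Z : Matrix (Fin n) (Fin n) F, IsHessenberg (g * Z) ∧ IsHessenberg (Z * g) := by
  rw [or_iff_not_imp_left]
  intro h
  push Not at h
  let T : (Matrix (Fin n) (Fin n) F × Matrix (Fin n) (Fin n) F) →ₗ[F] Matrix (Fin n) (Fin n) F :=
    LinearMap.mulRight F g ∘ₗ strictUpper n ∘ₗ LinearMap.fst F _ _ -
      LinearMap.mulLeft F g ∘ₗ strictUpper n ∘ₗ LinearMap.snd F _ _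
  let Φ : (Matrix (Fin n) (Fin n) F × Matrix (Fin n) (Fin n) F) →ₗ[F] F :=
    superdiag n ∘ₗ strictUpper n ∘ₗ LinearMap.fst F _ _ -
      superdiag n ∘ₗ strictUpper n ∘ₗ LinearMap.snd F _ _
  have hT : ∀ X Y, T (X, Y) = strictUpper n X * g - g * strictUpper n Y := fun _ _ => rfl
  have hΦ : ∀ X Y, Φ (X, Y) = superdiag n (strictUpper n X) - superdiag n (strictUpper n Y) :=
    fun _ _ => rfl
  -- If no relation is incompatible, `Φ` vanishes on the kernel of `T`, hence is `L ∘ T` for a form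
  -- `L`, which is the trace against some matrix `Z`. Evaluation on strictly upper matrix units
  -- reads off the entries of `g * Z` and `Z * g` below the diagonal.
  have hmem : Φ ∈ T.dualMap.range := by
    rw [LinearMap.range_dualMap_eq_dualAnnihilator_ker, Submodule.mem_dualAnnihilator]
    rintro ⟨X, Y⟩ hXY
    rw [LinearMap.mem_ker, hT, sub_eq_zero] at hXY
    rw [hΦ, h X Y hXY, sub_self]
  obtain ⟨L, hL⟩ := hmem
  have hL' : ∀ p, L (T p) = Φ p := fun p => LinearMap.congr_fun hL p
  let Z : Matrix (Fin n) (Fin n) F := fun j i => L (Matrix.single i j 1)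
  have hLZ : ∀ M : Matrix (Fin n) (Fin n) F, L M = ∑ i, ∑ j, M i j * Z j i := by
    intro M
    conv_lhs => rw [Matrix.matrix_eq_sum_single M]
    simp_rw [map_sum]
    refine Finset.sum_congr rfl fun i _ => Finset.sum_congr rfl fun j _ => ?_
    have hs : Matrix.single i j (M i j) = M i j • Matrix.single i j 1 := by
      rw [Matrix.smul_single, smul_eq_mul, mul_one]
    rw [hs, map_smul, smul_eq_mul]
  refine ⟨Z, fun j i hij => ?_, fun j i hij => ?_⟩
  · have h1 := hL' (Matrix.single i j 1, 0)
    rw [hT, hΦ, strictUpper_single hij, superdiag_single, map_zero, map_zero, mul_zero, sub_zero,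
      sub_zero, hLZ, Finset.sum_eq_single i] at h1
    · rw [← h1, Matrix.mul_apply]
      exact Finset.sum_congr rfl fun b _ => by simp
    · intro a _ ha
      exact Finset.sum_eq_zero fun b _ => by simp [ha]
    · simp
  · have h1 := hL' (0, Matrix.single i j 1)
    rw [hT, hΦ, strictUpper_single hij, superdiag_single, map_zero, map_zero, zero_mul, zero_sub,
      zero_sub, map_neg, neg_inj, hLZ, Finset.sum_comm, Finset.sum_eq_single j] at h1
    · rw [← h1, Matrix.mul_apply]
      exact Finset.sum_congr rfl fun b _ => by simp [mul_comm]
    · intro a _ ha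
      exact Finset.sum_eq_zero fun b _ => by simp [ha]
    · simp

/-- Gelfand–Kazhdan: functions transforming by a generic character on both sides are invariant
under reflection in the antidiagonal. -/
theorem apply_antiTransposeGL {M : Type*} [AddCommGroup M] [Module ℂ M] {ψ : AddChar F ℂ}
    (hψ : ψ ≠ 1) {f : GL (Fin (n + 1)) F → M}
    (hl : ∀ u g, IsUnitri u.val → f (u * g) = ψ (superdiag (n + 1) u.val) • f g)
    (hr : ∀ u g, IsUnitri u.val → f (g * u) = ψ (superdiag (n + 1) u.val) • f g)
    (g : GL (Fin (n + 1)) F) : f (antiTransposeGL g) = f g := by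
  rcases exists_relation_or_hessenberg g.val with ⟨X, Y, hXY, hne⟩ | ⟨Z, hA, hB⟩
  · obtain ⟨t, ht⟩ := AddChar.ne_one_iff.1 hψ
    set d := superdiag (n + 1) (strictUpper (n + 1) X) - superdiag (n + 1) (strictUpper (n + 1) Y)
      with hd
    have hd0 : d ≠ 0 := sub_ne_zero.2 hne
    -- Rescaling the relation makes the two character values differ by the factor `ψ t ≠ 1`.
    set c := t / d with hc
    have h1 : ∀ X : Matrix (Fin (n + 1)) (Fin (n + 1)) F, superdiag (n + 1)
        (1 + strictUpper (n + 1) (c • X)) = c * superdiag (n + 1) (strictUpper (n + 1) X) := by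
      intro X
      rw [map_add, superdiag_one, zero_add, map_smul, map_smul, smul_eq_mul]
    have hu := isUnitri_one_add_strictUpper (c • X)
    have hv := isUnitri_one_add_strictUpper (c • Y)
    have hrel : hu.toGL * g = g * hv.toGL := by
      refine Units.ext ?_
      rw [Units.val_mul, Units.val_mul, IsUnitri.val_toGL, IsUnitri.val_toGL, map_smul, map_smul,
        add_mul, mul_add, one_mul, mul_one, smul_mul_assoc, mul_smul_comm, hXY]
    have hψne : ψ (c * superdiag (n + 1) (strictUpper (n + 1) X)) ≠
        ψ (c * superdiag (n + 1) (strictUpper (n + 1) Y)) := by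
      intro h
      refine ht ?_
      have h2 : t = c * superdiag (n + 1) (strictUpper (n + 1) X) +
          -(c * superdiag (n + 1) (strictUpper (n + 1) Y)) := by
        rw [← sub_eq_add_neg, ← mul_sub, hc, div_mul_cancel₀ _ hd0]
      rw [h2, AddChar.map_add_eq_mul, h, ← AddChar.map_add_eq_mul, add_neg_cancel,
        AddChar.map_zero_eq_one]
    have hz : ∀ x : M, ψ (c * superdiag (n + 1) (strictUpper (n + 1) X)) • x =
        ψ (c * superdiag (n + 1) (strictUpper (n + 1) Y)) • x → x = 0 := by
      intro x hx
      rw [← sub_eq_zero, ← sub_smul] at hx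
      exact (smul_eq_zero.1 hx).resolve_left (sub_ne_zero.2 hψne)
    have h3 : f g = 0 := by
      refine hz _ ?_
      rw [← h1, ← h1]
      have := congrArg f hrel
      rwa [hl _ _ hu, hr _ _ hv] at this
    have h4 : f (antiTransposeGL g) = 0 := by
      refine hz _ ?_
      rw [← h1, ← h1]
      have := congrArg (fun x => f (antiTransposeGL x)) hrel
      simp only [antiTransposeGL_mul] at this
      rw [hr _ _ hu.antiTranspose, hl _ _ hv.antiTranspose] at this
      change ψ (superdiag _ (antiTranspose _)) • _ = ψ (superdiag _ (antiTranspose _)) • _ at this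
      rwa [superdiag_antiTranspose, superdiag_antiTranspose] at this
    rw [h3, h4]
  -- `g * Z` and `Z * g` have the same characteristic polynomial, so some unitriangular `u`
  -- conjugates them and `x = u⁻¹ g` commutes with `Z * g`; thus `x` is a polynomial in `Z * g`. A
  -- unitriangular `v` conjugates `Z * g` to its reflection, hence also `x` to its reflection, and
  -- the two characters of `v` cancel.
  · obtain ⟨u, hu, huB⟩ := hA.exists_conj hB (Matrix.charpoly_mul_comm _ _)
    obtain ⟨v, hv, hvB⟩ := hB.antiTranspose.exists_conj hB (by
      rw [antiTranspose, Matrix.charpoly_reindex, Matrix.charpoly_transpose])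
    set x : GL (Fin (n + 1)) F := hu.toGL⁻¹ * g with hx
    have hg : g = hu.toGL * x := by rw [hx, mul_inv_cancel_left]
    have hcomm : Commute x.val (Z * g.val) := by
      have h1 : hu.toGL.val * (x.val * (Z * g.val)) = hu.toGL.val * (Z * g.val * x.val) := by
        rw [← mul_assoc, ← Units.val_mul, ← hg, ← mul_assoc, ← mul_assoc, IsUnitri.val_toGL, ← huB,
          mul_assoc _ u, ← hu.val_toGL, ← Units.val_mul, ← hg]
      exact hu.toGL.isUnit.mul_left_cancel h1
    obtain ⟨a, ha⟩ := hB.exists_eq_sum_pow hcomm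
    have hrel : antiTransposeGL x * hv.toGL = hv.toGL * x := by
      refine Units.ext ?_
      rw [Units.val_mul, Units.val_mul, IsUnitri.val_toGL]
      have h1 : (antiTransposeGL x).val = ∑ k, a k • antiTranspose (Z * g.val) ^ (k : ℕ) := by
        change antiTranspose x.val = _
        rw [ha]
        ext i j
        rw [antiTranspose_apply, Matrix.sum_apply, Matrix.sum_apply]
        refine Finset.sum_congr rfl fun k _ => ?_
        rw [← antiTranspose_pow, Matrix.smul_apply, Matrix.smul_apply, antiTranspose_apply]
      have h2 : ∀ k : ℕ, antiTranspose (Z * g.val) ^ k * v = v * (Z * g.val) ^ k := by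
        intro k
        induction k with
        | zero => simp
        | succ k ih => rw [pow_succ, mul_assoc, hvB, ← mul_assoc, ih, mul_assoc, ← pow_succ]
      rw [h1, ha, Finset.sum_mul, Finset.mul_sum]
      exact Finset.sum_congr rfl fun k _ => by rw [smul_mul_assoc, mul_smul_comm, h2]
    have h3 : f (antiTransposeGL x) = f x := by
      have h4 := congrArg f hrel
      rw [hr _ _ hv, hl _ _ hv] at h4
      exact smul_right_injective M (ψ.val_isUnit _).ne_zero h4
    rw [hg, antiTransposeGL_mul, hr _ _ hu.antiTranspose, hl _ _ hu, h3]
    congr 2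
    exact superdiag_antiTranspose _

end GelfandKazhdan

end

end FiniteGL

/-! ### Top derivatives as sums over the unitriangular group. -/

namespace FiniteGL

universe u

section

variable {F : Type u} [Field F]

section Border

/-- The last coordinate, which is zero on the zero space. -/
def lastCoord (F : Type u) [Field F] : (k : ℕ) → (Fin k → F) →ₗ[F] F
  | 0 => 0
  | k + 1 => LinearMap.proj (Fin.last k)

/-- The block matrix with blocks `M`, `w`, `0`, `1`. -/
def border {k : ℕ} (M : Matrix (Fin k) (Fin k) F) (w : Fin k → F) :
    Matrix (Fin (k + 1)) (Fin (k + 1)) F :=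
  Matrix.of (Fin.snoc (α := fun _ => Fin (k + 1) → F)
    (fun i => Fin.snoc (α := fun _ => F) (M i) (w i)) (Fin.snoc (α := fun _ => F) 0 1))

variable {k : ℕ} (M : Matrix (Fin k) (Fin k) F) (w : Fin k → F)

@[simp] theorem border_castSucc_castSucc (i j : Fin k) :
    border M w i.castSucc j.castSucc = M i j := by simp [border]

@[simp] theorem border_castSucc_last (i : Fin k) : border M w i.castSucc (Fin.last k) = w i := by
  simp [border]

@[simp] theorem border_last_castSucc (j : Fin k) : border M w (Fin.last k) j.castSucc = 0 := by
  simp [border]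

@[simp] theorem border_last_last : border M w (Fin.last k) (Fin.last k) = 1 := by simp [border]

theorem isUnitri_border {M : Matrix (Fin k) (Fin k) F} (h : IsUnitri M) (w : Fin k → F) :
    IsUnitri (border M w) := by
  intro i j
  refine Fin.lastCases ?_ (fun i => ?_) i <;> refine Fin.lastCases ?_ (fun j => ?_) j
  · simp
  · intro _
    rw [border_last_castSucc, Matrix.one_apply_ne (Fin.castSucc_lt_last j).ne']
  · intro h
    exact absurd (Fin.castSucc_lt_last i) h.not_gt
  · intro hij
    rw [border_castSucc_castSucc, h i j (by simpa using hij)]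
    simp [Matrix.one_apply]

theorem superdiag_border : superdiag (k + 1) (border M w) = superdiag k M + lastCoord F k w := by
  simp_rw [superdiag_apply, Finset.sum_filter, Fintype.sum_prod_type, Fin.sum_univ_castSucc]
  have h1 : ∀ i : Fin k, ¬ (k + 1 = (i : ℕ)) := fun i => by omega
  simp only [Fin.val_castSucc, Fin.val_last, border_castSucc_castSucc, border_castSucc_last,
    border_last_castSucc, border_last_last, h1, if_false, Finset.sum_const_zero,
    Nat.succ_ne_self, Finset.sum_add_distrib, add_zero]
  congr 1
  cases k with
  | zero => simp [lastCoord]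
  | succ k =>
    rw [Finset.sum_eq_single (Fin.last k)]
    · simp [lastCoord]
    · intro i _ hi
      rw [if_neg]
      intro h
      exact hi (Fin.ext (by simpa using h))
    · simp

/-- Unitriangular matrices of size `k + 1` in terms of those of size `k`. -/
def unitriEquiv (k : ℕ) : {M : Matrix (Fin (k + 1)) (Fin (k + 1)) F // IsUnitri M} ≃
    {M : Matrix (Fin k) (Fin k) F // IsUnitri M} × (Fin k → F) where
  toFun M := (⟨Matrix.of fun i j => M.1 i.castSucc j.castSucc, fun i j hij => by
    rw [Matrix.of_apply, M.2 _ _ (by simpa using hij)]; simp [Matrix.one_apply]⟩,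
    fun i => M.1 i.castSucc (Fin.last k))
  invFun p := ⟨border p.1.1 p.2, isUnitri_border p.1.2 p.2⟩
  left_inv M := by
    refine Subtype.ext (Matrix.ext fun i j => ?_)
    refine Fin.lastCases ?_ (fun i => ?_) i <;> refine Fin.lastCases ?_ (fun j => ?_) j
    · dsimp only
      rw [border_last_last, M.2 _ _ le_rfl, Matrix.one_apply_eq]
    · dsimp only
      rw [border_last_castSucc, M.2 _ _ (Fin.castSucc_lt_last j).le,
        Matrix.one_apply_ne (Fin.castSucc_lt_last j).ne']
    · dsimp only
      rw [border_castSucc_last]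
    · dsimp only
      rw [border_castSucc_castSucc, Matrix.of_apply]
  right_inv p := by
    refine Prod.ext (Subtype.ext (Matrix.ext fun i j => ?_)) (funext fun i => ?_)
    · exact border_castSucc_castSucc _ _ _ _
    · exact border_castSucc_last _ _ _

/-- Appending a coordinate. -/
def snocEquiv (F : Type u) [Field F] (k : ℕ) : ((Fin k → F) × F) ≃ₗ[F] (Fin (k + 1) → F) where
  toFun p := Fin.snoc (α := fun _ => F) p.1 p.2
  invFun x := (fun i => x i.castSucc, x (Fin.last k))
  map_add' p q := by
    funext i
    refine Fin.lastCases ?_ (fun i => ?_) i <;> simp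
  map_smul' c p := by
    funext i
    refine Fin.lastCases ?_ (fun i => ?_) i <;> simp
  left_inv p := by ext <;> simp
  right_inv x := by
    funext i
    refine Fin.lastCases ?_ (fun i => ?_) i <;> simp

theorem snocEquiv_apply (p : (Fin k → F) × F) :
    snocEquiv F k p = Fin.snoc (α := fun _ => F) p.1 p.2 := rfl

theorem border_mulVec_snoc (p : (Fin k → F) × F) :
    (border M w).mulVec (snocEquiv F k p) = snocEquiv F k (M.mulVec p.1 + p.2 • w, p.2) := by
  rw [snocEquiv_apply, snocEquiv_apply]
  funext i
  rw [Matrix.mulVec, dotProduct, Fin.sum_univ_castSucc]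
  refine Fin.lastCases ?_ (fun i => ?_) i
  · simp
  · simp [Matrix.mulVec, dotProduct, mul_comm]

end Border

instance [Finite F] {k : ℕ} : Finite (Matrix (Fin k) (Fin k) F) :=
  inferInstanceAs (Finite (Fin k → Fin k → F))

open Classical in
noncomputable instance [Finite F] {k : ℕ} :
    Fintype {M : Matrix (Fin k) (Fin k) F // IsUnitri M} := Fintype.ofFinite _

/-- Each transform adjoins a last column weighted by `ψ` of its last coordinate, which is the new
entry just above the diagonal. On the zero space the iteration thus averages over the unitriangular
group against its generic character. The function `φ` stays arbitrary since the induction peels off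
the innermost transform. -/
theorem iterate_fourier_eq [Finite F] (ψ : AddChar F ℂ) (k : ℕ) : ∀ {φ : FlagFun F},
    IsInvFlag φ → ((fourier ψ)^[k] φ) PUnit.{u + 1} 0 0 =
      (Fintype.card {M : Matrix (Fin k) (Fin k) F // IsUnitri M} : ℂ)⁻¹ *
        ∑ M : {M : Matrix (Fin k) (Fin k) F // IsUnitri M}, ψ (superdiag k M.1) *
          φ (Fin k → F) (lastCoord F k) (Matrix.mulVecLin M.1) := by
  induction k with
  | zero =>
    intro φ hφ
    let x : {M : Matrix (Fin 0) (Fin 0) F // IsUnitri M} := ⟨1, isUnitri_one⟩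
    have hx : ∀ y, y = x := fun y => Subtype.ext (Subsingleton.elim _ _)
    rw [Fintype.sum_eq_single x fun y hy => absurd (hx y) hy,
      Fintype.card_eq_one_iff.2 ⟨x, hx⟩, superdiag_one, AddChar.map_zero_eq_one]
    simp only [Nat.cast_one, inv_one, one_mul]
    refine hφ (LinearEquiv.ofSubsingleton (R := F) PUnit.{u + 1} (Fin 0 → F)) _ _ _ _ ?_ ?_
    · intro v; rfl
    · intro v; exact Subsingleton.elim _ _
  | succ k ih =>
    intro φ hφ
    have := Fintype.ofFinite F
    rw [Function.iterate_succ_apply, ih (hφ.fourier ψ), Fintype.card_congr (unitriEquiv k),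
      Fintype.card_prod, Nat.cast_mul, mul_inv, mul_assoc,
      ← (unitriEquiv k).symm.sum_comp, Fintype.sum_prod_type]
    congr 1
    rw [Finset.mul_sum]
    refine Finset.sum_congr rfl fun M _ => ?_
    rw [fourier_eq, mul_left_comm, Finset.mul_sum]
    have hc : Fintype.card (F →ₗ[F] (Fin k → F)) = Fintype.card (Fin k → F) :=
      Fintype.card_congr (LinearMap.ringLmapEquivSelf F F (Fin k → F)).toEquiv
    rw [hc]
    congr 1
    refine Fintype.sum_equiv (LinearMap.ringLmapEquivSelf F F (Fin k → F)).toEquiv _ _ fun u => ?_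
    change _ = ψ (superdiag (k + 1) (border M.1 (u 1))) * φ _ _ (Matrix.mulVecLin (border M.1 (u 1)))
    rw [superdiag_border, AddChar.map_add_eq_mul, mul_assoc]
    congr 2
    refine hφ (snocEquiv F k) _ _ _ _ ?_ ?_
    · intro p
      simp [lastCoord, snocEquiv_apply]
    · intro p
      rw [Matrix.mulVecLin_apply, border_mulVec_snoc, blk_apply]
      congr 2
      rw [← map_smul, smul_eq_mul, mul_one, Matrix.mulVecLin_apply]

theorem derivative_toEndFun [Finite F] {n : ℕ} {χ : GL (Fin n) F → ℂ}
    (hχ : ∀ x y, χ (y * x * y⁻¹) = χ x) (ψ : AddChar F ℂ) :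
    derivative ψ n (toEndFun χ) PUnit.{u + 1} 0 =
      (Fintype.card {M : Matrix (Fin n) (Fin n) F // IsUnitri M} : ℂ)⁻¹ *
        ∑ M : {M : Matrix (Fin n) (Fin n) F // IsUnitri M}, ψ (superdiag n M.1) *
          χ M.2.toGL := by
  rw [derivative, iterFourier, iterate_fourier_eq ψ n (isInv_toEndFun hχ).flag]
  congr 1
  refine Finset.sum_congr rfl fun M _ => ?_
  congr 1
  exact toEndFun_eq hχ (LinearEquiv.refl F _) fun v => rfl

/-! ### Uniqueness of Whittaker models. -/

section Generic

variable [Finite F] {n : ℕ} {V : Type*} [AddCommGroup V] [Module ℂ V]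

/-- The operator projecting to the vectors on which the unitriangular group acts by the inverse of
the generic character. -/
noncomputable def whittakerOp (ψ : AddChar F ℂ) (ρ : Representation ℂ (GL (Fin n) F) V) :
    Module.End ℂ V :=
  (Fintype.card {M : Matrix (Fin n) (Fin n) F // IsUnitri M} : ℂ)⁻¹ •
    ∑ M : {M : Matrix (Fin n) (Fin n) F // IsUnitri M}, ψ (superdiag n M.1) • ρ M.2.toGL

variable {ψ : AddChar F ℂ} {ρ : Representation ℂ (GL (Fin n) F) V}

theorem trace_whittakerOp : LinearMap.trace ℂ V (whittakerOp ψ ρ) =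
    derivative ψ n (toEndFun ρ.character) PUnit.{u + 1} 0 := by
  rw [derivative_toEndFun (fun x y => ρ.char_conj x y), whittakerOp, map_smul, map_sum, smul_eq_mul]
  simp_rw [map_smul, smul_eq_mul]
  rfl

theorem map_mul_whittakerOp {u : GL (Fin n) F} (hu : IsUnitri u.val) :
    ρ u * whittakerOp ψ ρ = ψ⁻¹ (superdiag n u.val) • whittakerOp ψ ρ := by
  rw [whittakerOp, mul_smul_comm, smul_comm, Finset.mul_sum]
  congr 1
  have hb : Function.Bijective fun M : {M : Matrix (Fin n) (Fin n) F // IsUnitri M} =>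
      (⟨u.val * M.1, hu.mul M.2⟩ : {M : Matrix (Fin n) (Fin n) F // IsUnitri M}) := by
    rw [← Finite.injective_iff_bijective]
    intro M M' h
    exact Subtype.ext (u.isUnit.mul_left_cancel (congrArg Subtype.val h))
  rw [Finset.smul_sum]
  refine Fintype.sum_bijective _ hb _ _ fun M => ?_
  rw [hu.superdiag_mul M.2, AddChar.map_add_eq_mul, mul_smul_comm, smul_smul, ← mul_assoc,
    AddChar.inv_apply, ← AddChar.map_add_eq_mul, neg_add_cancel, AddChar.map_zero_eq_one, one_mul,
    ← map_mul]
  congr 2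
  exact Units.ext rfl

theorem whittakerOp_mul_map {u : GL (Fin n) F} (hu : IsUnitri u.val) :
    whittakerOp ψ ρ * ρ u = ψ⁻¹ (superdiag n u.val) • whittakerOp ψ ρ := by
  rw [whittakerOp, smul_mul_assoc, smul_comm, Finset.sum_mul]
  congr 1
  have hb : Function.Bijective fun M : {M : Matrix (Fin n) (Fin n) F // IsUnitri M} =>
      (⟨M.1 * u.val, M.2.mul hu⟩ : {M : Matrix (Fin n) (Fin n) F // IsUnitri M}) := by
    rw [← Finite.injective_iff_bijective]
    intro M M' h
    exact Subtype.ext (u.isUnit.mul_right_cancel (congrArg Subtype.val h))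
  rw [Finset.smul_sum]
  refine Fintype.sum_bijective _ hb _ _ fun M => ?_
  rw [M.2.superdiag_mul hu, AddChar.map_add_eq_mul, smul_mul_assoc, smul_smul,
    mul_comm (ψ (superdiag n M.1)), ← mul_assoc,
    AddChar.inv_apply, ← AddChar.map_add_eq_mul, neg_add_cancel, AddChar.map_zero_eq_one, one_mul,
    ← map_mul]
  congr 2
  exact Units.ext rfl

theorem card_unitri_ne_zero :
    (Fintype.card {M : Matrix (Fin n) (Fin n) F // IsUnitri M} : ℂ) ≠ 0 := by
  have : Nonempty {M : Matrix (Fin n) (Fin n) F // IsUnitri M} := ⟨⟨1, isUnitri_one⟩⟩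
  exact_mod_cast Fintype.card_ne_zero

theorem whittakerOp_mul_self : whittakerOp ψ ρ * whittakerOp ψ ρ = whittakerOp ψ ρ := by
  conv_lhs => enter [1]; rw [whittakerOp]
  rw [smul_mul_assoc, Finset.sum_mul, Finset.sum_congr rfl (g := fun _ => whittakerOp ψ ρ),
    Finset.sum_const, Finset.card_univ, ← Nat.cast_smul_eq_nsmul ℂ, smul_smul,
    inv_mul_cancel₀ card_unitri_ne_zero, one_smul]
  intro M _
  rw [smul_mul_assoc, map_mul_whittakerOp M.2, smul_smul, M.2.val_toGL, AddChar.inv_apply,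
    ← AddChar.map_add_eq_mul, add_neg_cancel, AddChar.map_zero_eq_one, one_smul]

theorem whittakerOp_eq_antiTranspose : whittakerOp ψ ρ =
    (Fintype.card {M : Matrix (Fin n) (Fin n) F // IsUnitri M} : ℂ)⁻¹ •
      ∑ M : {M : Matrix (Fin n) (Fin n) F // IsUnitri M},
        ψ (superdiag n M.1) • ρ (antiTransposeGL M.2.toGL) := by
  rw [whittakerOp]
  congr 1
  have hb : Function.Bijective fun M : {M : Matrix (Fin n) (Fin n) F // IsUnitri M} =>
      (⟨antiTranspose M.1, M.2.antiTranspose⟩ :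
        {M : Matrix (Fin n) (Fin n) F // IsUnitri M}) := by
    rw [← Finite.injective_iff_bijective]
    intro M M' h
    refine Subtype.ext (Matrix.ext fun i j => ?_)
    have := congrFun (congrFun (congrArg Subtype.val h) j.rev) i.rev
    simpa [antiTranspose_apply] using this
  refine (Fintype.sum_bijective _ hb _ _ fun M => ?_).symm
  rw [superdiag_antiTranspose]
  congr 2
  exact Units.ext rfl

/-- With `E` the Whittaker projector, `g ↦ E g E` transforms on both sides by the generic character
of `ψ⁻¹`, so the Gelfand–Kazhdan lemma applies. -/
theorem whittakerOp_mul_map_mul_antiTransposeGL {ρ : Representation ℂ (GL (Fin (n + 1)) F) V}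
    (hψ : ψ ≠ 1) (g : GL (Fin (n + 1)) F) :
    whittakerOp ψ ρ * ρ (antiTransposeGL g) * whittakerOp ψ ρ =
      whittakerOp ψ ρ * ρ g * whittakerOp ψ ρ := by
  refine apply_antiTransposeGL (inv_ne_one.2 hψ) (f := fun g => whittakerOp ψ ρ * ρ g *
    whittakerOp ψ ρ) ?_ ?_ g
  · intro u g hu
    rw [map_mul, ← mul_assoc, whittakerOp_mul_map hu, smul_mul_assoc, smul_mul_assoc]
  · intro u g hu
    rw [map_mul, mul_assoc, mul_assoc, map_mul_whittakerOp hu, mul_smul_comm, mul_smul_comm,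
      mul_assoc]

/-- Gelfand's trick: the reflection reverses products but fixes every `E g E`, so these operators
commute. -/
theorem whittakerOp_comm {ρ : Representation ℂ (GL (Fin (n + 1)) F) V} (hψ : ψ ≠ 1)
    (g h : GL (Fin (n + 1)) F) :
    whittakerOp ψ ρ * ρ g * whittakerOp ψ ρ * ρ h * whittakerOp ψ ρ =
      whittakerOp ψ ρ * ρ h * whittakerOp ψ ρ * ρ g * whittakerOp ψ ρ := by
  -- Expanding the middle projector writes `E g E h E` through operators `E x E`. Both expressions
  -- of that projector are needed, over the unitriangular matrices and over their reflections.
  have expand : ∀ (g h : GL (Fin (n + 1)) F) (T : Module.End ℂ V)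
      (c : {M : Matrix (Fin (n + 1)) (Fin (n + 1)) F // IsUnitri M} → GL (Fin (n + 1)) F),
      T = (Fintype.card {M : Matrix (Fin (n + 1)) (Fin (n + 1)) F // IsUnitri M} : ℂ)⁻¹ •
        ∑ M : {M : Matrix (Fin (n + 1)) (Fin (n + 1)) F // IsUnitri M},
          ψ (superdiag (n + 1) M.1) • ρ (c M) →
      whittakerOp ψ ρ * ρ g * T * ρ h * whittakerOp ψ ρ =
      (Fintype.card {M : Matrix (Fin (n + 1)) (Fin (n + 1)) F // IsUnitri M} : ℂ)⁻¹ •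
        ∑ M : {M : Matrix (Fin (n + 1)) (Fin (n + 1)) F // IsUnitri M},
          ψ (superdiag (n + 1) M.1) • (whittakerOp ψ ρ * ρ (g * c M * h) * whittakerOp ψ ρ) := by
    intro g h T c hT
    rw [hT, mul_smul_comm, smul_mul_assoc, smul_mul_assoc, Finset.mul_sum, Finset.sum_mul,
      Finset.sum_mul]
    congr 1
    refine Finset.sum_congr rfl fun M _ => ?_
    rw [mul_smul_comm, smul_mul_assoc, smul_mul_assoc, map_mul, map_mul, mul_assoc, mul_assoc,
      mul_assoc, mul_assoc, mul_assoc, mul_assoc]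
  have h1 := expand g h (whittakerOp ψ ρ) (fun M => M.2.toGL) rfl
  have h2 := expand (antiTransposeGL h) (antiTransposeGL g) _ _
    (whittakerOp_eq_antiTranspose (ψ := ψ) (ρ := ρ))
  simp_rw [← antiTransposeGL_mul, whittakerOp_mul_map_mul_antiTransposeGL hψ, ← mul_assoc] at h2
  rw [h1, ← h2]
  have h3 : ∀ x y : Module.End ℂ V, whittakerOp ψ ρ * x * whittakerOp ψ ρ * y * whittakerOp ψ ρ =
      (whittakerOp ψ ρ * x * whittakerOp ψ ρ) * (whittakerOp ψ ρ * y * whittakerOp ψ ρ) := by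
    intro x y
    have hE := whittakerOp_mul_self (ψ := ψ) (ρ := ρ)
    rw [← mul_assoc _ (whittakerOp ψ ρ * y), ← mul_assoc _ (whittakerOp ψ ρ),
      mul_assoc _ (whittakerOp ψ ρ) (whittakerOp ψ ρ), hE]
  rw [h3, h3, whittakerOp_mul_map_mul_antiTransposeGL hψ]

end Generic

section Irreducible

variable {G V : Type*} [Group G] [AddCommGroup V] [Module ℂ V]

theorem span_orbit_eq_top {ρ : Representation ℂ G V} (hρ : ρ.IsIrreducible) {w : V} (hw : w ≠ 0) :
    Submodule.span ℂ (Set.range fun g => ρ g w) = ⊤ := by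
  let S : Subrepresentation ρ :=
    { toSubmodule := Submodule.span ℂ (Set.range fun g => ρ g w)
      apply_mem_toSubmodule := fun g v hv => by
        induction hv using Submodule.span_induction with
        | mem x hx =>
          obtain ⟨h, rfl⟩ := hx
          refine Submodule.subset_span ⟨g * h, ?_⟩
          simp
        | zero => rw [map_zero]; exact zero_mem _
        | add x y _ _ hx hy => rw [map_add]; exact add_mem hx hy
        | smul c x _ hx => rw [map_smul]; exact Submodule.smul_mem _ c hx }
  have hmem : w ∈ S.toSubmodule := Submodule.subset_span ⟨1, by simp⟩
  rcases hρ.eq_bot_or_eq_top S with h | h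
  · rw [h] at hmem
    exact absurd hmem hw
  · exact congrArg Subrepresentation.toSubmodule h

theorem nontrivial_of_isIrreducible {ρ : Representation ℂ G V} (hρ : ρ.IsIrreducible) :
    Nontrivial V := by
  by_contra h
  rw [not_nontrivial_iff_subsingleton] at h
  obtain ⟨S, T, hST⟩ := hρ.exists_pair_ne
  refine hST (Subrepresentation.toSubmodule_injective (Submodule.ext fun x => ?_))
  rw [Subsingleton.elim x 0]
  exact ⟨fun _ => zero_mem _, fun _ => zero_mem _⟩

theorem finiteDimensional_of_isIrreducible [Finite G] {ρ : Representation ℂ G V}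
    (hρ : ρ.IsIrreducible) : FiniteDimensional ℂ V := by
  have := nontrivial_of_isIrreducible hρ
  obtain ⟨w, hw⟩ := exists_ne (0 : V)
  exact ⟨⟨(Set.finite_range fun g => ρ g w).toFinset, by
    rw [Set.Finite.coe_toFinset, span_orbit_eq_top hρ hw]⟩⟩

/-- If the operators `E g E` commute for an idempotent `E`, then `E` has rank at most one. -/
theorem trace_eq_one_of_comm [FiniteDimensional ℂ V] {ρ : Representation ℂ G V}
    (hρ : ρ.IsIrreducible) {E : Module.End ℂ V} (hE : E * E = E)
    (hcomm : ∀ g h, E * ρ g * E * ρ h * E = E * ρ h * E * ρ g * E) (hE0 : E ≠ 0) :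
    LinearMap.trace ℂ V E = 1 := by
  have hEE : ∀ x, E (E x) = E x := fun x => LinearMap.congr_fun hE x
  have hc : ∀ g h x, E (ρ g (E (ρ h (E x)))) = E (ρ h (E (ρ g (E x)))) := fun g h x =>
    LinearMap.congr_fun (hcomm g h) x
  have hspan : ∀ w, E w = w → w ≠ 0 → ∀ (S : Submodule ℂ V), (∀ g, E (ρ g w) ∈ S) →
      ∀ x, E x ∈ S := by
    intro w _ hw S hS x
    have hx : x ∈ Submodule.span ℂ (Set.range fun g => ρ g w) := by
      rw [span_orbit_eq_top hρ hw]; trivial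
    induction hx using Submodule.span_induction with
    | mem x hx => obtain ⟨g, rfl⟩ := hx; exact hS g
    | zero => rw [map_zero]; exact zero_mem _
    | add x y _ _ hx hy => rw [map_add]; exact add_mem hx hy
    | smul c x _ hx => rw [map_smul]; exact Submodule.smul_mem _ c hx
  obtain ⟨w₀, hw₀, hw₀E⟩ : ∃ w, w ≠ 0 ∧ E w = w := by
    obtain ⟨x, hx⟩ : ∃ x, E x ≠ 0 := by
      by_contra h
      push Not at h
      exact hE0 (LinearMap.ext h)
    exact ⟨E x, hx, hEE x⟩
  have hne : Nontrivial E.range := ⟨⟨⟨w₀, w₀, hw₀E⟩, 0, fun h => hw₀ (congrArg Subtype.val h)⟩⟩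
  -- An eigenvector `w` of `E g` in the range of `E` exists; commutation carries its eigenvalue to
  -- all `E h w`, and these span the range by irreducibility.
  have hscalar : ∀ g, ∃ c : ℂ, ∀ x, E (ρ g (E x)) = c • E x := by
    intro g
    let T : Module.End ℂ E.range := (E * ρ g).restrict (q := E.range) fun x _ => ⟨ρ g x, rfl⟩
    obtain ⟨c, hc'⟩ := Module.End.exists_eigenvalue T
    obtain ⟨w, hw⟩ := hc'.exists_hasEigenvector
    have hwE : E (w : V) = w := by obtain ⟨y, hy⟩ := w.2; rw [← hy, hEE]
    have hTw : E (ρ g w) = c • (w : V) := congrArg Subtype.val hw.apply_eq_smul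
    have hw0 : (w : V) ≠ 0 := fun h => hw.2 (Subtype.ext h)
    refine ⟨c, fun x => ?_⟩
    have := hspan w hwE hw0 (LinearMap.ker (E * ρ g * E - c • E)) (fun h => ?_) x
    · rw [LinearMap.mem_ker, LinearMap.sub_apply, sub_eq_zero] at this
      simpa [hEE] using this
    · rw [LinearMap.mem_ker, LinearMap.sub_apply, sub_eq_zero]
      have h1 := hc g h w
      rw [hwE, hTw, map_smul, map_smul] at h1
      simpa [hEE, hwE] using h1
  have hrank : Module.finrank ℂ E.range = 1 := by
    refine finrank_eq_one (⟨w₀, w₀, hw₀E⟩ : E.range) (fun h => hw₀ (congrArg Subtype.val h)) ?_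
    rintro ⟨_, x, rfl⟩
    have := hspan w₀ hw₀E hw₀ (Submodule.span ℂ {w₀}) (fun g => ?_) x
    · obtain ⟨c, hc'⟩ := Submodule.mem_span_singleton.1 this
      exact ⟨c, Subtype.ext hc'⟩
    · obtain ⟨c, hc'⟩ := hscalar g
      have := hc' w₀
      rw [hw₀E] at this
      rw [this]
      exact Submodule.smul_mem _ _ (Submodule.mem_span_singleton_self w₀)
  rw [(LinearMap.IsIdempotentElem.isProj_range E hE).trace, hrank, Nat.cast_one]

end Irreducible

section Whittaker

variable [Finite F] {n : ℕ} {V : Type*} [AddCommGroup V] [Module ℂ V]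
  {ρ : Representation ℂ (GL (Fin n) F) V} {ψ : AddChar F ℂ}

/-- Existence of a Whittaker model. In the branching formula against the indicator of the identity,
one side is a nonzero multiple of `dim V`. On the other side positive derivatives vanish on nonzero
spaces, so only the term of the top derivative can be nonzero. -/
theorem derivative_ne_zero (hn : 0 < n) [FiniteDimensional ℂ V] [Nontrivial V]
    (hρ : OperatorsSumToZero ρ) (hψ : ψ ≠ 1) :
    derivative ψ n (toEndFun ρ.character) PUnit.{u + 1} 0 ≠ 0 := by
  classical
  obtain ⟨m, rfl⟩ : ∃ m, n = m + 1 := ⟨n - 1, by omega⟩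
  intro h0
  have hχ : ∀ x y, ρ.character (y * x * y⁻¹) = ρ.character x := fun x y => ρ.char_conj x y
  have hf := isInv_toEndFun hχ
  let h : EndFun F := fun V [_] [_] g => if g = LinearMap.id then 1 else 0
  have hh : IsInv h := by
    intro V W _ _ _ _ e g g' hg
    have : g = LinearMap.id ↔ g' = LinearMap.id := by
      constructor
      · rintro rfl
        ext w
        obtain ⟨v, rfl⟩ := e.surjective w
        rw [← hg]; rfl
      · rintro rfl
        ext v
        exact e.injective (hg v)
    simp only [h, this]
  have key := (sum_blk_mul_eq_sum_pairing hf hh hψ m).trans (Finset.sum_eq_zero fun i hi => by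
    rw [pairing, Finset.sum_eq_zero, mul_zero]
    intro g _
    by_cases him : i = m
    · subst him
      have : derivative ψ (i + 1) (toEndFun ρ.character) (Fin (i - i) → F) g = 0 := by
        rw [← h0]
        refine (hf.derivative ψ (i + 1)) (LinearEquiv.ofFinrankEq _ _ (by
          simp [Module.finrank_zero_of_subsingleton])) _ _ fun v => ?_
        exact Subsingleton.elim _ _
      rw [this, zero_mul]
    · have : Nonempty (Fin (m - i)) := ⟨⟨0, by have := Finset.mem_range.1 hi; omega⟩⟩
      rw [derivative_eq_zero hf hρ.sumsToZero ψ (Nat.succ_pos i), zero_mul])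
  rw [Finset.sum_eq_single LinearMap.id] at key
  · have h1 : toEndFun ρ.character ((Fin m → F) × F)
        (blk LinearMap.id 0 LinearMap.id) = ρ.character 1 := by
      refine toEndFun_eq hχ (snocEquiv F m) fun p => ?_
      simp
    rw [h1, ρ.char_one] at key
    have h2 := card_GL_ne_zero (F := F) m
    have h3 : (Module.finrank ℂ V : ℂ) ≠ 0 := by
      exact_mod_cast Module.finrank_pos.ne'
    simp [h, h2, h3] at key
  · intro g _ hg
    simp [h, hg]
  · simp

/-- Multiplicity one for Whittaker models of cuspidal representations. -/
theorem derivative_character (hn : 0 < n) (hirr : ρ.IsIrreducible) (hρ : OperatorsSumToZero ρ)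
    (hψ : ψ ≠ 1) : derivative ψ n (toEndFun ρ.character) PUnit.{u + 1} 0 = 1 := by
  have := finiteDimensional_of_isIrreducible hirr
  have := nontrivial_of_isIrreducible hirr
  have hne := derivative_ne_zero hn hρ hψ
  obtain ⟨m, rfl⟩ : ∃ m, n = m + 1 := ⟨n - 1, by omega⟩
  rw [← trace_whittakerOp] at hne ⊢
  refine trace_eq_one_of_comm hirr whittakerOp_mul_self (whittakerOp_comm hψ) ?_
  intro h
  rw [h, map_zero] at hne
  exact hne rfl

theorem derivative_character_dual [FiniteDimensional ℂ V] :
    derivative ψ n (toEndFun ρ.dual.character) PUnit.{u + 1} 0 =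
      derivative ψ⁻¹ n (toEndFun ρ.character) PUnit.{u + 1} 0 := by
  rw [derivative_toEndFun (fun x y => ρ.dual.char_conj x y),
    derivative_toEndFun (fun x y => ρ.char_conj x y)]
  congr 1
  have hb : Function.Bijective fun M : {M : Matrix (Fin n) (Fin n) F // IsUnitri M} =>
      (⟨M.1⁻¹, M.2.inv⟩ : {M : Matrix (Fin n) (Fin n) F // IsUnitri M}) := by
    rw [← Finite.injective_iff_bijective]
    intro M M' h
    refine Subtype.ext ?_
    have := congrArg (fun x => x⁻¹) (congrArg Subtype.val h)
    dsimp only at this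
    rwa [Matrix.nonsing_inv_nonsing_inv _ (by rw [M.2.det]; exact isUnit_one),
      Matrix.nonsing_inv_nonsing_inv _ (by rw [M'.2.det]; exact isUnit_one)] at this
  refine Fintype.sum_bijective _ hb _ _ fun M => ?_
  rw [ρ.char_dual]
  congr 1
  · rw [AddChar.inv_apply]
    congr 1
    rw [eq_neg_iff_add_eq_zero, ← M.2.superdiag_mul M.2.inv,
      Matrix.mul_nonsing_inv _ (by rw [M.2.det]; exact isUnit_one), superdiag_one]
  · congr 1
    refine Units.ext ?_
    rw [Matrix.coe_units_inv]
    rfl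

theorem isCuspidalFun_toEndFun (hn : 0 < n) (hirr : ρ.IsIrreducible) (hρ : IsCuspidal ρ) :
    IsCuspidalFun n (toEndFun ρ.character) where
  isInv := isInv_toEndFun fun x y => ρ.char_conj x y
  pos := hn
  hasDegree := hasDegree_toEndFun
  sumsToZero := hρ.operatorsSumToZero.sumsToZero
  whittaker _ hψ := derivative_character hn hirr hρ.operatorsSumToZero hψ

theorem isCuspidalFun_toEndFun_dual (hn : 0 < n) (hirr : ρ.IsIrreducible) (hρ : IsCuspidal ρ) :
    IsCuspidalFun n (toEndFun ρ.dual.character) where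
  isInv := isInv_toEndFun fun x y => ρ.dual.char_conj x y
  pos := hn
  hasDegree := hasDegree_toEndFun
  sumsToZero := hρ.operatorsSumToZero.dual.sumsToZero
  whittaker ψ hψ := by
    have := finiteDimensional_of_isIrreducible hirr
    rw [derivative_character_dual,
      derivative_character hn hirr hρ.operatorsSumToZero (inv_ne_one.2 hψ)]

end Whittaker

end

end FiniteGL

/-! ### Block triangular matrices and iterated Hall products. -/

namespace FiniteGL

universe u

section

variable {F : Type u} [Field F]

section HallTerm

variable {A B : Type u} [AddCommGroup A] [Module F A] [AddCommGroup B] [Module F B]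

open Classical in
theorem hallTerm_range_inl {f h : EndFun F} (hf : IsInv f) (hh : IsInv h)
    (g : (A × B) →ₗ[F] (A × B)) :
    hallTerm f h (A × B) g (LinearMap.inl F A B).range =
      if ∀ x, (g (x, 0)).2 = 0 then
        f A (LinearMap.fst F A B ∘ₗ g ∘ₗ LinearMap.inl F A B) *
          h B (LinearMap.snd F A B ∘ₗ g ∘ₗ LinearMap.inr F A B)
      else 0 := by
  split_ifs with H
  · refine hallTerm_eq hf hh (LinearMap.inl F A B) LinearMap.inl_injective rfl
      (LinearMap.snd F A B) LinearMap.snd_surjective ?_ _ ?_ _ ?_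
    · rw [LinearMap.range_inl]
    · exact fun x => Prod.ext rfl (H x)
    · intro p
      have : g p = g (p.1, 0) + g (0, p.2) := by rw [← map_add]; simp
      rw [this, map_add, LinearMap.snd_apply, H, zero_add]
      rfl
  · rw [hallTerm, dif_neg]
    intro h
    refine H fun x => ?_
    exact mem_range_inl_iff.1 (h ⟨x, rfl⟩)

theorem snd_comp_blkEquiv_comp_inr (a : A ≃ₗ[F] A) (u : B →ₗ[F] A) (b : B ≃ₗ[F] B) :
    LinearMap.snd F A B ∘ₗ (blkEquiv a u b : (A × B) →ₗ[F] (A × B)) ∘ₗ LinearMap.inr F A B =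
      (b : B →ₗ[F] B) := by
  refine LinearMap.ext fun x => ?_
  simp [blkEquiv_apply]

end HallTerm

section ParabolicTerm

variable {r : ℕ}

/-- Vectors indexed by `r + 1` blocks, split into the first block and the others. -/
def consBlockEquiv (F : Type u) [Field F] (n : Fin (r + 1) → ℕ) :
    ((Fin (n 0) → F) × ((i : Fin r) × Fin (n i.succ) → F)) ≃ₗ[F]
      ((i : Fin (r + 1)) × Fin (n i) → F) where
  toFun p x := Fin.cases (motive := fun i => Fin (n i) → F) p.1 (fun i a => p.2 ⟨i, a⟩) x.1 x.2
  invFun v := (fun a => v ⟨0, a⟩, fun q => v ⟨q.1.succ, q.2⟩)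
  map_add' p q := by
    funext ⟨i, a⟩
    refine Fin.cases (fun _ => rfl) (fun _ _ => rfl) i a
  map_smul' c p := by
    funext ⟨i, a⟩
    refine Fin.cases (fun _ => rfl) (fun _ _ => rfl) i a
  left_inv p := rfl
  right_inv v := by
    funext ⟨i, a⟩
    refine Fin.cases (fun _ => rfl) (fun _ _ => rfl) i a

open Classical in
/-- The product of the values of `f i` at the diagonal blocks of a block upper triangular matrix,
extended by zero. -/
noncomputable def parabolicTerm (n : Fin r → ℕ) (f : Fin r → EndFun F)
    (M : Matrix ((i : Fin r) × Fin (n i)) ((i : Fin r) × Fin (n i)) F) : ℂ :=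
  if M.BlockTriangular Sigma.fst then
    ∏ i, f i (Fin (n i) → F) (Matrix.mulVecLin (M.blockDiag' i)) else 0

variable (n : Fin (r + 1) → ℕ)
  (g : ((Fin (n 0) → F) × ((i : Fin r) × Fin (n i.succ) → F)) →ₗ[F]
    ((Fin (n 0) → F) × ((i : Fin r) × Fin (n i.succ) → F)))

theorem consBlockEquiv_symm_single_zero (a : Fin (n 0)) :
    (consBlockEquiv F n).symm (Pi.single ⟨0, a⟩ 1) = (Pi.single a 1, 0) := by
  rw [LinearEquiv.symm_apply_eq]
  funext ⟨i, b⟩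
  refine Fin.cases (fun b => ?_) (fun i b => ?_) i b
  · change (Pi.single (⟨0, a⟩ : (i : Fin (r + 1)) × Fin (n i)) (1 : F) :
      (i : Fin (r + 1)) × Fin (n i) → F) ⟨0, b⟩ = (Pi.single a 1 : Fin (n 0) → F) b
    simp [Pi.single_apply]
  · change (Pi.single (⟨0, a⟩ : (i : Fin (r + 1)) × Fin (n i)) (1 : F) :
      (i : Fin (r + 1)) × Fin (n i) → F) ⟨i.succ, b⟩ = 0
    rw [Pi.single_eq_of_ne]
    simp

theorem consBlockEquiv_symm_single_succ (q : (i : Fin r) × Fin (n i.succ)) :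
    (consBlockEquiv F n).symm (Pi.single ⟨q.1.succ, q.2⟩ 1) = (0, Pi.single q 1) := by
  rw [LinearEquiv.symm_apply_eq]
  funext ⟨i, b⟩
  refine Fin.cases (fun b => ?_) (fun i b => ?_) i b
  · change (Pi.single (⟨q.1.succ, q.2⟩ : (i : Fin (r + 1)) × Fin (n i)) (1 : F) :
      (i : Fin (r + 1)) × Fin (n i) → F) ⟨0, b⟩ = 0
    rw [Pi.single_eq_of_ne]
    simp [(Fin.succ_ne_zero _).symm]
  · change (Pi.single (⟨q.1.succ, q.2⟩ : (i : Fin (r + 1)) × Fin (n i)) (1 : F) :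
      (i : Fin (r + 1)) × Fin (n i) → F) ⟨i.succ, b⟩ =
        (Pi.single q 1 : (i : Fin r) × Fin (n i.succ) → F) ⟨i, b⟩
    obtain ⟨j, c⟩ := q
    by_cases h : (⟨i, b⟩ : (i : Fin r) × Fin (n i.succ)) = ⟨j, c⟩
    · obtain ⟨rfl, h⟩ := Sigma.mk.inj_iff.1 h
      obtain rfl := eq_of_heq h
      simp
    · rw [Pi.single_eq_of_ne h, Pi.single_eq_of_ne]
      intro h'
      obtain ⟨h1, h2⟩ := Sigma.mk.inj_iff.1 h'
      obtain rfl := Fin.succ_injective _ h1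
      obtain rfl := eq_of_heq h2
      exact h rfl

theorem toMatrix_conj_consBlockEquiv_zero (x : (i : Fin (r + 1)) × Fin (n i)) (a : Fin (n 0)) :
    LinearMap.toMatrix' ((consBlockEquiv F n).conj g) x ⟨0, a⟩ =
      consBlockEquiv F n (g (Pi.single a 1, 0)) x := by
  rw [LinearMap.toMatrix'_apply, LinearEquiv.conj_apply_apply, ← consBlockEquiv_symm_single_zero]

theorem toMatrix_conj_consBlockEquiv_succ (x : (i : Fin (r + 1)) × Fin (n i))
    (q : (i : Fin r) × Fin (n i.succ)) :
    LinearMap.toMatrix' ((consBlockEquiv F n).conj g) x ⟨q.1.succ, q.2⟩ =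
      consBlockEquiv F n (g (0, Pi.single q 1)) x := by
  rw [LinearMap.toMatrix'_apply, LinearEquiv.conj_apply_apply, ← consBlockEquiv_symm_single_succ]

theorem blockTriangular_conj_consBlockEquiv :
    (LinearMap.toMatrix' ((consBlockEquiv F n).conj g)).BlockTriangular Sigma.fst ↔
      (∀ x, (g (x, 0)).2 = 0) ∧ (LinearMap.toMatrix' (LinearMap.snd F _ _ ∘ₗ g ∘ₗ
        LinearMap.inr F _ _)).BlockTriangular (Sigma.fst : (i : Fin r) × Fin (n i.succ) → Fin r) := by
  constructor
  · intro h
    refine ⟨fun x => ?_, ?_⟩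
    · have : LinearMap.snd F _ _ ∘ₗ g ∘ₗ LinearMap.inl F _ _ = 0 := by
        refine LinearMap.pi_ext' fun a => LinearMap.ext_ring (funext fun q => ?_)
        have := h (i := ⟨q.1.succ, q.2⟩) (j := ⟨0, a⟩) (Fin.succ_pos _)
        rwa [toMatrix_conj_consBlockEquiv_zero] at this
      exact LinearMap.congr_fun this x
    · intro p q hpq
      have := h (i := ⟨p.1.succ, p.2⟩) (j := ⟨q.1.succ, q.2⟩) (Fin.succ_lt_succ_iff.2 hpq)
      rw [toMatrix_conj_consBlockEquiv_succ] at this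
      rw [LinearMap.toMatrix'_apply]
      exact this
  · rintro ⟨h1, h2⟩ ⟨i, a⟩ ⟨j, b⟩ hij
    revert a b hij
    refine Fin.cases (fun a => ?_) (fun i a => ?_) i
    · intro b hij
      exact absurd hij (Fin.not_lt_zero _)
    · refine Fin.cases (fun b _ => ?_) (fun j b hij => ?_) j
      · rw [toMatrix_conj_consBlockEquiv_zero]
        exact congrFun (h1 _) ⟨i, a⟩
      · rw [toMatrix_conj_consBlockEquiv_succ n g _ ⟨j, b⟩]
        have := h2 (i := ⟨i, a⟩) (j := ⟨j, b⟩) (Fin.succ_lt_succ_iff.1 hij)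
        rw [LinearMap.toMatrix'_apply] at this
        exact this

open Classical in
-- Splitting off the first block matches the recursion of the iterated Hall product.
theorem parabolicTerm_conj_consBlockEquiv (f : Fin (r + 1) → EndFun F) :
    parabolicTerm n f (LinearMap.toMatrix' ((consBlockEquiv F n).conj g)) =
      if ∀ x, (g (x, 0)).2 = 0 then
        f 0 (Fin (n 0) → F) (LinearMap.fst F _ _ ∘ₗ g ∘ₗ LinearMap.inl F _ _) *
          parabolicTerm (fun i => n (Fin.succ i)) (fun i => f i.succ)
            (LinearMap.toMatrix' (LinearMap.snd F _ _ ∘ₗ g ∘ₗ LinearMap.inr F _ _))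
      else 0 := by
  rw [parabolicTerm, parabolicTerm]
  have key := blockTriangular_conj_consBlockEquiv n g
  by_cases h1 : ∀ x, (g (x, 0)).2 = 0
  · by_cases h2 : (LinearMap.toMatrix' (LinearMap.snd F _ _ ∘ₗ g ∘ₗ
        LinearMap.inr F _ _)).BlockTriangular (Sigma.fst : (i : Fin r) × Fin (n i.succ) → Fin r)
    · rw [if_pos (key.2 ⟨h1, h2⟩), if_pos h1, if_pos h2, Fin.prod_univ_succ]
      congr 1
      · congr 1
        refine LinearMap.pi_ext' fun a => LinearMap.ext_ring (funext fun b => ?_)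
        rw [LinearMap.comp_apply, LinearMap.single_apply, Matrix.mulVecLin_apply,
          Matrix.mulVec_single_one]
        exact toMatrix_conj_consBlockEquiv_zero n g ⟨0, b⟩ a
      · refine Finset.prod_congr rfl fun i _ => ?_
        congr 2
        ext a b
        rw [Matrix.blockDiag'_apply, Matrix.blockDiag'_apply]
        refine (toMatrix_conj_consBlockEquiv_succ n g ⟨i.succ, a⟩ ⟨i, b⟩).trans ?_
        rw [LinearMap.toMatrix'_apply]
        rfl
    · rw [if_neg (fun h => h2 (key.1 h).2), if_pos h1, if_neg h2, mul_zero]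
  · rw [if_neg (fun h => h1 (key.1 h).1), if_neg h1]

end ParabolicTerm

section Sum

variable [Finite F] {r : ℕ}

theorem card_blockTriangular_succ (n : Fin (r + 1) → ℕ) :
    Nat.card {w : ((i : Fin (r + 1)) × Fin (n i) → F) ≃ₗ[F] ((i : Fin (r + 1)) × Fin (n i) → F) //
      (LinearMap.toMatrix' (w : ((i : Fin (r + 1)) × Fin (n i) → F) →ₗ[F] _)).BlockTriangular
        Sigma.fst} =
    Nat.card ((Fin (n 0) → F) ≃ₗ[F] (Fin (n 0) → F)) *
      Nat.card (((i : Fin r) × Fin (n i.succ) → F) →ₗ[F] (Fin (n 0) → F)) *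
      Nat.card {w : ((i : Fin r) × Fin (n i.succ) → F) ≃ₗ[F] ((i : Fin r) × Fin (n i.succ) → F) //
      (LinearMap.toMatrix' (w : ((i : Fin r) × Fin (n i.succ) → F) →ₗ[F] _)).BlockTriangular
        Sigma.fst} := by
  rw [← Nat.card_prod, ← Nat.card_prod]
  symm
  let E := consBlockEquiv F n
  have hE : ∀ e : ((Fin (n 0) → F) × ((i : Fin r) × Fin (n i.succ) → F)) ≃ₗ[F] _,
      (((E.symm.trans e).trans E : _ ≃ₗ[F] _) : _ →ₗ[F] _) = E.conj (e : _ →ₗ[F] _) :=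
    fun _ => rfl
  refine Nat.card_eq_of_bijective (fun t => ⟨(E.symm.trans (blkEquiv t.1.1 t.1.2 t.2.1)).trans E,
    ?_⟩) ⟨?_, ?_⟩
  · rw [hE, blockTriangular_conj_consBlockEquiv, snd_comp_blkEquiv_comp_inr]
    exact ⟨fun x => by simp [blkEquiv_apply], t.2.2⟩
  · rintro ⟨⟨a, u⟩, b⟩ ⟨⟨a', u'⟩, b'⟩ h
    have h' : blkEquiv a u b.1 = blkEquiv a' u' b'.1 := by
      refine LinearEquiv.ext fun p => ?_
      have := LinearEquiv.congr_fun (congrArg Subtype.val h) (E p)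
      simpa using this
    obtain ⟨h1, h2, h3⟩ := blkEquiv_inj h'
    exact Prod.ext (Prod.ext h1 h2) (Subtype.ext h3)
  · rintro ⟨w, hw⟩
    have hw' : (E.symm.trans ((E.trans w).trans E.symm)).trans E = w := by
      refine LinearEquiv.ext fun p => ?_
      simp
    rw [← hw', hE, blockTriangular_conj_consBlockEquiv] at hw
    obtain ⟨a, u, b, h⟩ := exists_blkEquiv_eq hw.1
    refine ⟨((a, u), ⟨b, ?_⟩), Subtype.ext ?_⟩
    · rw [← snd_comp_blkEquiv_comp_inr a u b, h]
      exact hw.2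
    · dsimp only
      rw [h, hw']

omit [Finite F] in
theorem hallProd_map {ι κ : Type*} (f : κ → EndFun F) (s : ι → κ) (l : List ι) :
    hallProd f (l.map s) = hallProd (fun i => f (s i)) l := by
  induction l with
  | nil => rfl
  | cons i l ih => rw [List.map_cons, hallProd, hallProd, ih]

open Classical in
-- The sum over the whole group in the induced character formula gives the iterated Hall product
-- times the order of the parabolic subgroup, by induction on the number of blocks.
theorem sum_parabolicTerm_conj (n : Fin r → ℕ) {f : Fin r → EndFun F} (hf : ∀ i, IsInv (f i))
    (hd : ∀ i, HasDegree (n i) (f i))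
    (g : ((i : Fin r) × Fin (n i) → F) →ₗ[F] ((i : Fin r) × Fin (n i) → F)) :
    ∑ w : ((i : Fin r) × Fin (n i) → F) ≃ₗ[F] ((i : Fin r) × Fin (n i) → F),
        parabolicTerm n f (LinearMap.toMatrix' (w.conj g)) =
      Nat.card {w : ((i : Fin r) × Fin (n i) → F) ≃ₗ[F] ((i : Fin r) × Fin (n i) → F) //
        (LinearMap.toMatrix' (w : ((i : Fin r) × Fin (n i) → F) →ₗ[F] _)).BlockTriangular
          Sigma.fst} *
      hallProd f (List.finRange r) ((i : Fin r) × Fin (n i) → F) g := by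
  induction r with
  | zero =>
    rw [Fintype.sum_subsingleton _ (LinearEquiv.refl F _), Nat.card_of_subsingleton
      ⟨LinearEquiv.refl F _, fun i => i.1.elim0⟩, parabolicTerm,
      if_pos (by intro i; exact i.1.elim0)]
    simp [hallProd, hallOne, Module.finrank_zero_of_subsingleton]
  | succ r ih =>
    let E := consBlockEquiv F n
    let A := Fin (n 0) → F
    let B := (i : Fin r) × Fin (n i.succ) → F
    let T : ((A × B) →ₗ[F] (A × B)) → ℂ := fun h =>
      parabolicTerm n f (LinearMap.toMatrix' (E.conj h))
    let H := hallProd (fun i => f (Fin.succ i)) (List.finRange r)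
    have hH : IsInv H := isInv_hallProd (fun i => hf _) _
    let c : ℕ := Nat.card {w : B ≃ₗ[F] B //
      (LinearMap.toMatrix' (w : B →ₗ[F] B)).BlockTriangular Sigma.fst}
    have hinner : ∀ h : (A × B) →ₗ[F] (A × B),
        ∑ z : B ≃ₗ[F] B, T (((LinearEquiv.refl F A).prodCongr z).conj h) =
          c * hallTerm (f 0) H (A × B) h (LinearMap.inl F A B).range := by
      intro h
      rw [hallTerm_range_inl (hf 0) hH]
      have h1 : ∀ z : B ≃ₗ[F] B, T (((LinearEquiv.refl F A).prodCongr z).conj h) =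
          if ∀ x, (h (x, 0)).2 = 0 then
            f 0 A (LinearMap.fst F A B ∘ₗ h ∘ₗ LinearMap.inl F A B) *
              parabolicTerm (fun i => n (Fin.succ i)) (fun i => f i.succ)
              (LinearMap.toMatrix' (z.conj (LinearMap.snd F A B ∘ₗ h ∘ₗ LinearMap.inr F A B)))
          else 0 := by
        intro z
        refine (parabolicTerm_conj_consBlockEquiv n _ f).trans ?_
        refine if_congr ?_ ?_ rfl
        · refine forall_congr' fun x => ?_
          simp [LinearEquiv.conj_apply]
        · congr 2
          refine LinearMap.ext fun x => ?_
          simp [LinearEquiv.conj_apply]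
          rfl
      simp_rw [h1]
      split_ifs with h0
      · rw [← Finset.mul_sum, ih (fun i => n (Fin.succ i)) (fun i => hf _) (fun i => hd _)]
        ring
      · simp
    have hB : (Fintype.card (B ≃ₗ[F] B) : ℂ) ≠ 0 := by exact_mod_cast Fintype.card_ne_zero
    -- The factor `|GL(B)|` pays for an extra sum over conjugations by `diag(1, z)`, to which the
    -- induction hypothesis applies.
    refine mul_left_cancel₀ hB ?_
    have h2 : ∑ w : ((i : Fin (r + 1)) × Fin (n i) → F) ≃ₗ[F] _,
        parabolicTerm n f (LinearMap.toMatrix' (w.conj g)) =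
        ∑ e : (A × B) ≃ₗ[F] (A × B), T (e.conj (E.symm.conj g)) := by
      symm
      refine Fintype.sum_equiv ⟨fun e => (E.symm.trans e).trans E,
        fun w => (E.trans w).trans E.symm, fun e => ?_, fun w => ?_⟩ _ _ fun e => ?_
      · refine LinearEquiv.ext fun x => ?_
        simp
      · refine LinearEquiv.ext fun x => ?_
        simp
      · rfl
    have h3 : ∀ z : B ≃ₗ[F] B, ∑ e : (A × B) ≃ₗ[F] (A × B), T (e.conj (E.symm.conj g)) =
        ∑ e : (A × B) ≃ₗ[F] (A × B),
          T (((LinearEquiv.refl F A).prodCongr z).conj (e.conj (E.symm.conj g))) := by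
      intro z
      symm
      exact Fintype.sum_equiv (Equiv.mulLeft ((LinearEquiv.refl F A).prodCongr z)) _ _ fun e => rfl
    rw [h2, ← nsmul_eq_mul, ← Finset.card_univ, ← Finset.sum_const,
      Finset.sum_congr rfl fun z _ => h3 z, Finset.sum_comm,
      Finset.sum_congr rfl fun e _ => hinner _, ← Finset.mul_sum]
    have h4 : ∑ e : (A × B) ≃ₗ[F] (A × B),
        hallTerm (f 0) H (A × B) (e.conj (E.symm.conj g)) (LinearMap.inl F A B).range =
        ∑ e : (A × B) ≃ₗ[F] (A × B),
        hallTerm (f 0) H (A × B) (e.symm.conj (E.symm.conj g)) (LinearMap.inl F A B).range :=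
      (Fintype.sum_equiv (Equiv.inv _) _ _ fun e => rfl).symm
    rw [h4, sum_hallTerm_conj (hf 0) hH (by rw [Module.finrank_fin_fun]; exact hd 0), card_blockTriangular_succ,
      List.finRange_succ, hallProd, hallProd_map,
      ((hf 0).hall hH) E _ g fun v => by simp [LinearEquiv.conj_apply]]
    have hc : c = Fintype.card {w : B ≃ₗ[F] B //
      (LinearMap.toMatrix' (w : B →ₗ[F] B)).BlockTriangular Sigma.fst} := Nat.card_eq_fintype_card
    simp only [Nat.card_eq_fintype_card, Finset.card_univ]
    rw [hc]
    push_cast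
    simp only [A, B, H]
    ring

end Sum

end

end FiniteGL

/-! ### Characters of parabolically induced representations. -/

namespace FiniteGL

universe u

section

section Trace

theorem trace_piTensorProduct_map {ι : Type*} [Fintype ι] {V : ι → Type*}
    [∀ i, AddCommGroup (V i)] [∀ i, Module ℂ (V i)] [∀ i, FiniteDimensional ℂ (V i)]
    (f : ∀ i, V i →ₗ[ℂ] V i) :
    LinearMap.trace ℂ _ (PiTensorProduct.map f) = ∏ i, LinearMap.trace ℂ _ (f i) := by
  classical
  let b := fun i => Module.finBasis ℂ (V i)
  rw [LinearMap.trace_eq_matrix_trace ℂ (Basis.piTensorProduct b)]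
  simp_rw [fun i => LinearMap.trace_eq_matrix_trace ℂ (b i) (f i), Matrix.trace]
  rw [Finset.prod_univ_sum, Fintype.piFinset_univ]
  refine Finset.sum_congr rfl fun p _ => ?_
  rw [Matrix.diag_apply, LinearMap.toMatrix_apply, Basis.piTensorProduct_apply,
    PiTensorProduct.map_tprod, Basis.piTensorProduct_repr_tprod_apply]
  exact Finset.prod_congr rfl fun i _ => by rw [Matrix.diag_apply, LinearMap.toMatrix_apply]

variable {G X : Type*} [Group G] [Finite G] [AddCommGroup X] [Module ℂ X] [FiniteDimensional ℂ X]

instance (H : Subgroup G) (σ : Representation ℂ H X) :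
    FiniteDimensional ℂ (Representation.coindV H.subtype σ) :=
  inferInstanceAs (FiniteDimensional ℂ (_ : Submodule ℂ (G → X)))

open Classical in
/-- The formula for the character of an induced representation. -/
theorem character_coind [Fintype G] (H : Subgroup G) (σ : Representation ℂ H X) (g : G) :
    (Representation.coind H.subtype σ).character g =
      (Nat.card H : ℂ)⁻¹ * ∑ x : G, if h : x * g * x⁻¹ ∈ H then σ.character ⟨_, h⟩ else 0 := by
  have hH : (Nat.card H : ℂ) ≠ 0 := by exact_mod_cast Nat.card_pos.ne'
  -- The induced space is the image of the averaging projector `q` on all functions `G → X`. Its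
  -- character is therefore the trace of right translation composed with `q`, which splits over the
  -- points of `G`.
  let i : Representation.coindV H.subtype σ →ₗ[ℂ] (G → X) := Submodule.subtype _
  let q : (G → X) →ₗ[ℂ] (G → X) := (Nat.card H : ℂ)⁻¹ • ∑ h : H, LinearMap.pi fun x =>
    σ h ∘ₗ LinearMap.proj ((h : G)⁻¹ * x)
  have hq : ∀ f x, q f x = (Nat.card H : ℂ)⁻¹ • ∑ h : H, σ h (f ((h : G)⁻¹ * x)) := by
    intro f x
    simp [q]
  let p : (G → X) →ₗ[ℂ] Representation.coindV H.subtype σ := q.codRestrict _ fun f => by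
    intro h x
    rw [hq, hq, map_smul, map_sum]
    congr 1
    refine Fintype.sum_equiv (Equiv.mulLeft h⁻¹) _ _ fun k => ?_
    rw [← Module.End.mul_apply, ← map_mul]
    simp [mul_assoc]
  have hpi : p ∘ₗ i = LinearMap.id := by
    refine LinearMap.ext fun f => Subtype.ext (funext fun x => ?_)
    change q f.1 x = f.1 x
    rw [hq, Finset.sum_congr rfl fun h _ => ?_, Finset.sum_const, Finset.card_univ,
      ← Nat.card_eq_fintype_card, ← Nat.cast_smul_eq_nsmul ℂ, smul_smul, inv_mul_cancel₀ hH,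
      one_smul]
    have := f.2 h ((h : G)⁻¹ * x)
    rw [Subgroup.subtype_apply, mul_inv_cancel_left] at this
    exact this.symm
  let R : (G → X) →ₗ[ℂ] (G → X) := LinearMap.funLeft ℂ X (· * g)
  have hR : R ∘ₗ i = i ∘ₗ Representation.coind H.subtype σ g := by
    refine LinearMap.ext fun f => rfl
  have h1 : (Representation.coind H.subtype σ).character g = LinearMap.trace ℂ _ (R ∘ₗ q) := by
    have : q = i ∘ₗ p := rfl
    rw [this, ← LinearMap.comp_assoc, hR, LinearMap.trace_comp_comm', ← LinearMap.comp_assoc, hpi]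
    rfl
  have h2 : R ∘ₗ q = (Nat.card H : ℂ)⁻¹ • ∑ x : G, ∑ h : H,
      (LinearMap.single ℂ (fun _ : G => X) x ∘ₗ σ h) ∘ₗ
        LinearMap.proj (φ := fun _ : G => X) ((h : G)⁻¹ * (x * g)) := by
    refine LinearMap.ext fun f => funext fun y => ?_
    change q f (y * g) = _
    rw [hq, LinearMap.smul_apply, Pi.smul_apply]
    congr 1
    rw [LinearMap.sum_apply, Finset.sum_apply, Finset.sum_eq_single y]
    · simp
    · intro x _ hx
      simp [Pi.single_eq_of_ne hx.symm]
    · simp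
  rw [h1, h2, map_smul, map_sum, smul_eq_mul]
  congr 1
  refine Finset.sum_congr rfl fun x _ => ?_
  have h3 : ∀ h : H, LinearMap.trace ℂ _ ((LinearMap.single ℂ (fun _ : G => X) x ∘ₗ σ h) ∘ₗ
      LinearMap.proj (φ := fun _ : G => X) ((h : G)⁻¹ * (x * g))) =
      if x * g * x⁻¹ = h then σ.character h else 0 := by
    intro h
    rw [LinearMap.comp_assoc, LinearMap.trace_comp_comm', LinearMap.comp_assoc]
    split_ifs with hx
    · have : (h : G)⁻¹ * (x * g) = x := by rw [← hx]; group
      rw [this]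
      have : LinearMap.proj (φ := fun _ : G => X) x ∘ₗ LinearMap.single ℂ (fun _ : G => X) x =
          LinearMap.id := by
        refine LinearMap.ext fun v => ?_
        simp
      rw [this, LinearMap.comp_id]
      rfl
    · have : LinearMap.proj (φ := fun _ : G => X) ((h : G)⁻¹ * (x * g)) ∘ₗ
          LinearMap.single ℂ (fun _ : G => X) x = 0 := by
        refine LinearMap.ext fun v => ?_
        have hne : (h : G)⁻¹ * (x * g) ≠ x := by
          intro h'
          exact hx (by rw [mul_inv_eq_iff_eq_mul, ← inv_mul_eq_iff_eq_mul, h'])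
        simp [Pi.single_eq_of_ne hne]
      rw [this, LinearMap.comp_zero, map_zero]
  rw [map_sum, Finset.sum_congr rfl fun h _ => h3 h]
  split_ifs with hx
  · rw [Finset.sum_eq_single ⟨_, hx⟩]
    · simp
    · intro h _ hne
      rw [if_neg]
      intro h'
      exact hne (Subtype.ext h'.symm)
    · simp
  · refine Finset.sum_eq_zero fun h _ => if_neg ?_
    intro h'
    exact hx (h' ▸ h.2)

end Trace

variable {F : Type u} [Field F] [Finite F] {r : ℕ} {n : Fin r → ℕ}

omit [Finite F] in
theorem glOf_refl {ι : Type*} [Fintype ι] [DecidableEq ι] (w : (ι → F) ≃ₗ[F] (ι → F)) :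
    (glOf (LinearEquiv.refl F _) w).val = LinearMap.toMatrix' (w : (ι → F) →ₗ[F] (ι → F)) :=
  Matrix.ext_of_mulVec_single fun i => by
    rw [LinearMap.toMatrix'_mulVec]
    exact glOf_mulVec (LinearEquiv.refl F _) w _

omit [Finite F] in
open Classical in
theorem parabolicTerm_toEndFun {χ : ∀ i, GL (Fin (n i)) F → ℂ}
    (hχ : ∀ i x y, χ i (y * x * y⁻¹) = χ i x) (y : GL ((i : Fin r) × Fin (n i)) F) :
    parabolicTerm n (fun i => toEndFun (χ i)) y.val =
      if h : y ∈ parabolic F n then ∏ i, χ i (leviProj F n i ⟨y, h⟩) else 0 := by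
  rw [parabolicTerm]
  split_ifs with h h' h'
  · refine Finset.prod_congr rfl fun i _ => ?_
    exact toEndFun_eq (hχ i) (LinearEquiv.refl F _) fun v => rfl
  · exact absurd h h'
  · exact absurd h' h
  · rfl

instance : Finite (GL ((i : Fin r) × Fin (n i)) F) := Finite.of_injective _ Units.val_injective

omit [Finite F] in
theorem card_blockTriangular :
    Nat.card {w : ((i : Fin r) × Fin (n i) → F) ≃ₗ[F] ((i : Fin r) × Fin (n i) → F) //
      (LinearMap.toMatrix' (w : ((i : Fin r) × Fin (n i) → F) →ₗ[F] _)).BlockTriangular Sigma.fst} =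
    Nat.card (parabolic F n) := by
  refine Nat.card_congr ((glOf (LinearEquiv.refl F _)).toEquiv.subtypeEquiv fun w => ?_)
  rw [← glOf_refl]
  rfl

open Classical in
theorem sum_parabolic_eq_hallProd [Fintype (GL ((i : Fin r) × Fin (n i)) F)]
    {χ : ∀ i, GL (Fin (n i)) F → ℂ}
    (hχ : ∀ i x y, χ i (y * x * y⁻¹) = χ i x) (g : GL ((i : Fin r) × Fin (n i)) F) :
    (Nat.card (parabolic F n) : ℂ)⁻¹ * ∑ x : GL ((i : Fin r) × Fin (n i)) F,
      (if h : x * g * x⁻¹ ∈ parabolic F n then ∏ i, χ i (leviProj F n i ⟨_, h⟩) else 0) =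
    hallProd (fun i => toEndFun (χ i)) (List.finRange r) ((i : Fin r) × Fin (n i) → F)
      (Matrix.mulVecLin g.val) := by
  have hP : (Nat.card (parabolic F n) : ℂ) ≠ 0 := by exact_mod_cast Nat.card_pos.ne'
  rw [inv_mul_eq_iff_eq_mul₀ hP, ← card_blockTriangular,
    ← sum_parabolicTerm_conj n (fun i => isInv_toEndFun (hχ i)) fun i => hasDegree_toEndFun]
  symm
  refine Fintype.sum_equiv (glOf (LinearEquiv.refl F _)).toEquiv _ _ fun w => ?_
  rw [← parabolicTerm_toEndFun hχ]
  congr 1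
  rw [MulEquiv.toEquiv_eq_coe, EquivLike.coe_coe, ← map_inv, Units.val_mul, Units.val_mul,
    glOf_refl, glOf_refl, LinearEquiv.conj_apply, LinearMap.toMatrix'_comp,
    LinearMap.toMatrix'_comp, ← Matrix.toLin'_apply',
    LinearMap.toMatrix'_toLin']
  rfl

omit [Finite F] in
theorem mulVec_reindexGL {ι κ : Type*} [Fintype ι] [DecidableEq ι] [Fintype κ] [DecidableEq κ]
    (e : ι ≃ κ) (g : GL ι F) (v : κ → F) :
    LinearEquiv.funCongrLeft F F e ((reindexGL F e g).val.mulVec v) =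
      g.val.mulVec (LinearEquiv.funCongrLeft F F e v) := by
  funext i
  change (Matrix.reindex e e g.val).mulVec v (e i) = g.val.mulVec (v ∘ e) i
  simp [Matrix.mulVec, dotProduct, ← e.sum_comp]

section Induction

variable {N : ℕ} (h : ∑ i, n i = N) {V : Fin r → Type*} [∀ i, AddCommGroup (V i)]
  [∀ i, Module ℂ (V i)] [∀ i, FiniteDimensional ℂ (V i)]
  (π : ∀ i, Representation ℂ (GL (Fin (n i)) F) (V i))

omit [Finite F] in
theorem character_leviRep (p : parabolic F n) :
    (leviRep π).character p = ∏ i, (π i).character (leviProj F n i p) :=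
  trace_piTensorProduct_map fun i => π i (leviProj F n i p)

omit [Finite F] in
theorem hallProd_reindexGL {f : Fin r → EndFun F} (hf : ∀ i, IsInv (f i)) (g : GL (Fin N) F) :
    hallProd f (List.finRange r) ((i : Fin r) × Fin (n i) → F)
      (Matrix.mulVecLin
        (reindexGL F (finSigmaFinEquiv.trans (finCongr h)).symm g).val) =
    hallProd f (List.finRange r) (Fin N → F) (Matrix.mulVecLin g.val) :=
  isInv_hallProd hf _ (LinearEquiv.funCongrLeft F F (finSigmaFinEquiv.trans (finCongr h)).symm)
    _ _ fun _ => mulVec_reindexGL _ _ _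

/-- The character of a parabolically induced representation is a Hall product. -/
theorem character_parabolicInduction (g : GL (Fin N) F) :
    (parabolicInduction h π).character g =
      hallProd (fun i => toEndFun (π i).character) (List.finRange r) (Fin N → F)
        (Matrix.mulVecLin g.val) := by
  classical
  have := Fintype.ofFinite (GL ((i : Fin r) × Fin (n i)) F)
  have hc : ∀ i x y, (π i).character (y * x * y⁻¹) = (π i).character x :=
    fun i x y => (π i).char_conj x y
  rw [← hallProd_reindexGL h (fun i => isInv_toEndFun (hc i)), ← sum_parabolic_eq_hallProd hc]
  simp_rw [← character_leviRep]
  exact character_coind _ _ _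

/-- Inversion commutes with conjugation and with the Levi projections, so it can be moved onto the
inducing characters. This brings the duals into the Hom formula. -/
theorem character_parabolicInduction_inv (g : GL (Fin N) F) :
    (parabolicInduction h π).character g⁻¹ =
      hallProd (fun i => toEndFun (π i).dual.character) (List.finRange r) (Fin N → F)
        (Matrix.mulVecLin g.val) := by
  classical
  have := Fintype.ofFinite (GL ((i : Fin r) × Fin (n i)) F)
  have hc : ∀ i x y, (π i).character (y * x * y⁻¹) = (π i).character x :=
    fun i x y => (π i).char_conj x y
  have hd : ∀ i x y, (π i).dual.character (y * x * y⁻¹) = (π i).dual.character x :=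
    fun i x y => (π i).dual.char_conj x y
  rw [character_parabolicInduction, ← hallProd_reindexGL h (fun i => isInv_toEndFun (hc i)),
    ← hallProd_reindexGL h (fun i => isInv_toEndFun (hd i)), ← sum_parabolic_eq_hallProd hc,
    ← sum_parabolic_eq_hallProd hd, map_inv]
  congr 1
  refine Finset.sum_congr rfl fun x _ => ?_
  have hx : ∀ y : GL ((i : Fin r) × Fin (n i)) F, x * y⁻¹ * x⁻¹ = (x * y * x⁻¹)⁻¹ := by
    intro y; group
  simp only [hx, inv_mem_iff]
  split_ifs with hm
  · refine Finset.prod_congr rfl fun i _ => ?_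
    rw [Representation.char_dual]
    exact congrArg (π i).character (map_inv (leviProj F n i) ⟨_, hm⟩)
  · rfl

end Induction

end

end FiniteGL

/-! ### From characters back to representations. -/

namespace FiniteGL

universe u

section

/-- By Maschke a submodule has a complement; the projection onto it is a scalar, so the submodule is
zero or everything. -/
theorem isIrreducible_of_finrank_eq_one {G V : Type*} [Group G] [Finite G] [AddCommGroup V]
    [Module ℂ V] (ρ : Representation ℂ G V)
    (h : Module.finrank ℂ (Representation.IntertwiningMap ρ ρ) = 1) : ρ.IsIrreducible := by
  have : NeZero (Nat.card G : ℂ) := ⟨by exact_mod_cast Nat.card_pos.ne'⟩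
  rw [Representation.irreducible_iff_isSimpleModule_asModule, isSimpleModule_iff]
  let R := MonoidAlgebra ℂ G
  let M := ρ.asModule
  have h1 : Module.finrank ℂ (Module.End R M) = 1 := by
    rw [← h]
    exact ((Representation.IntertwiningMap.equivAlgEnd ρ).toLinearEquiv.finrank_eq).symm
  have hE : Nontrivial (Module.End R M) := Module.nontrivial_of_finrank_pos (R := ℂ) (by omega)
  have hM : Nontrivial M := by
    by_contra hM
    rw [not_nontrivial_iff_subsingleton] at hM
    exact not_subsingleton (Module.End R M) inferInstance
  rw [finrank_eq_one_iff_of_nonzero' 1 one_ne_zero] at h1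
  refine ⟨fun p => ?_⟩
  obtain ⟨q, hpq⟩ := exists_isCompl p
  obtain ⟨c, hc⟩ := h1 (Submodule.projection p q hpq)
  by_cases h0 : c = 0
  · left
    rw [← Submodule.range_projection hpq, ← hc, h0, zero_smul]
    exact LinearMap.range_zero
  · right
    have hq : q = ⊥ := by
      rw [← Submodule.ker_projection hpq, ← hc, LinearMap.ker_eq_bot']
      intro v hv
      have hv' : c • v = 0 := hv
      exact (smul_eq_zero.1 hv').resolve_left h0
    rw [hq] at hpq
    exact hpq.sup_eq_top ▸ (sup_bot_eq p).symm

end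

section SameRep

variable {F : Type*} [Field F] {a b c : ℕ} {U V W : Type*} [AddCommGroup U] [Module ℂ U]
  [AddCommGroup V] [Module ℂ V] [AddCommGroup W] [Module ℂ W]
  {ρ : Representation ℂ (GL (Fin a) F) U} {σ : Representation ℂ (GL (Fin b) F) V}
  {τ : Representation ℂ (GL (Fin c) F) W}

theorem sameRep_iff_nonempty_equiv {σ : Representation ℂ (GL (Fin a) F) V} :
    SameRep ρ σ ↔ Nonempty (ρ.Equiv σ) :=
  ⟨fun ⟨_, h⟩ => h, fun h => ⟨rfl, h⟩⟩

theorem SameRep.symm (h : SameRep ρ σ) : SameRep σ ρ := by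
  obtain rfl := h.1
  rw [sameRep_iff_nonempty_equiv] at h ⊢
  exact h.map fun e => e.symm

theorem SameRep.trans (h : SameRep ρ σ) (h' : SameRep σ τ) : SameRep ρ τ := by
  obtain rfl := h.1
  obtain rfl := h'.1
  rw [sameRep_iff_nonempty_equiv] at h h' ⊢
  exact ⟨h.some.trans h'.some⟩

end SameRep

section

variable {F : Type u} [Field F] [Finite F]

open Classical in
-- Schur orthogonality when the sizes agree; otherwise the two functions live in different degrees.
theorem pairing_character_eq {a b : ℕ} {V W : Type*} [AddCommGroup V] [Module ℂ V]
    [AddCommGroup W] [Module ℂ W] {ρ : Representation ℂ (GL (Fin a) F) V}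
    {σ : Representation ℂ (GL (Fin b) F) W} (hρ : ρ.IsIrreducible) (hσ : σ.IsIrreducible) :
    pairing a (toEndFun ρ.character) (toEndFun σ.dual.character) =
      if SameRep ρ σ then 1 else 0 := by
  by_cases hab : a = b
  · subst hab
    have := Fintype.ofFinite (GL (Fin a) F)
    have := finiteDimensional_of_isIrreducible hρ
    have := finiteDimensional_of_isIrreducible hσ
    have : Invertible (Nat.card (GL (Fin a) F) : ℂ) := invertibleOfNonzero (card_GL_ne_zero a)
    rw [pairing_toEndFun (fun x y => ρ.char_conj x y) fun x y => σ.dual.char_conj x y]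
    simp_rw [Representation.char_dual]
    rw [Representation.char_orthonormal]
    refine if_congr ?_ rfl rfl
    rw [sameRep_iff_nonempty_equiv]
    exact ⟨fun h => h.map fun e => e.symm, fun h => h.map fun e => e.symm⟩
  · rw [pairing_eq_zero_of_right _ hasDegree_toEndFun hab, if_neg fun h => hab h.1]

omit [Finite F] in
-- An endomorphism injective on `U` and on the quotient is injective. Hence sums over endomorphisms
-- are sums over `GL_N`.
theorem hallProd_toEndFun_eq_zero {ι : Type*} {n : ι → ℕ} (χ : ∀ i, GL (Fin (n i)) F → ℂ)
    (l : List ι) {V : Type u} [AddCommGroup V] [Module F V] [Finite V] {g : V →ₗ[F] V}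
    (hg : ¬ Function.Injective g) : hallProd (fun i => toEndFun (χ i)) l V g = 0 := by
  induction l generalizing V with
  | nil =>
    refine if_neg fun h => hg ?_
    have := Module.finrank_zero_iff.1 h
    exact Function.injective_of_subsingleton g
  | cons i l ih =>
    rw [hallProd, hall, finsum_eq_zero_of_forall_eq_zero]
    intro U
    rw [hallTerm]
    split_ifs with hU
    · by_cases h1 : Function.Injective (g.restrict hU)
      · rw [ih, mul_zero]
        intro h2
        refine hg ((injective_iff_map_eq_zero g).2 fun v hv => ?_)
        have h3 : U.mkQ v = 0 := (injective_iff_map_eq_zero _).1 h2 _ (by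
          rw [Submodule.mkQ_apply, Submodule.mapQ_apply, hv, Submodule.Quotient.mk_zero])
        have h4 : v ∈ U := (Submodule.Quotient.mk_eq_zero U).1 h3
        have h5 := (injective_iff_map_eq_zero _).1 h1 ⟨v, h4⟩ (Subtype.ext hv)
        exact congrArg Subtype.val h5
      · rw [toEndFun_eq_zero fun h => h1 h.1, zero_mul]
    · rfl

theorem sum_GL_eq {N : ℕ} [Fintype (GL (Fin N) F)] (φ : ((Fin N → F) →ₗ[F] (Fin N → F)) → ℂ)
    (hφ : ∀ g : (Fin N → F) →ₗ[F] (Fin N → F), ¬ Function.Injective g → φ g = 0) :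
    ∑ x : GL (Fin N) F, φ (Matrix.mulVecLin x.val) = ∑ g, φ g := by
  refine Fintype.sum_of_injective (fun x : GL (Fin N) F => Matrix.mulVecLin x.val) ?_ _ _ ?_
    fun _ => rfl
  · exact fun x y h => GL_ext_mulVec fun v => LinearMap.congr_fun h v
  · intro g hg
    refine hφ g fun hi => hg ?_
    let e := LinearEquiv.ofBijective g ⟨hi, Finite.surjective_of_injective hi⟩
    refine ⟨glOf (LinearEquiv.refl F _) e, LinearMap.ext fun v => ?_⟩
    exact glOf_mulVec (LinearEquiv.refl F _) e v

omit [Finite F] in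
theorem snocEquiv_blk {N : ℕ} (g : GL (Fin N) F) (p : (Fin N → F) × F) :
    snocEquiv F N (blk (Matrix.mulVecLin g.val) 0 LinearMap.id p) =
      Matrix.mulVecLin (embedGL F N g).val (snocEquiv F N p) := by
  have h : (embedGL F N g).val = Matrix.reindex finSumFinEquiv finSumFinEquiv
    (Matrix.fromBlocks g.val 0 0 1 : Matrix (Fin N ⊕ Fin 1) (Fin N ⊕ Fin 1) F) := rfl
  rw [snocEquiv_apply, snocEquiv_apply, h, Matrix.mulVecLin_apply]
  have h1 : ∀ i : Fin N, (finSumFinEquiv (m := N) (n := 1)).symm i.castSucc = Sum.inl i :=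
    fun i => finSumFinEquiv_symm_apply_castAdd i
  have h2 : (finSumFinEquiv (m := N) (n := 1)).symm (Fin.last N) = Sum.inr 0 :=
    finSumFinEquiv_symm_apply_natAdd (0 : Fin 1)
  funext i
  rw [Matrix.mulVec, dotProduct, Fin.sum_univ_castSucc]
  refine Fin.lastCases ?_ (fun i => ?_) i
  · simp [h1, h2]
  · simp [h1, h2, Matrix.mulVec, dotProduct]

section Induced

variable {N : ℕ} {s : ℕ} {m : Fin s → ℕ} (hm : ∑ j, m j = N) {W : Fin s → Type*}
  [∀ j, AddCommGroup (W j)] [∀ j, Module ℂ (W j)]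
  {μ : ∀ j, Representation ℂ (GL (Fin (m j)) F) (W j)}

theorem isIrreducible_parabolicInduction (hm_pos : ∀ j, 0 < m j)
    (hμ_irr : ∀ j, (μ j).IsIrreducible) (hμ_cusp : ∀ j, IsCuspidal (μ j))
    (hμ_dist : ∀ j j', j ≠ j' → ¬ SameRep (μ j) (μ j')) :
    (parabolicInduction hm μ).IsIrreducible := by
  classical
  have := Fintype.ofFinite (GL (Fin N) F)
  have := fun j => finiteDimensional_of_isIrreducible (hμ_irr j)
  have : Invertible (Nat.card (GL (Fin N) F) : ℂ) := invertibleOfNonzero (card_GL_ne_zero N)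
  refine isIrreducible_of_finrank_eq_one _ ?_
  have key := pairing_hallProd_self
    (fun j => isCuspidalFun_toEndFun_dual (hm_pos j) (hμ_irr j) (hμ_cusp j))
    (fun j => isCuspidalFun_toEndFun (hm_pos j) (hμ_irr j) (hμ_cusp j))
    (fun j => by
      rw [pairing_character_eq (hμ_irr j) (hμ_irr j), if_pos]
      exact sameRep_iff_nonempty_equiv.2 ⟨Representation.Equiv.refl _⟩)
    (fun j j' hj => by rw [pairing_character_eq (hμ_irr j) (hμ_irr j'), if_neg (hμ_dist j j' hj)])
    (List.finRange s) (List.nodup_finRange s)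
  rw [← List.ofFn_eq_map, List.sum_ofFn, hm, pairing,
    ← sum_GL_eq _ fun g hg => by rw [hallProd_toEndFun_eq_zero _ _ hg, zero_mul]] at key
  have h := Representation.card_inv_mul_sum_char_mul_char_eq_finrank (parabolicInduction hm μ)
    (parabolicInduction hm μ)
  simp_rw [character_parabolicInduction_inv, character_parabolicInduction] at h
  simp_rw [mul_comm (hallProd (fun j => toEndFun (μ j).character) _ _ _)] at h
  rw [h] at key
  exact_mod_cast key

/-- The Hom dimension averages the character of the source at `g⁻¹` times that of the target at `g`,
so the branching rule is used with the duals of the `π i` and with the `μ j` themselves. Its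
hypothesis `hc` holds since no `π i` is isomorphic to two distinct `μ j`. -/
theorem dimHom_parabolicInduction (hm_pos : ∀ j, 0 < m j)
    (hμ_irr : ∀ j, (μ j).IsIrreducible) (hμ_cusp : ∀ j, IsCuspidal (μ j))
    (hμ_dist : ∀ j j', j ≠ j' → ¬ SameRep (μ j) (μ j'))
    {r : ℕ} {n : Fin r → ℕ} (hn : ∑ i, n i = N + 1) {V : Fin r → Type*}
    [∀ i, AddCommGroup (V i)] [∀ i, Module ℂ (V i)]
    {π : ∀ i, Representation ℂ (GL (Fin (n i)) F) (V i)} (hn_pos : ∀ i, 0 < n i)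
    (hπ_irr : ∀ i, (π i).IsIrreducible) (hπ_cusp : ∀ i, IsCuspidal (π i)) :
    dimHom (parabolicInduction hn π) (parabolicInduction hm μ) =
      ∏ j, (1 + Nat.card {i : Fin r // SameRep (μ j) (π i)}) := by
  classical
  have := Fintype.ofFinite (GL (Fin N) F)
  have := fun j => finiteDimensional_of_isIrreducible (hμ_irr j)
  have := fun i => finiteDimensional_of_isIrreducible (hπ_irr i)
  have : Invertible (Nat.card (GL (Fin N) F) : ℂ) := invertibleOfNonzero (card_GL_ne_zero N)
  -- Any nontrivial additive character will do; the result does not involve it.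
  obtain ⟨ψ, hψ⟩ := AddChar.exists_apply_ne_zero.2 (one_ne_zero (α := F))
  have hψ1 : ψ ≠ 1 := fun h => hψ (by rw [h, AddChar.one_apply])
  have hp : ∀ i j, pairing (m j) (toEndFun (μ j).character) (toEndFun (π i).dual.character) =
      if SameRep (μ j) (π i) then 1 else 0 :=
    fun i j => pairing_character_eq (hμ_irr j) (hπ_irr i)
  have key := sum_blk_mul_hallProd
    (fun i => isCuspidalFun_toEndFun_dual (hn_pos i) (hπ_irr i) (hπ_cusp i))
    (fun j => isCuspidalFun_toEndFun (hm_pos j) (hμ_irr j) (hμ_cusp j))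
    (fun i j j' hj h => by
      rw [hp] at h ⊢
      have h1 : SameRep (μ j) (π i) := by
        by_contra h1
        exact h (if_neg h1)
      exact if_neg fun h2 => hμ_dist j j' hj (h1.trans h2.symm))
    hψ1 (List.finRange r) (List.nodup_finRange r)
    (by rw [← List.ofFn_eq_map, List.sum_ofFn, hn]) (List.finRange s) (List.nodup_finRange s)
    (by rw [← List.ofFn_eq_map, List.sum_ofFn, hm])
  rw [← sum_GL_eq _ fun g hg => by rw [hallProd_toEndFun_eq_zero _ _ hg, mul_zero]] at key
  have h := Representation.card_inv_mul_sum_char_mul_char_eq_finrank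
    ((parabolicInduction hn π).comp (embedGL F N)) (parabolicInduction hm μ)
  have hc : ∀ g, Representation.character ((parabolicInduction hn π).comp (embedGL F N)) g⁻¹ =
      hallProd (fun i => toEndFun (π i).dual.character) (List.finRange r) ((Fin N → F) × F)
        (blk (Matrix.mulVecLin g.val) 0 LinearMap.id) := by
    intro g
    refine Eq.trans ?_ ((character_parabolicInduction_inv hn π (embedGL F N g)).trans ?_)
    · rw [← map_inv]
      rfl
    · exact (isInv_hallProd (fun i => isInv_toEndFun fun x y => (π i).dual.char_conj x y) _
        (snocEquiv F N) _ _ (snocEquiv_blk g)).symm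
  simp_rw [character_parabolicInduction, hc] at h
  simp_rw [mul_comm (hallProd (fun i => toEndFun (π i).dual.character) _ _ _)] at key
  rw [h] at key
  simp_rw [hp, Finset.sum_boole] at key
  rw [dimHom]
  have h2 : ∀ j, Nat.card {i : Fin r // SameRep (μ j) (π i)} =
      ((List.finRange r).toFinset.filter fun i => SameRep (μ j) (π i)).card := by
    intro j
    rw [Nat.card_eq_fintype_card, Fintype.card_subtype, List.toFinset_finRange]
  simp_rw [h2]
  rw [List.toFinset_finRange] at key
  exact_mod_cast key

end Induced

end

end FiniteGL
-- The main theorem.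
theorem mainTheorem2 {F : Type*} [Field F] [Finite F] {N r s : ℕ}
    (n : Fin r → ℕ) (hn_pos : ∀ i, 0 < n i) (hn : ∑ i, n i = N + 1)
    (m : Fin s → ℕ) (hm_pos : ∀ j, 0 < m j) (hm : ∑ j, m j = N)
    {V : Fin r → Type*} [∀ i, AddCommGroup (V i)] [∀ i, Module ℂ (V i)]
    (π : ∀ i, Representation ℂ (GL (Fin (n i)) F) (V i))
    (hπ_irr : ∀ i, (π i).IsIrreducible) (hπ_cusp : ∀ i, FiniteGL.IsCuspidal (π i))
    {W : Fin s → Type*} [∀ j, AddCommGroup (W j)] [∀ j, Module ℂ (W j)]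
    (μ : ∀ j, Representation ℂ (GL (Fin (m j)) F) (W j))
    (hμ_irr : ∀ j, (μ j).IsIrreducible) (hμ_cusp : ∀ j, FiniteGL.IsCuspidal (μ j))
    (hμ_dist : ∀ j j', j ≠ j' → ¬ FiniteGL.SameRep (μ j) (μ j')) :
    (FiniteGL.parabolicInduction hm μ).IsIrreducible ∧
    FiniteGL.dimHom (FiniteGL.parabolicInduction hn π) (FiniteGL.parabolicInduction hm μ) =
      ∏ j, (1 + Nat.card {i : Fin r // FiniteGL.SameRep (μ j) (π i)}) ∧
    1 ≤ ∏ j, (1 + Nat.card {i : Fin r // FiniteGL.SameRep (μ j) (π i)}) ∧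
    ((∀ i i', i ≠ i' → ¬ FiniteGL.SameRep (π i) (π i')) →
      FiniteGL.dimHom (FiniteGL.parabolicInduction hn π) (FiniteGL.parabolicInduction hm μ) =
        2 ^ Nat.card {j : Fin s // ∃ i, FiniteGL.SameRep (μ j) (π i)}) ∧
    (FiniteGL.dimHom (FiniteGL.parabolicInduction hn π) (FiniteGL.parabolicInduction hm μ) = 1 ↔
      ∀ i j, ¬ FiniteGL.SameRep (μ j) (π i)) := by
  have hdim := FiniteGL.dimHom_parabolicInduction hm hm_pos hμ_irr hμ_cusp hμ_dist hn hn_pos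
    hπ_irr hπ_cusp
  have hempty : ∀ j, Nat.card {i : Fin r // FiniteGL.SameRep (μ j) (π i)} = 0 ↔
      ∀ i, ¬ FiniteGL.SameRep (μ j) (π i) := by
    intro j
    rw [Finite.card_eq_zero_iff, isEmpty_subtype]
  refine ⟨FiniteGL.isIrreducible_parabolicInduction hm hm_pos hμ_irr hμ_cusp hμ_dist, hdim,
    Finset.one_le_prod' fun j _ => Nat.le_add_right _ _, fun hπ_dist => ?_, ?_⟩
  · classical
    have h1 : ∀ j, 1 + Nat.card {i : Fin r // FiniteGL.SameRep (μ j) (π i)} =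
        if ∃ i, FiniteGL.SameRep (μ j) (π i) then 2 else 1 := by
      intro j
      split_ifs with h
      · obtain ⟨i, hi⟩ := h
        -- Two indices counted for the same `μ j` would give isomorphic `π i`.
        have : Subsingleton {i : Fin r // FiniteGL.SameRep (μ j) (π i)} := by
          refine ⟨fun a b => Subtype.ext ?_⟩
          by_contra hab
          exact hπ_dist _ _ hab (a.2.symm.trans b.2)
        rw [Nat.card_of_subsingleton ⟨i, hi⟩]
      · rw [(hempty j).2 (not_exists.1 h)]
    rw [hdim, Finset.prod_congr rfl fun j _ => h1 j, Finset.prod_ite, Finset.prod_const,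
      Finset.prod_const_one, mul_one, Nat.card_eq_fintype_card, Fintype.card_subtype]
  · rw [hdim, Finset.prod_eq_one_iff]
    simp only [Finset.mem_univ, true_implies, Nat.add_eq_left, hempty]
    exact forall_comm
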